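/- Let $n\ge 2$, let $m,\rho,\sigma>0$, and let the sign $\pm$ be $+$ (a ball of radius $\rho$ rolls over the outer surface of a fixed sphere of radius $\sigma$ in $\mathbb R^n$) or $-$ with $\sigma\neq\rho$ (it rolls inside the fixed sphere, $\sigma>\rho$, or it is a spherical shell around the fixed sphere, $\sigma<\rho$). Put $D=m\rho^2$ and $\epsilon=\sigma/(\sigma\pm\rho)$. Identify $so(n)^*$ with $so(n)$ by $\langle X,Y\rangle=-\tfrac12\operatorname{tr}(XY)$ and $T^*SO(n)$ with $so(n)^*\times SO(n)$ by left translations, and let $\mathbb I\colon so(n)\to so(n)$ be a symmetric positive definite operator (the inertia operator). For $\gamma\in S^{n-1}$ let $\mathrm{pr}_{\mathfrak v_\gamma}\xi=\xi\gamma\gamma^T+\gamma\gamma^T\xi$ be the orthogonal projection of $so(n)$ onto $\mathfrak v_\gamma=\mathbb R^n\wedge\gamma$, where $x\wedge y=xy^T-yx^T$, and let $\mu(\gamma)=\sqrt{\det(\mathbb I+D\,\mathrm{pr}_{\mathfrak v_\gamma})}$. The Chaplygin ball rolling without slipping over the sphere is described on $T^*SO(n)\times S^{n-1}$, in the variables $(\mathbf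 k,g,\gamma)$, by $$\dot{\mathbf k}=[\mathbf k,\omega],\qquad \dot g=g\,\omega,\qquad \dot\gamma=-\epsilon\,\omega\gamma,\qquad\text{where}\quad \mathbf k=(\mathbb I+D\,\mathrm{pr}_{\mathfrak v_\gamma})\,\omega,\tag{1}$$ and its reduction by the left $SO(n)$-action is the system on $so(n)^*\times S^{n-1}$ given by $$\dot{\mathbf k}=[\mathbf k,\omega],\qquad \dot\gamma=-\epsilon\,\omega\gamma.\tag{2}$$ Let $\Omega$ be the canonical symplectic form of $T^*SO(n)$, $d=\dim SO(n)$, and let $\mathrm d\mathbf k$ and $\mathrm d\gamma$ be the standard volume forms on $so(n)^*$ and $S^{n-1}$. (i) The system (1) has a global flow, which preserves the measure $\mu^{-1}\,\Omega^d\wedge\mathrm d\gamma=\det(\mathbb I+D\,\mathrm{pr}_{\mathfrak v_\gamma})^{-1/2}\,\Omega^d\wedge\mathrm d\gamma$. The reduced system (2) has a global flow, which preserves the measure $\mu^{-1}\,\mathrm d\mathbf k\wedge\mathrm d\gamma=\det(\mathbb I+D\,\mathrm{pr}_{\mathfrak v_\gamma})^{-1/2}\,\mathrm d\mathbf k\wedge\mathrm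 d\gamma$. (ii) Let $E_1,\dots,E_n$ be the standard basis of $\mathbb R^n$, let $a_1,\dots,a_n$ be real numbers with $0<a_ia_j<D$ for $i\ne j$, let $A=\mathrm{diag}(a_1,\dots,a_n)$, and suppose that $\mathbb I(E_i\wedge E_j)=\frac{Da_ia_j}{D-a_ia_j}\,E_i\wedge E_j$ for all $i,j$. Then there is a constant $c>0$ such that $$\mu(\gamma)=c\,\bigl|(\gamma,A^{-1}\gamma)\bigr|^{\frac{n-2}2}\qquad\text{for all }\gamma\in S^{n-1}$$ (if all $a_i$ are positive, then $(\gamma,A^{-1}\gamma)>0$ and the absolute value can be omitted). -/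

import Mathlib

open MeasureTheory

namespace ChaplyginBall

noncomputable section

/-! ### The Lie algebra `so(n)`, the group `SO(n)` and the sphere `S^{n-1}` -/

/-- The Lie algebra `so(n)` of skew-symmetric real matrices, with the commutator as bracket. -/
abbrev LieSO (n : ℕ) := ↥(LieAlgebra.Orthogonal.so (Fin n) ℝ)

/-- The group `SO(n)`. -/
abbrev SO (n : ℕ) := ↥(Matrix.specialOrthogonalGroup (Fin n) ℝ)

/-- The unit sphere `S^{n-1}` of Euclidean space. -/
abbrev UnitSphere (n : ℕ) := ↥(Metric.sphere (0 : EuclideanSpace ℝ (Fin n)) 1)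

instance instMeasurableSpaceLieSO (n : ℕ) : MeasurableSpace (LieSO n) := borel _

instance instBorelSpaceLieSO (n : ℕ) : BorelSpace (LieSO n) := ⟨rfl⟩

instance instMeasurableSpaceSO (n : ℕ) : MeasurableSpace (SO n) := borel _

instance instBorelSpaceSO (n : ℕ) : BorelSpace (SO n) := ⟨rfl⟩

/-- The coordinates of a point of the sphere, as a column vector. -/
def coords {n : ℕ} (γ : UnitSphere n) : Fin n → ℝ :=
  (γ : EuclideanSpace ℝ (Fin n)).ofLp

/-- The invariant scalar product `⟨X, Y⟩ = -(1/2) tr (X Y)` on `so(n)`, by which `so(n)^*` is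
identified with `so(n)`. -/
def killing {n : ℕ} (X Y : LieSO n) : ℝ :=
  -(1 / 2 : ℝ) * ((X : Matrix (Fin n) (Fin n) ℝ) * (Y : Matrix (Fin n) (Fin n) ℝ)).trace

/-- The wedge product `x ∧ y = x yᵀ - y xᵀ` of two vectors, an element of `so(n)`. -/
def wedge {n : ℕ} (x y : Fin n → ℝ) : LieSO n :=
  ⟨Matrix.vecMulVec x y - Matrix.vecMulVec y x, by
    rw [LieAlgebra.Orthogonal.mem_so, Matrix.transpose_sub, Matrix.transpose_vecMulVec,
      Matrix.transpose_vecMulVec, neg_sub]⟩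

/-- The vector `E_i` of the standard basis of `ℝ^n`. -/
def stdVec {n : ℕ} (i : Fin n) : Fin n → ℝ := Pi.single i 1

/-- The pairs `i < j`, which index the orthonormal basis `E_i ∧ E_j` of `so(n)`; their number is
`d = dim SO(n)`. -/
abbrev Pairs (n : ℕ) := {p : Fin n × Fin n // p.1 < p.2}

/-- The basis element `E_i ∧ E_j`, `i < j`. -/
def basisSO {n : ℕ} (p : Pairs n) : LieSO n := wedge (stdVec p.1.1) (stdVec p.1.2)

/-! ### The rolling ball -/

/-- The orthogonal projection of `so(n)` onto `𝔳_γ = ℝ^n ∧ γ`, that is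
`ξ ↦ ξ γ ⊗ γ + γ ⊗ γ ξ = (ξ γ) ∧ γ`. -/
def prV {n : ℕ} (γ : UnitSphere n) : LieSO n →ₗ[ℝ] LieSO n where
  toFun ξ := ⟨(ξ : Matrix (Fin n) (Fin n) ℝ) * Matrix.vecMulVec (coords γ) (coords γ)
      + Matrix.vecMulVec (coords γ) (coords γ) * (ξ : Matrix (Fin n) (Fin n) ℝ), by
    have h := (LieAlgebra.Orthogonal.mem_so (Fin n) ℝ ξ.1).1 ξ.2
    rw [LieAlgebra.Orthogonal.mem_so, Matrix.transpose_add, Matrix.transpose_mul,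
      Matrix.transpose_mul, Matrix.transpose_vecMulVec, h]
    simp only [Matrix.mul_neg, Matrix.neg_mul, neg_add_rev]⟩
  map_add' ξ η := by
    apply Subtype.ext
    change (ξ.1 + η.1) * _ + _ * (ξ.1 + η.1) = (ξ.1 * _ + _ * ξ.1) + (η.1 * _ + _ * η.1)
    rw [Matrix.add_mul, Matrix.mul_add]
    abel
  map_smul' c ξ := by
    apply Subtype.ext
    change (c • ξ.1) * _ + _ * (c • ξ.1) = c • (ξ.1 * _ + _ * ξ.1)
    rw [Matrix.smul_mul, Matrix.mul_smul, smul_add]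

/-- The operator `κ = 𝕀 + D pr_{𝔳_γ}`. -/
def kappa {n : ℕ} (I : LieSO n →ₗ[ℝ] LieSO n) (D : ℝ) (γ : UnitSphere n) :
    LieSO n →ₗ[ℝ] LieSO n :=
  I + D • prV γ

/-- The function `μ(γ) = √(det (𝕀 + D pr_{𝔳_γ}))`. -/
def mu {n : ℕ} (I : LieSO n →ₗ[ℝ] LieSO n) (D : ℝ) (γ : UnitSphere n) : ℝ :=
  Real.sqrt (LinearMap.det (kappa I D γ))

/-- `𝕀` is an inertia operator: symmetric and positive definite, so that
`⟨𝕀 ω, ω⟩` defines a left-invariant metric on `SO(n)`. -/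
structure IsInertia {n : ℕ} (I : LieSO n →ₗ[ℝ] LieSO n) : Prop where
  symm : ∀ X Y, killing (I X) Y = killing X (I Y)
  pos : ∀ X, X ≠ 0 → 0 < killing (I X) X

/-- `T^*SO(n)` in the left trivialization, with the variables `(k, g)`. -/
abbrev CotangentSO (n : ℕ) := LieSO n × SO n

/-- The phase space `T^*SO(n) × S^{n-1}` with the variables `(k, g, γ)`. -/
abbrev PhaseSpace (n : ℕ) := CotangentSO n × UnitSphere n

/-- The phase space `so(n)^* × S^{n-1}` of the reduced system, with the variables `(k, γ)`. -/
abbrev ReducedSpace (n : ℕ) := LieSO n × UnitSphere n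

/-- `t ↦ x t = (k, g, γ)` solves the equations of the rolling ball
`k' = [k, ω]`, `g' = g ω`, `γ' = -ε ω γ`, where the angular velocity `ω` is given by
`k = κ(ω) = 𝕀 ω + D (ω γ ⊗ γ + γ ⊗ γ ω)`. -/
def IsRolling {n : ℕ} (I : LieSO n →ₗ[ℝ] LieSO n) (D ε : ℝ) (x : ℝ → PhaseSpace n) : Prop :=
  ∃ ω : ℝ → LieSO n, ∀ t,
    kappa I D (x t).2 (ω t) = (x t).1.1 ∧
    HasDerivAt (fun s => (x s).1.1) ⁅(x t).1.1, ω t⁆ t ∧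
    HasDerivAt (fun s => ((x s).1.2 : Matrix (Fin n) (Fin n) ℝ))
      (((x t).1.2 : Matrix (Fin n) (Fin n) ℝ) * (ω t : Matrix (Fin n) (Fin n) ℝ)) t ∧
    HasDerivAt (fun s => ((x s).2 : EuclideanSpace ℝ (Fin n)))
      (WithLp.toLp 2
        (-(ε • (ω t : Matrix (Fin n) (Fin n) ℝ).mulVec (coords (x t).2)))) t

/-- `t ↦ x t = (k, γ)` solves the reduced equations `k' = [k, ω]`, `γ' = -ε ω γ`,
where `k = κ(ω)`. -/
def IsReducedRolling {n : ℕ} (I : LieSO n →ₗ[ℝ] LieSO n) (D ε : ℝ)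
    (x : ℝ → ReducedSpace n) : Prop :=
  ∃ ω : ℝ → LieSO n, ∀ t,
    kappa I D (x t).2 (ω t) = (x t).1 ∧
    HasDerivAt (fun s => (x s).1) ⁅(x t).1, ω t⁆ t ∧
    HasDerivAt (fun s => ((x s).2 : EuclideanSpace ℝ (Fin n)))
      (WithLp.toLp 2
        (-(ε • (ω t : Matrix (Fin n) (Fin n) ℝ).mulVec (coords (x t).2)))) t

/-! ### Flows and invariant measures -/

/-- `Φ` is the flow of the system whose solutions, defined for all times, are the curves in
`Sol`: the curve `t ↦ Φ t p` is a solution that starts at `p`. -/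
def IsFlow {P : Type*} (Sol : (ℝ → P) → Prop) (Φ : ℝ → P → P) : Prop :=
  ∀ p, Φ 0 p = p ∧ Sol (fun t => Φ t p)

/-- The system has a global flow, and `ν` is invariant under the flow. -/
def HasInvariantMeasure {P : Type*} [MeasurableSpace P] (Sol : (ℝ → P) → Prop)
    (ν : Measure P) : Prop :=
  (∃ Φ, IsFlow Sol Φ) ∧ ∀ Φ, IsFlow Sol Φ → ∀ t, MeasurePreserving (Φ t) ν ν

/-! ### The measures -/

/-- The canonical symplectic form `Ω = dθ` of `T^*SO(n)` at `(k, g)`. A tangent vector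
`(g ξ, η)` is written as `(ξ, η)`. The canonical 1-form is `θ (ξ, η) = ⟨k, ξ⟩`, and the fields
with constant `(ξ, η)` have the bracket `([ξ₁, ξ₂], 0)`, so that
`dθ(X₁, X₂) = X₁ θ(X₂) - X₂ θ(X₁) - θ([X₁, X₂])` is the formula below. (The opposite sign
convention does not change the measure.) -/
def canonicalForm {n : ℕ} (k : LieSO n) (v w : LieSO n × LieSO n) : ℝ :=
  killing v.2 w.1 - killing w.2 v.1 - killing k ⁅v.1, w.1⁆

/-- The value `(β ∧ ⋯ ∧ β)(v)` (`d = card ι` factors) of the top power of a 2-form `β` on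
`2 d` vectors, which come in `d` pairs and are ordered pair by pair:
`2^{-d} ∑_σ sign σ ∏_i β (v_{σ(i,0)}, v_{σ(i,1)})`. -/
def wedgePower {ι V : Type*} [Fintype ι] [DecidableEq ι] (β : V → V → ℝ)
    (v : ι × Fin 2 → V) : ℝ :=
  (1 / 2 : ℝ) ^ Fintype.card ι *
    ∑ σ : Equiv.Perm (ι × Fin 2), ((Equiv.Perm.sign σ : ℤ) : ℝ) *
      ∏ i : ι, β (v (σ (i, 0))) (v (σ (i, 1)))

/-- The frame `(E_p, 0)`, `(0, E_p)` of `T(T^*SO(n))`, in the left trivialization. -/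
def frame {n : ℕ} (q : Pairs n × Fin 2) : LieSO n × LieSO n :=
  if q.2 = 0 then (basisSO q.1, 0) else (0, basisSO q.1)

/-- The standard volume `dk` on `so(n)^*`: Lebesgue measure in the coordinates `k_{ij}`
given by `k = ∑_{i<j} k_{ij} E_i ∧ E_j`. -/
def volSO (n : ℕ) : Measure (LieSO n) :=
  Measure.map (fun c : Pairs n → ℝ => ∑ p, c p • basisSO p) volume

/-- The measure of the volume form `Ω^d` on `T^*SO(n)`. It has the density `|Ω^d (frame)|` with
respect to the measure `dk × dg` that belongs to the frame; the left-invariant volume on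
`SO(n)` is a Haar measure `dg = haar`. -/
def liouville {n : ℕ} (haar : Measure (SO n)) : Measure (CotangentSO n) :=
  ((volSO n).prod haar).withDensity
    (fun x => ENNReal.ofReal |wedgePower (canonicalForm x.1) (frame (n := n))|)

/-- The standard volume `dγ` on the sphere `S^{n-1}`. -/
def volSphere (n : ℕ) : Measure (UnitSphere n) :=
  (volume : Measure (EuclideanSpace ℝ (Fin n))).toSphere

/-- The measure `1 / √(det (𝕀 + D pr_{𝔳_γ})) Ω^d ∧ dγ` on `T^*SO(n) × S^{n-1}`. -/
def phaseMeasure {n : ℕ} (haar : Measure (SO n)) (I : LieSO n →ₗ[ℝ] LieSO n) (D : ℝ) :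
    Measure (PhaseSpace n) :=
  ((liouville haar).prod (volSphere n)).withDensity
    (fun x => ENNReal.ofReal (1 / mu I D x.2))

/-- The measure `1 / √(det (𝕀 + D pr_{𝔳_γ})) dk ∧ dγ` on `so(n)^* × S^{n-1}`. -/
def reducedMeasure {n : ℕ} (I : LieSO n →ₗ[ℝ] LieSO n) (D : ℝ) :
    Measure (ReducedSpace n) :=
  ((volSO n).prod (volSphere n)).withDensity
    (fun x => ENNReal.ofReal (1 / mu I D x.2))

end

end ChaplyginBall

/-! Part (i) rests on Liouville's theorem: a flow preserves the density `f` when `f` times the field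
has divergence zero. The reduced field extends from the sphere to nonzero vectors `x` by using the
projection of `x / ‖x‖`. Then `κ` is homogeneous of degree zero in `x`, and the field commutes with
dilations. In its divergence the `k`-block is traceless, since `ad` is skew and `κ⁻¹` symmetric, and
a single sum survives from the `x`-block (`trace_fderiv_field`). By Jacobi's formula the logarithmic
derivative of `det(κ)^(-1/2)` along the field is minus that sum (`fderiv_dens`, `trace_T_kapDeriv`),
so the two cancel (`trace_fderiv_dens_smul_field`).

Skewness also makes `‖k‖` and `‖x‖` first integrals. Hence compact shells are invariant, solutions
are global, and cutoffs that depend only on these norms keep the divergence zero. In polar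
coordinates the extended flow is the flow on the sphere times the identity on radii. Cancelling a
finite radial factor gives invariance under a cutoff in `k` (`measurePreserving_cutoff`), and an
exhaustion by `‖k‖` removes the cutoff (`measurePreserving_sphereFlow`).

The full system is a skew product over the reduced one: `g` is multiplied on the right by the
solution of `h' = h ω`, `h(0) = 1`. Haar measure on a compact group is right invariant, and `Ω^d`
has constant value on the left-invariant frame (`wedgePower_canonicalForm`), so the measure is a
constant multiple of the reduced measure times Haar (`full_hasInvariantMeasure`).

For part (ii), the inverse inertia operator is `X ↦ A⁻¹ X A⁻¹ - X / D`, and the projection factors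
through `ℝⁿ` as `ξ ↦ ξ γ` followed by `x ↦ x ∧ γ`. The identity `det (1 + FG) = det (1 + GF)` turns
`det κ` into `det 𝕀` times an `n × n` determinant of a diagonal matrix plus one of rank two, and
applied again it leaves a `2 × 2` determinant (`det_diagonal_mul_rank_two`). -/

namespace ChaplyginBall

open Set Filter Topology
open scoped NNReal ENNReal

/-! ### Global flows of bounded Lipschitz vector fields. -/

section Flow

variable {V : Type*} [NormedAddCommGroup V] [NormedSpace ℝ V]

/-- `Φ` is a flow of the vector field `Y`, defined for all times. -/
def IsFlowOf (Y : V → V) (Φ : ℝ → V → V) : Prop :=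
  (∀ x, Φ 0 x = x) ∧ ∀ x t, HasDerivAt (fun s => Φ s x) (Y (Φ t x)) t

variable {Y : V → V} {Φ : ℝ → V → V} {K : ℝ≥0}

theorem integralCurve_ext (hY : LipschitzWith K Y) {α β : ℝ → V}
    (hα : ∀ t, HasDerivAt α (Y (α t)) t) (hβ : ∀ t, HasDerivAt β (Y (β t)) t) {t₀ : ℝ}
    (h : α t₀ = β t₀) : α = β :=
  ODE_solution_unique_univ (v := fun _ => Y) (s := fun _ => univ) (K := K) (t₀ := t₀)
    (fun _ => hY.lipschitzOnWith) (fun t => ⟨hα t, trivial⟩) (fun t => ⟨hβ t, trivial⟩) h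

theorem exists_integralCurve [CompleteSpace V] (hY : LipschitzWith K Y) {M : ℝ≥0}
    (hM : ∀ x, ‖Y x‖ ≤ M) (x : V) : ∃ α : ℝ → V, α 0 = x ∧ ∀ t, HasDerivAt α (Y (α t)) t := by
  have key : ∀ N : ℕ, ∃ α : ℝ → V, α 0 = x ∧
      ∀ t ∈ Ioo (-(N + 1 : ℝ)) (N + 1), HasDerivAt α (Y (α t)) t := by
    intro N
    have h0 : (0 : ℝ) ∈ Icc (-(N + 1 : ℝ)) (N + 1) := ⟨by linarith [N.cast_nonneg (α := ℝ)],
      by positivity⟩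
    -- A curve of speed at most `M` moves at most `M (N + 1)` in time `N + 1`, so the
    -- Picard-Lindelöf radius can be matched to any time interval.
    have hpl : IsPicardLindelof (fun _ => Y) (⟨0, h0⟩ : Icc (-(N + 1 : ℝ)) (N + 1)) x
        (M * (N + 1)) 0 M K :=
      IsPicardLindelof.of_time_independent (fun y _ => hM y) hY.lipschitzOnWith (by simp)
    obtain ⟨α, h1, h2⟩ := hpl.exists_eq_forall_mem_Icc_hasDerivWithinAt₀
    exact ⟨α, h1, fun t ht => (h2 t (Ioo_subset_Icc_self ht)).hasDerivAt (Icc_mem_nhds ht.1 ht.2)⟩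
  choose α h0 hα using key
  have agree : ∀ N N' : ℕ, N ≤ N' → EqOn (α N) (α N') (Ioo (-(N + 1 : ℝ)) (N + 1)) := by
    intro N N' h
    have h' : (N : ℝ) ≤ N' := by exact_mod_cast h
    refine ODE_solution_unique_of_mem_Ioo (v := fun _ => Y) (s := fun _ => univ) (K := K) (t₀ := 0)
      (fun _ _ => hY.lipschitzOnWith) ⟨by linarith [N.cast_nonneg (α := ℝ)], by positivity⟩
      (fun t ht => ⟨hα N t ht, trivial⟩)
      (fun t ht => ⟨hα N' t ⟨by linarith [ht.1], by linarith [ht.2]⟩, trivial⟩) ?_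
    rw [h0, h0]
  have eq1 : ∀ (N : ℕ) (t : ℝ), t ∈ Ioo (-(N + 1 : ℝ)) (N + 1) → α ⌈|t|⌉₊ t = α N t := by
    intro N t ht
    rcases le_total ⌈|t|⌉₊ N with h | h
    · refine agree _ _ h ⟨?_, ?_⟩
      · linarith [Nat.le_ceil |t|, neg_abs_le t]
      · linarith [Nat.le_ceil |t|, le_abs_self t]
    · exact (agree _ _ h ht).symm
  -- Gluing: the local curve with index `⌈|t|⌉` lives on an open interval that contains `t`, and by
  -- uniqueness all local curves agree where they overlap.
  refine ⟨fun t => α ⌈|t|⌉₊ t, by simpa using h0 0, fun t => ?_⟩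
  have ht : t ∈ Ioo (-((⌈|t|⌉₊ : ℕ) + 1 : ℝ)) ((⌈|t|⌉₊ : ℕ) + 1) :=
    ⟨by linarith [Nat.le_ceil |t|, neg_abs_le t], by linarith [Nat.le_ceil |t|, le_abs_self t]⟩
  refine (hα _ t ht).congr_of_eventuallyEq ?_
  filter_upwards [Ioo_mem_nhds ht.1 ht.2] with s hs using eq1 _ s hs

theorem exists_isFlowOf [CompleteSpace V] (hY : LipschitzWith K Y) {M : ℝ≥0}
    (hM : ∀ x, ‖Y x‖ ≤ M) : ∃ Φ, IsFlowOf Y Φ := by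
  choose α h0 hα using exists_integralCurve hY hM
  exact ⟨fun t x => α x t, h0, hα⟩

theorem IsFlowOf.eq_curve (h : IsFlowOf Y Φ) (hY : LipschitzWith K Y) {α : ℝ → V}
    (hα : ∀ t, HasDerivAt α (Y (α t)) t) (t : ℝ) : Φ t (α 0) = α t :=
  congrFun (integralCurve_ext hY (h.2 (α 0)) hα (t₀ := 0) (h.1 _)) t

theorem IsFlowOf.add_apply (h : IsFlowOf Y Φ) (hY : LipschitzWith K Y) (s t : ℝ) (x : V) :
    Φ (s + t) x = Φ s (Φ t x) := by
  have := h.eq_curve hY (α := fun r => Φ (r + t) x) (fun r => (h.2 x (r + t)).comp_add_const r t) s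
  simpa using this.symm

theorem IsFlowOf.reverse (h : IsFlowOf Y Φ) : IsFlowOf (fun x => -Y x) (fun t => Φ (-t)) := by
  refine ⟨fun x => by simpa using h.1 x, fun x t => ?_⟩
  simpa [Function.comp_def] using (h.2 x (-t)).scomp t (hasDerivAt_neg t)

theorem IsFlowOf.lipschitzWith_of_nonneg (h : IsFlowOf Y Φ) (hY : LipschitzWith K Y) {t : ℝ}
    (ht : 0 ≤ t) : LipschitzWith (Real.exp (K * t)).toNNReal (Φ t) := by
  refine LipschitzWith.of_dist_le_mul fun x y => ?_
  have := dist_le_of_trajectories_ODE (v := fun _ => Y) (a := 0) (b := t) (K := K)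
    (f := fun s => Φ s x) (g := fun s => Φ s y) (fun _ => hY)
    (fun s _ => (h.2 x s).continuousAt.continuousWithinAt) (fun s _ => (h.2 x s).hasDerivWithinAt)
    (fun s _ => (h.2 y s).continuousAt.continuousWithinAt) (fun s _ => (h.2 y s).hasDerivWithinAt)
    (le_refl _) t ⟨ht, le_rfl⟩
  rw [Real.coe_toNNReal _ (Real.exp_pos _).le, mul_comm]
  simpa [h.1] using this

theorem IsFlowOf.exists_lipschitzWith (h : IsFlowOf Y Φ) (hY : LipschitzWith K Y) (t : ℝ) :
    ∃ C, LipschitzWith C (Φ t) := by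
  rcases le_total 0 t with ht | ht
  · exact ⟨_, h.lipschitzWith_of_nonneg hY ht⟩
  · have hY' : LipschitzWith K (fun x => -Y x) := hY.neg
    have := h.reverse.lipschitzWith_of_nonneg hY' (neg_nonneg.2 ht)
    simp only [neg_neg] at this
    exact ⟨_, this⟩

theorem IsFlowOf.continuous (h : IsFlowOf Y Φ) (hY : LipschitzWith K Y) (t : ℝ) :
    Continuous (Φ t) :=
  (h.exists_lipschitzWith hY t).choose_spec.continuous

theorem IsFlowOf.lipschitzWith_time (h : IsFlowOf Y Φ) {M : ℝ≥0} (hM : ∀ x, ‖Y x‖ ≤ M) (x : V) :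
    LipschitzWith M (fun t => Φ t x) :=
  lipschitzWith_of_nnnorm_deriv_le (fun t => (h.2 x t).differentiableAt) fun t => by
    rw [(h.2 x t).deriv]
    exact hM _

end Flow

/-! ### Liouville's theorem with a density. -/

section Liouville

/-- Thickened indicators of a closed set are Lipschitz and converge to its indicator. Lipschitz test
functions are chosen because this class is stable under composition with the flow of a Lipschitz
field. -/
theorem ext_of_forall_integral_eq_of_lipschitz {V : Type*} [PseudoMetricSpace V]
    [MeasurableSpace V] [BorelSpace V] {μ ν : Measure V} [IsFiniteMeasure μ]
    [IsFiniteMeasure ν]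
    (h : ∀ (φ : V → ℝ) (C : ℝ≥0), LipschitzWith C φ → (∀ x, ‖φ x‖ ≤ 1) →
      ∫ x, φ x ∂μ = ∫ x, φ x ∂ν) : μ = ν := by
  refine ext_of_generate_finite _ (BorelSpace.measurable_eq.trans borel_eq_generateFrom_isClosed)
    isPiSystem_isClosed ?_ ?_
  · intro F hF
    have hδ : ∀ n : ℕ, (0 : ℝ) < 1 / (n + 1) := fun n => Nat.one_div_pos_of_nat
    have hlim : Tendsto (fun n : ℕ => (1 : ℝ) / (n + 1)) atTop (𝓝 0) :=
      tendsto_one_div_add_atTop_nhds_zero_nat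
    have t1 := tendsto_lintegral_thickenedIndicator_of_isClosed μ hF hδ hlim
    have t2 := tendsto_lintegral_thickenedIndicator_of_isClosed ν hF hδ hlim
    refine tendsto_nhds_unique t1 (t2.congr fun n => ?_)
    have e := h (fun x => (thickenedIndicator (hδ n) F x : ℝ)) _
      (NNReal.isometry_coe.lipschitz.comp (lipschitzWith_thickenedIndicator (hδ n) F)) (fun x => by
        rw [Real.norm_of_nonneg (NNReal.coe_nonneg _)]
        exact_mod_cast thickenedIndicator_le_one (hδ n) F x)
    rw [← BoundedContinuousFunction.toReal_lintegral_coe_eq_integral (thickenedIndicator (hδ n) F),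
      ← BoundedContinuousFunction.toReal_lintegral_coe_eq_integral (thickenedIndicator (hδ n) F)] at e
    exact ((ENNReal.toReal_eq_toReal_iff'
      (BoundedContinuousFunction.lintegral_lt_top_of_nnreal _ _).ne
      (BoundedContinuousFunction.lintegral_lt_top_of_nnreal _ _).ne).1 e).symm
  · have := h (fun _ => 1) 0 (LipschitzWith.const 1) (by simp)
    simpa [Measure.real, ENNReal.toReal_eq_toReal_iff'] using this

variable {V : Type*} [NormedAddCommGroup V] [NormedSpace ℝ V] [FiniteDimensional ℝ V]
  [MeasurableSpace V] [BorelSpace V]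

/-- The divergence theorem for a divergence-free compactly supported field, paired with a
Lipschitz function. -/
theorem integral_fderiv_apply_eq_zero (vol : Measure V) [vol.IsAddHaarMeasure] {Z : V → V}
    (hZ : ContDiff ℝ 1 Z) (hc : HasCompactSupport Z)
    (hdiv : ∀ x, LinearMap.trace ℝ V (fderiv ℝ Z x : V →ₗ[ℝ] V) = 0)
    {ψ : V → ℝ} {C : ℝ≥0} (hψ : LipschitzWith C ψ) :
    ∫ x, fderiv ℝ ψ x (Z x) ∂vol = 0 := by
  let b := Module.finBasis ℝ V
  let c : Fin (Module.finrank ℝ V) → V →L[ℝ] ℝ := fun i =>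
    LinearMap.toContinuousLinearMap (b.coord i)
  have hci : ∀ i, ContDiff ℝ 1 (fun x => c i (Z x)) := fun i => (c i).contDiff.comp hZ
  have hcc : ∀ i, HasCompactSupport (fun x => c i (Z x)) := fun i =>
    hc.comp_left (g := c i) (map_zero _)
  have hlip : ∀ i, ∃ D, LipschitzWith D (fun x => c i (Z x)) := fun i =>
    (hci i).lipschitzWith_of_hasCompactSupport (hcc i) one_ne_zero
  -- Rademacher's theorem: the Lipschitz function is differentiable almost everywhere, so its
  -- derivative expands in directional derivatives.
  have hexp : ∀ᵐ x ∂vol, fderiv ℝ ψ x (Z x) = ∑ i, lineDeriv ℝ ψ x (b i) * c i (Z x) := by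
    filter_upwards [hψ.ae_differentiableAt (μ := vol)] with x hx
    conv_lhs => rw [← b.sum_repr (Z x)]
    rw [map_sum]
    refine Finset.sum_congr rfl fun i _ => ?_
    rw [map_smul, hx.lineDeriv_eq_fderiv, smul_eq_mul, mul_comm]
    rfl
  have hint : ∀ i, Integrable (fun x => lineDeriv ℝ ψ x (b i) * c i (Z x)) vol := by
    intro i
    have h1 : Integrable (fun x => c i (Z x)) vol :=
      (hci i).continuous.integrable_of_hasCompactSupport (hcc i)
    refine h1.bdd_mul (c := C * ‖b i‖) (stronglyMeasurable_lineDeriv hψ.continuous).aestronglyMeasurable ?_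
    exact ae_of_all _ fun x => norm_lineDeriv_le_of_lipschitz ℝ hψ
  have hint' : ∀ i, Integrable (fun x => lineDeriv ℝ (fun x => c i (Z x)) x (-b i) * ψ x) vol := by
    intro i
    have e : (fun x => lineDeriv ℝ (fun x => c i (Z x)) x (-b i) * ψ x) =
        fun x => (fderiv ℝ (fun x => c i (Z x)) x (-b i)) * ψ x := by
      funext x
      rw [((hci i).differentiable one_ne_zero x).lineDeriv_eq_fderiv]
    rw [e]
    refine Continuous.integrable_of_hasCompactSupport ?_ ?_
    · exact (((hci i).continuous_fderiv one_ne_zero).clm_apply continuous_const).mul hψ.continuous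
    · exact ((hcc i).fderiv_apply (𝕜 := ℝ) (-b i)).mul_right
  rw [integral_congr_ae hexp, integral_finsetSum _ fun i _ => hint i]
  -- Integration by parts moves each directional derivative onto the components of `Z`; their sum is
  -- the divergence.
  have : ∀ i, ∫ x, lineDeriv ℝ ψ x (b i) * c i (Z x) ∂vol =
      ∫ x, lineDeriv ℝ (fun x => c i (Z x)) x (-b i) * ψ x ∂vol := fun i =>
    LipschitzWith.integral_lineDeriv_mul_eq hψ (hlip i).choose_spec (hcc i) (b i)
  simp_rw [this]
  rw [← integral_finsetSum _ fun i _ => hint' i]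
  refine integral_eq_zero_of_ae (ae_of_all _ fun x => ?_)
  have hZx : HasFDerivAt Z (fderiv ℝ Z x) x := (hZ.differentiable one_ne_zero x).hasFDerivAt
  have h2 : ∀ i, lineDeriv ℝ (fun x => c i (Z x)) x (-b i) =
      -(b.repr (fderiv ℝ Z x (b i)) i) := by
    intro i
    have : HasFDerivAt (fun x => c i (Z x)) ((c i).comp (fderiv ℝ Z x)) x :=
      (c i).hasFDerivAt.comp x hZx
    rw [this.differentiableAt.lineDeriv_eq_fderiv, this.fderiv, map_neg]
    rfl
  have h3 := hdiv x
  rw [LinearMap.trace_eq_matrix_trace ℝ b, Matrix.trace] at h3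
  simp only [Matrix.diag, LinearMap.toMatrix_apply] at h3
  simp only [h2, ← Finset.sum_mul, Finset.sum_neg_distrib, Pi.zero_apply]
  rw [show (∑ i, b.repr (fderiv ℝ Z x (b i)) i) = 0 from h3]
  simp

/-- **Liouville's theorem**: if `f Y` is a divergence-free field, then the flow of `Y` preserves
the measure with density `f`. -/
theorem IsFlowOf.measurePreserving (vol : Measure V) [vol.IsAddHaarMeasure] {Y : V → V}
    {Φ : ℝ → V → V} {K M : ℝ≥0} (h : IsFlowOf Y Φ) (hY : LipschitzWith K Y)
    (hM : ∀ x, ‖Y x‖ ≤ M) {f : V → ℝ} (hf : Continuous f) (hfc : HasCompactSupport f)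
    (hf0 : ∀ x, 0 ≤ f x) (hZ : ContDiff ℝ 1 (fun x => f x • Y x))
    (hdiv : ∀ x, LinearMap.trace ℝ V (fderiv ℝ (fun x => f x • Y x) x : V →ₗ[ℝ] V) = 0) (t : ℝ) :
    MeasurePreserving (Φ t) (vol.withDensity fun x => ENNReal.ofReal (f x))
      (vol.withDensity fun x => ENNReal.ofReal (f x)) := by
  have hint : Integrable f vol := hf.integrable_of_hasCompactSupport hfc
  have hfm : Measurable fun x => ENNReal.ofReal (f x) := hf.measurable.ennreal_ofReal
  have hfin : IsFiniteMeasure (vol.withDensity fun x => ENNReal.ofReal (f x)) :=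
    isFiniteMeasure_withDensity_ofReal hint.2
  -- At time zero the derivative under the integral is the derivative of `ψ` along `f Y`, whose
  -- integral vanishes by the divergence theorem.
  have key : ∀ (ψ : V → ℝ) (C : ℝ≥0), LipschitzWith C ψ →
      HasDerivAt (fun s => ∫ x, ψ (Φ s x) * f x ∂vol) 0 0 := by
    intro ψ C hψ
    have hzero := integral_fderiv_apply_eq_zero vol hZ hfc.smul_right hdiv hψ
    have := (hasDerivAt_integral_of_dominated_loc_of_lip (μ := vol) (𝕜 := ℝ) (x₀ := (0 : ℝ))
      (F := fun s x => ψ (Φ s x) * f x) (F' := fun x => fderiv ℝ ψ x (f x • Y x))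
      (bound := fun x => (C * M) * f x) (s := univ) univ_mem ?_ ?_ ?_ ?_ ?_ ?_).2
    · rwa [hzero] at this
    · exact Eventually.of_forall fun s =>
        ((hψ.continuous.comp (h.continuous hY s)).mul hf).aestronglyMeasurable
    · exact ((hψ.continuous.comp (h.continuous hY 0)).mul hf).integrable_of_hasCompactSupport
        hfc.mul_left
    · exact ContinuousLinearMap.aestronglyMeasurable_comp₂ (ContinuousLinearMap.id ℝ (V →L[ℝ] ℝ))
        (measurable_fderiv ℝ ψ).aestronglyMeasurable hZ.continuous.aestronglyMeasurable
    · refine ae_of_all _ fun x => LipschitzWith.lipschitzOnWith ?_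
      refine LipschitzWith.of_dist_le_mul fun s s' => ?_
      have h1 := (hψ.comp (h.lipschitzWith_time hM x)).dist_le_mul s s'
      simp only [Function.comp_apply, NNReal.coe_mul] at h1
      have h2 : 0 ≤ C * M * f x := mul_nonneg (by positivity) (hf0 x)
      rw [Real.dist_eq, ← sub_mul, abs_mul, abs_of_nonneg (hf0 x), Real.coe_nnabs, abs_of_nonneg h2,
        ← Real.dist_eq]
      nlinarith [hf0 x, mul_le_mul_of_nonneg_right h1 (hf0 x)]
    · exact hint.const_mul _
    · filter_upwards [hψ.ae_differentiableAt (μ := vol)] with x hx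
      have h1 := h.2 x 0
      rw [h.1] at h1
      have h2 : HasFDerivAt ψ (fderiv ℝ ψ x) (Φ 0 x) := by rw [h.1]; exact hx.hasFDerivAt
      have h3 := (h2.comp_hasDerivAt (0 : ℝ) h1).mul_const (f x)
      rw [map_smul, smul_eq_mul, mul_comm]
      exact h3
  have const : ∀ (φ : V → ℝ) (C : ℝ≥0), LipschitzWith C φ → ∀ s,
      ∫ x, φ (Φ s x) * f x ∂vol = ∫ x, φ x * f x ∂vol := by
    intro φ C hφ s
    -- The group property reduces time `s` to time zero with the test function `φ ∘ Φ s`, which is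
    -- again Lipschitz.
    have hd : ∀ s, HasDerivAt (fun s => ∫ x, φ (Φ s x) * f x ∂vol) 0 s := by
      intro s
      obtain ⟨C', hC'⟩ := h.exists_lipschitzWith hY s
      have := key (fun x => φ (Φ s x)) _ (hφ.comp hC')
      simp only [← h.add_apply hY] at this
      have h2 : HasDerivAt (fun r => ∫ x, φ (Φ (s + (r - s)) x) * f x ∂vol) 0 s := by
        have h0 : HasDerivAt (fun s_1 => ∫ x, φ (Φ (s + s_1) x) * f x ∂vol) 0 (s - s) := by
          rwa [sub_self]
        simpa using h0.comp_sub_const s s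
      simpa using h2
    have := is_const_of_deriv_eq_zero (fun s => (hd s).differentiableAt) (fun s => (hd s).deriv) s 0
    simpa [h.1] using this
  refine ⟨(h.continuous hY t).measurable, ?_⟩
  have hfin' := Measure.isFiniteMeasure_map (vol.withDensity fun x => ENNReal.ofReal (f x)) (Φ t)
  refine ext_of_forall_integral_eq_of_lipschitz fun φ C hφ _ => ?_
  rw [integral_map (h.continuous hY t).aemeasurable hφ.continuous.aestronglyMeasurable]
  have e : ∀ g : V → ℝ, ∫ x, g x ∂(vol.withDensity fun x => ENNReal.ofReal (f x)) =
      ∫ x, g x * f x ∂vol := by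
    intro g
    rw [integral_withDensity_eq_integral_toReal_smul hfm (ae_of_all _ fun x => ENNReal.ofReal_lt_top)]
    refine integral_congr_ae (ae_of_all _ fun x => ?_)
    simp [ENNReal.toReal_ofReal (hf0 x), mul_comm]
  rw [e, e]
  exact const φ C hφ t

end Liouville

end ChaplyginBall

namespace ChaplyginBall

open Set Filter Topology
open scoped NNReal ENNReal

/-! ### Cutting off a field near a compact invariant set. -/

section Cutoff

variable {V W : Type*} [NormedAddCommGroup V] [NormedSpace ℝ V] [NormedAddCommGroup W]
  [NormedSpace ℝ W]

theorem contDiff_smul_of_tsupport {n : ℕ∞} {χ : V → ℝ} {X : V → W} (hχ : ContDiff ℝ n χ)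
    (hX : ∀ x ∈ tsupport χ, ContDiffAt ℝ n X x) : ContDiff ℝ n (fun x => χ x • X x) := by
  refine contDiff_iff_contDiffAt.2 fun x => ?_
  by_cases hx : x ∈ tsupport χ
  · exact hχ.contDiffAt.smul (hX x hx)
  · refine (contDiffAt_const (c := (0 : W))).congr_of_eventuallyEq ?_
    filter_upwards [(notMem_tsupport_iff_eventuallyEq.1 hx)] with y hy
    simp [hy]

/-- A field that is `C¹` near a compact set agrees there with a bounded Lipschitz multiple. -/
theorem exists_lipschitz_cutoff [FiniteDimensional ℝ V] {X : V → V} {C : Set V}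
    (hC : IsCompact C) (hX : ∀ x ∈ C, ContDiffAt ℝ 1 X x) :
    ∃ (χ : V → ℝ) (K M : ℝ≥0), (∀ x ∈ C, χ x = 1) ∧ LipschitzWith K (fun x => χ x • X x) ∧
      ∀ x, ‖χ x • X x‖ ≤ M := by
  have hU : IsOpen {x | ContDiffAt ℝ 1 X x} := by
    rw [isOpen_iff_mem_nhds]
    intro x hx
    exact ContDiffAt.eventually hx (by simp)
  obtain ⟨L, hL, hCL, hLU⟩ := exists_compact_between hC hU hX
  obtain ⟨f, hf1, hf0, -⟩ := exists_contMDiffMap_one_nhds_of_subset_interior (n := 1)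
    (modelWithCornersSelf ℝ V) hC.isClosed hCL
  have hf : ContDiff ℝ 1 f := f.contMDiff.contDiff
  have hts : tsupport f ⊆ L := by
    refine closure_minimal (fun x hx => ?_) hL.isClosed
    by_contra h
    exact hx (hf0 x h)
  have hZ : ContDiff ℝ 1 (fun x => f x • X x) :=
    contDiff_smul_of_tsupport (n := 1) hf fun x hx => hLU (hts hx)
  have hc : HasCompactSupport (fun x => f x • X x) :=
    HasCompactSupport.smul_right (hL.of_isClosed_subset (isClosed_tsupport _) hts)
  obtain ⟨K, hK⟩ := hZ.lipschitzWith_of_hasCompactSupport hc one_ne_zero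
  obtain ⟨M, hM⟩ := hc.exists_bound_of_continuous hZ.continuous
  exact ⟨f, K, M.toNNReal, fun x hx => (hf1.self_of_nhdsSet x hx), hK, fun x =>
    (hM x).trans (Real.le_coe_toNNReal M)⟩

/-- If `C` is a compact set which is invariant under all fields proportional to `X`, and `X` is
`C¹` near `C`, then there is a global Lipschitz flow that solves the equation of `X` on `C`. -/
theorem exists_cutoff_flow [FiniteDimensional ℝ V] {X : V → V} {C : Set V}
    (hC : IsCompact C) (hX : ∀ x ∈ C, ContDiffAt ℝ 1 X x)
    (hinv : ∀ (χ : V → ℝ) (α : ℝ → V), (∀ t, HasDerivAt α (χ (α t) • X (α t)) t) → α 0 ∈ C →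
      ∀ t, α t ∈ C) :
    ∃ (Y : V → V) (Φ : ℝ → V → V) (K M : ℝ≥0), (∀ x ∈ C, Y x = X x) ∧ LipschitzWith K Y ∧
      (∀ x, ‖Y x‖ ≤ M) ∧ IsFlowOf Y Φ ∧ ∀ x ∈ C, ∀ t, Φ t x ∈ C := by
  obtain ⟨χ, K, M, h1, hK, hM⟩ := exists_lipschitz_cutoff hC hX
  have : CompleteSpace V := FiniteDimensional.complete ℝ V
  obtain ⟨Φ, hΦ⟩ := exists_isFlowOf hK hM
  refine ⟨_, Φ, K, M, fun x hx => by simp [h1 x hx], hK, hM, hΦ, fun x hx t => ?_⟩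
  -- The constructed flow belongs to `χ X`, and `χ = 1` along a curve is known only once the curve
  -- stays in `C`; for this reason `hinv` is needed for all multiples of `X`.
  exact hinv χ (fun s => Φ s x) (hΦ.2 x) (by rwa [hΦ.1]) t

end Cutoff

end ChaplyginBall

namespace ChaplyginBall

open Set Filter Topology
open scoped NNReal ENNReal RealInnerProductSpace

/-! ### Traces of products with skew operators, and Jacobi's formula. -/

section Trace

variable {K : Type*} [NormedAddCommGroup K] [InnerProductSpace ℝ K]

theorem trace_eq_zero_of_skew [FiniteDimensional ℝ K] {S : K →ₗ[ℝ] K} (hS : ∀ x, ⟪S x, x⟫ = 0) :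
    LinearMap.trace ℝ K S = 0 := by
  rw [LinearMap.trace_eq_sum_inner S (stdOrthonormalBasis ℝ K)]
  exact Finset.sum_eq_zero fun i _ => by rw [real_inner_comm, hS]

theorem inner_skew {S : K →ₗ[ℝ] K} (hS : ∀ x, ⟪S x, x⟫ = 0) (x y : K) :
    ⟪S x, y⟫ = -⟪x, S y⟫ := by
  have := hS (x + y)
  rw [map_add, inner_add_left, inner_add_right, inner_add_right, hS, hS] at this
  rw [real_inner_comm (S y) x]
  linarith

/-- Taking adjoints gives `tr (S T) = -tr (T S)`, while cyclicity gives `tr (S T) = tr (T S)`. -/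
theorem trace_skew_comp_symm [FiniteDimensional ℝ K] {S T : K →ₗ[ℝ] K} (hS : ∀ x, ⟪S x, x⟫ = 0)
    (hT : ∀ x y, ⟪T x, y⟫ = ⟪x, T y⟫) : LinearMap.trace ℝ K (S ∘ₗ T) = 0 := by
  have h1 : LinearMap.trace ℝ K (S ∘ₗ T) = -LinearMap.trace ℝ K (T ∘ₗ S) := by
    rw [LinearMap.trace_eq_sum_inner _ (stdOrthonormalBasis ℝ K),
      LinearMap.trace_eq_sum_inner _ (stdOrthonormalBasis ℝ K), ← Finset.sum_neg_distrib]
    refine Finset.sum_congr rfl fun i _ => ?_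
    rw [LinearMap.comp_apply, LinearMap.comp_apply, real_inner_comm, inner_skew hS, hT]
  have h2 := LinearMap.trace_comp_comm' S T
  linarith

end Trace

section Det

variable {K : Type*} [NormedAddCommGroup K] [NormedSpace ℝ K] [FiniteDimensional ℝ K]

theorem contDiff_det {n : WithTop ℕ∞} :
    ContDiff ℝ n (fun A : K →L[ℝ] K => LinearMap.det (A : K →ₗ[ℝ] K)) := by
  let b := Module.finBasis ℝ K
  have h : ∀ A : K →L[ℝ] K, LinearMap.det (A : K →ₗ[ℝ] K) =
      ∑ σ : Equiv.Perm (Fin (Module.finrank ℝ K)), ((Equiv.Perm.sign σ : ℤ) : ℝ) *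
        ∏ i, b.repr (A (b i)) (σ i) := by
    intro A
    rw [← LinearMap.det_toMatrix b, Matrix.det_apply']
    simp [LinearMap.toMatrix_apply]
  simp_rw [h]
  refine ContDiff.sum fun σ _ => contDiff_const.mul (contDiff_prod fun i _ => ?_)
  exact ((LinearMap.toContinuousLinearMap (b.coord (σ i))).comp
    (ContinuousLinearMap.apply ℝ K (b i))).contDiff

theorem det_one_add_smul_eq (A : K →ₗ[ℝ] K) :
    ∃ p : Polynomial ℝ, ∀ h : ℝ, LinearMap.det (1 + h • A) =
      1 + LinearMap.trace ℝ K A * h + p.eval h * h ^ 2 := by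
  let b := Module.finBasis ℝ K
  refine ⟨(Matrix.det (1 + (Polynomial.X : Polynomial ℝ) •
    (LinearMap.toMatrix b b A).map Polynomial.C)).divX.divX, fun h => ?_⟩
  rw [← LinearMap.det_toMatrix b, map_add, map_smul, LinearMap.toMatrix_one,
    Matrix.det_one_add_smul, LinearMap.trace_eq_matrix_trace ℝ b]

/-- Jacobi's formula at an invertible operator. -/
theorem fderiv_det {B T : K →L[ℝ] K} (hB : B.comp T = 1) (A : K →L[ℝ] K) :
    fderiv ℝ (fun A : K →L[ℝ] K => LinearMap.det (A : K →ₗ[ℝ] K)) B A =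
      LinearMap.det (B : K →ₗ[ℝ] K) * LinearMap.trace ℝ K (T.comp A : K →L[ℝ] K) := by
  have hd : HasFDerivAt (fun A : K →L[ℝ] K => LinearMap.det (A : K →ₗ[ℝ] K)) _ (B + (0 : ℝ) • A) :=
    (contDiff_det.differentiable one_ne_zero _).hasFDerivAt
  have hl : HasDerivAt (fun h : ℝ => B + h • A) A 0 := by
    simpa using ((hasDerivAt_id (0 : ℝ)).smul_const A).const_add B
  have h1 := hd.comp_hasDerivAt (0 : ℝ) hl
  obtain ⟨p, hp⟩ := det_one_add_smul_eq (T.comp A : K →L[ℝ] K).toLinearMap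
  -- Since `B T = 1`, one has `B + h A = B (1 + h T A)`; the expansion of `det (1 + h T A)` to first
  -- order then gives the trace.
  have h2 : (fun h : ℝ => LinearMap.det ((B + h • A : K →L[ℝ] K) : K →ₗ[ℝ] K)) = fun h =>
      LinearMap.det (B : K →ₗ[ℝ] K) *
        (1 + LinearMap.trace ℝ K (T.comp A : K →L[ℝ] K) * h + p.eval h * h ^ 2) := by
    funext h
    rw [← hp, ← LinearMap.det_comp]
    congr 1
    ext x
    have := congrArg (fun f : K →L[ℝ] K => f (A x)) hB
    simp at this
    simp [this]
  have h3 : HasDerivAt (fun h : ℝ => LinearMap.det (B : K →ₗ[ℝ] K) *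
        (1 + LinearMap.trace ℝ K (T.comp A : K →L[ℝ] K) * h + p.eval h * h ^ 2))
      (LinearMap.det (B : K →ₗ[ℝ] K) * LinearMap.trace ℝ K (T.comp A : K →L[ℝ] K)) 0 := by
    have := ((((hasDerivAt_id (0 : ℝ)).const_mul (LinearMap.trace ℝ K (T.comp A : K →L[ℝ] K))).const_add 1).add
      ((p.hasDerivAt 0).mul ((hasDerivAt_id (0 : ℝ)).pow 2))).const_mul
        (LinearMap.det (B : K →ₗ[ℝ] K))
    simpa using this
  have h4 : HasDerivAt (fun h : ℝ => LinearMap.det ((B + h • A : K →L[ℝ] K) : K →ₗ[ℝ] K)) _ 0 := h1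
  rw [h2] at h4
  have := h4.unique h3
  simpa using this

end Det

end ChaplyginBall

/-! ### The rolling field on a linear space, for an abstract bracket and skew action. -/

namespace ChaplyginBall

open Set Filter Topology
open scoped NNReal ENNReal RealInnerProductSpace

/-- The data of the equations `k' = [k, ω]`, `x' = -ε ω x`, `k = 𝕀 ω + D pr ω`, with a bracket
`br` and an action `act` by skew operators; `wedge x y` is dual to `ξ ↦ ⟪x, ξ y⟫`. -/
structure RollingData (K E : Type*) [NormedAddCommGroup K] [InnerProductSpace ℝ K]
    [NormedAddCommGroup E] [InnerProductSpace ℝ E] where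
  br : K →L[ℝ] K →L[ℝ] K
  act : K →L[ℝ] E →L[ℝ] E
  wedge : E →L[ℝ] E →L[ℝ] K
  inertia : K →L[ℝ] K
  D : ℝ
  ε : ℝ
  inner_br_left : ∀ k w, ⟪br k w, k⟫ = 0
  inner_br_right : ∀ k w, ⟪br k w, w⟫ = 0
  inner_act : ∀ w x, ⟪act w x, x⟫ = 0
  inner_wedge : ∀ x y w, ⟪wedge x y, w⟫ = ⟪x, act w y⟫
  inertia_symm : ∀ x y, ⟪inertia x, y⟫ = ⟪x, inertia y⟫
  inertia_pos : ∀ x, x ≠ 0 → 0 < ⟪inertia x, x⟫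
  D_nonneg : 0 ≤ D

namespace RollingData

variable {K E : Type*} [NormedAddCommGroup K] [InnerProductSpace ℝ K]
    [NormedAddCommGroup E] [InnerProductSpace ℝ E] (R : RollingData K E)

theorem inner_act_left (w : K) (x y : E) : ⟪R.act w x, y⟫ = -⟪x, R.act w y⟫ :=
  inner_skew (S := (R.act w : E →ₗ[ℝ] E)) (R.inner_act w) x y

theorem inner_wedge_right (x y : E) (w : K) : ⟪w, R.wedge x y⟫ = ⟪x, R.act w y⟫ := by
  rw [real_inner_comm, R.inner_wedge]

theorem wedge_antisymm (x y : E) : R.wedge x y = -R.wedge y x := by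
  refine ext_inner_right ℝ fun w => ?_
  rw [inner_neg_left, R.inner_wedge, R.inner_wedge, ← R.inner_act_left, real_inner_comm]

theorem wedge_self (x : E) : R.wedge x x = 0 := by
  refine ext_inner_right ℝ fun w => ?_
  rw [R.inner_wedge, real_inner_comm, R.inner_act, inner_zero_left]

/-- The bilinear map whose diagonal is `ξ ↦ (ξ x) ∧ x`. -/
noncomputable def prB : E →L[ℝ] E →L[ℝ] K →L[ℝ] K :=
  (ContinuousLinearMap.compL ℝ K E K).bilinearComp R.wedge.flip R.act.flip

@[simp] theorem prB_apply (x y : E) (ξ : K) : R.prB x y ξ = R.wedge (R.act ξ y) x := rfl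

/-- `𝕀 + D pr`, where `pr` belongs to the normalized vector `x / ‖x‖`. -/
noncomputable def kap (x : E) : K →L[ℝ] K :=
  R.inertia + (R.D * (‖x‖ ^ 2)⁻¹) • R.prB x x

theorem kap_symm (x : E) (ξ η : K) : ⟪R.kap x ξ, η⟫ = ⟪ξ, R.kap x η⟫ := by
  simp only [kap, add_apply, smul_apply, prB_apply,
    inner_add_left, inner_add_right, inner_smul_left, inner_smul_right, R.inertia_symm,
    R.inner_wedge, R.inner_wedge_right, real_inner_comm (R.act ξ x)]
  simp

/-- By duality of `wedge` and `act`, the projection term contributes `D ‖x‖⁻² ‖ξ x‖² ≥ 0`. This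
includes `x = 0`, where the inverse is zero by convention, so `kap` is invertible everywhere. -/
theorem kap_pos (x : E) {ξ : K} (h : ξ ≠ 0) : 0 < ⟪R.kap x ξ, ξ⟫ := by
  simp only [kap, add_apply, smul_apply, prB_apply,
    inner_add_left, inner_smul_left, R.inner_wedge]
  have h1 := R.inertia_pos ξ h
  have h2 : 0 ≤ R.D * (‖x‖ ^ 2)⁻¹ * ⟪R.act ξ x, R.act ξ x⟫ :=
    mul_nonneg (mul_nonneg R.D_nonneg (by positivity)) real_inner_self_nonneg
  simp only [conj_trivial]
  linarith

theorem kap_injective (x : E) : Function.Injective (R.kap x) := by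
  refine (injective_iff_map_eq_zero (R.kap x)).2 fun ξ hξ => ?_
  by_contra h
  have := R.kap_pos x h
  rw [hξ, inner_zero_left] at this
  exact lt_irrefl _ this

/-- Homogeneity of degree zero is what makes the extended system commute with dilations and lets the
radius split off later. -/
theorem kap_smul {r : ℝ} (hr : r ≠ 0) (x : E) : R.kap (r • x) = R.kap x := by
  unfold kap
  congr 1
  rw [map_smul, map_smul, smul_apply, smul_smul, smul_smul, norm_smul, mul_pow,
    Real.norm_eq_abs, sq_abs]
  congr 1
  field_simp

/-- The inverse operator of `kap x`. -/
noncomputable def T (x : E) : K →L[ℝ] K := Ring.inverse (R.kap x)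

theorem T_smul {r : ℝ} (hr : r ≠ 0) (x : E) : R.T (r • x) = R.T x := by
  rw [T, R.kap_smul hr, T]

/-- The vector field of the rolling equations. -/
noncomputable def field (p : K × E) : K × E :=
  (R.br p.1 (R.T p.2 p.1), -(R.ε • R.act (R.T p.2 p.1) p.2))

/-- The derivative of `kap`. -/
noncomputable def kapDeriv (x δ : E) : K →L[ℝ] K :=
  (R.D * (‖x‖ ^ 2)⁻¹) • (R.prB x δ + R.prB δ x) -
    (R.D * (2 * ⟪x, δ⟫ * ((‖x‖ ^ 2)⁻¹) ^ 2)) • R.prB x x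

theorem contDiffAt_scale (x : E) (hx : x ≠ 0) :
    ContDiffAt ℝ 1 (fun x : E => (R.D * (‖x‖ ^ 2)⁻¹)) x := by
  have h0 : ‖x‖ ^ 2 ≠ 0 := by positivity
  exact contDiffAt_const.mul ((contDiff_norm_sq ℝ).contDiffAt.inv h0)

theorem contDiff_prB : ContDiff ℝ 1 (fun x : E => R.prB x x) := by
  fun_prop

theorem contDiffAt_kap {x : E} (hx : x ≠ 0) : ContDiffAt ℝ 1 R.kap x := by
  have h3 : ContDiffAt ℝ 1 (fun x : E => (R.D * (‖x‖ ^ 2)⁻¹) • R.prB x x) x :=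
    (R.contDiffAt_scale x hx).smul R.contDiff_prB.contDiffAt
  have h4 : ContDiffAt ℝ 1 (fun x : E => R.inertia + (R.D * (‖x‖ ^ 2)⁻¹) • R.prB x x) x :=
    contDiffAt_const.add h3
  exact h4

theorem fderiv_kap {x : E} (hx : x ≠ 0) (δ : E) : fderiv ℝ R.kap x δ = R.kapDeriv x δ := by
  have h1 : HasFDerivAt (fun x : E => (‖x‖ ^ 2)) (2 • innerSL ℝ x) x :=
    (hasStrictFDerivAt_norm_sq x).hasFDerivAt
  have h2 := ((hasDerivAt_inv (x := ‖x‖ ^ 2) (by positivity)).comp_hasFDerivAt x h1).const_mul R.D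
  have h3 : HasFDerivAt (fun x : E => R.prB x x) _ x :=
    (R.prB.hasFDerivAt (x := x)).clm_apply (hasFDerivAt_id x)
  have h4 : HasFDerivAt R.kap _ x := (h2.smul h3).const_add R.inertia
  rw [h4.fderiv]
  ext ξ
  simp [kapDeriv, sub_eq_add_neg, mul_comm (2 * ⟪x, δ⟫)]

variable [FiniteDimensional ℝ K]

theorem isUnit_kap (x : E) : IsUnit (R.kap x) := by
  have := FiniteDimensional.complete ℝ K
  rw [ContinuousLinearMap.isUnit_iff_isUnit_toLinearMap, LinearMap.isUnit_iff_ker_eq_bot]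
  exact LinearMap.ker_eq_bot.2 (R.kap_injective x)

theorem kap_comp_T (x : E) : (R.kap x).comp (R.T x) = 1 :=
  Ring.mul_inverse_cancel _ (R.isUnit_kap x)

theorem kap_T (x : E) (k : K) : R.kap x (R.T x k) = k :=
  congrArg (fun f : K →L[ℝ] K => f k) (R.kap_comp_T x)

theorem T_symm (x : E) (ξ η : K) : ⟪R.T x ξ, η⟫ = ⟪ξ, R.T x η⟫ := by
  conv_lhs => rw [← R.kap_T x η, ← R.kap_symm, R.kap_T]

/-- The determinant of `𝕀 + D pr` is positive: a symmetric positive definite operator. -/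
theorem det_kap_pos (x : E) : 0 < LinearMap.det (R.kap x : K →ₗ[ℝ] K) := by
  have hsymm : (R.kap x : K →ₗ[ℝ] K).IsSymmetric := R.kap_symm x
  rw [hsymm.det_eq_prod_eigenvalues rfl]
  simp only [RCLike.ofReal_real_eq_id, id]
  refine Finset.prod_pos fun i _ => ?_
  have h := hsymm.apply_eigenvectorBasis rfl i
  have hne : hsymm.eigenvectorBasis rfl i ≠ 0 := (hsymm.eigenvectorBasis rfl).orthonormal.ne_zero i
  have h1 := R.kap_pos x hne
  have h2 : ⟪R.kap x (hsymm.eigenvectorBasis rfl i), hsymm.eigenvectorBasis rfl i⟫ =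
      hsymm.eigenvalues rfl i := by
    have h3 : R.kap x (hsymm.eigenvectorBasis rfl i) = _ := h
    rw [h3, inner_smul_left]
    simp
  rwa [h2] at h1

theorem contDiffAt_T {x : E} (hx : x ≠ 0) : ContDiffAt ℝ 1 R.T x := by
  have := FiniteDimensional.complete ℝ K
  obtain ⟨u, hu⟩ := R.isUnit_kap x
  have h := contDiffAt_ringInverse ℝ (n := 1) u
  rw [hu] at h
  exact h.comp x (R.contDiffAt_kap hx)

theorem fderiv_T {x : E} (hx : x ≠ 0) (δ : E) :
    fderiv ℝ R.T x δ = -((R.T x).comp ((R.kapDeriv x δ).comp (R.T x))) := by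
  have := FiniteDimensional.complete ℝ K
  obtain ⟨u, hu⟩ := R.isUnit_kap x
  have h := hasFDerivAt_ringInverse (𝕜 := ℝ) u
  rw [hu] at h
  have h1 := ((R.contDiffAt_kap hx).differentiableAt one_ne_zero).hasFDerivAt
  have h2 : HasFDerivAt R.T _ x := h.comp x h1
  have h3 : (↑u⁻¹ : K →L[ℝ] K) = R.T x := by rw [T, ← hu, Ring.inverse_unit]
  rw [h2.fderiv, h3]
  simp [R.fderiv_kap hx]
  rfl

theorem contDiffAt_field {p : K × E} (hp : p.2 ≠ 0) :
    ContDiffAt ℝ 1 R.field p := by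
  have hT : ContDiffAt ℝ 1 (fun p : K × E => R.T p.2 p.1) p :=
    ((R.contDiffAt_T hp).comp p contDiffAt_snd).clm_apply contDiffAt_fst
  refine ContDiffAt.prodMk ?_ ?_
  · exact (R.br.contDiff.contDiffAt.comp p contDiffAt_fst).clm_apply hT
  · exact (contDiffAt_const.smul
      ((R.act.contDiff.contDiffAt.comp p hT).clm_apply contDiffAt_snd)).neg

end RollingData

end ChaplyginBall

/-! ### The divergence of the rolling field. -/

namespace ChaplyginBall

open Set Filter Topology
open scoped NNReal ENNReal RealInnerProductSpace

theorem trace_prod {V W : Type*} [NormedAddCommGroup V] [NormedSpace ℝ V] [NormedAddCommGroup W]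
    [NormedSpace ℝ W] [FiniteDimensional ℝ V] [FiniteDimensional ℝ W] (A : V × W →ₗ[ℝ] V × W) :
    LinearMap.trace ℝ (V × W) A =
      LinearMap.trace ℝ V (LinearMap.fst ℝ V W ∘ₗ A ∘ₗ LinearMap.inl ℝ V W) +
      LinearMap.trace ℝ W (LinearMap.snd ℝ V W ∘ₗ A ∘ₗ LinearMap.inr ℝ V W) := by
  have h : A = (A ∘ₗ LinearMap.inl ℝ V W) ∘ₗ LinearMap.fst ℝ V W +
      (A ∘ₗ LinearMap.inr ℝ V W) ∘ₗ LinearMap.snd ℝ V W := by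
    refine LinearMap.ext fun p => ?_
    simp [← map_add]
  conv_lhs => rw [h, map_add]
  rw [LinearMap.trace_comp_comm' (LinearMap.fst ℝ V W), LinearMap.trace_comp_comm' (LinearMap.snd ℝ V W)]

namespace RollingData

variable {K E : Type*} [NormedAddCommGroup K] [InnerProductSpace ℝ K]
    [NormedAddCommGroup E] [InnerProductSpace ℝ E] (R : RollingData K E)
    [FiniteDimensional ℝ K] [FiniteDimensional ℝ E]

/-- The sum which gives, up to a factor, both the divergence of the field and the logarithmic
derivative of the density. -/
noncomputable def wedgeSum (x y : E) : ℝ :=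
  ∑ i, ⟪R.T x (R.wedge (stdOrthonormalBasis ℝ E i) x), R.wedge y (stdOrthonormalBasis ℝ E i)⟫

/-- The operator factors through `E` as `ξ ↦ ξ y` followed by `v ↦ T (v ∧ x)`, so cyclicity turns
the trace over `K` into a sum over a basis of `E`. -/
theorem trace_T_prB (x y : E) :
    LinearMap.trace ℝ K ((R.T x).comp (R.prB x y) : K →L[ℝ] K) = -R.wedgeSum x y := by
  have h : (((R.T x).comp (R.prB x y) : K →L[ℝ] K) : K →ₗ[ℝ] K) =
      ((R.T x).comp (R.wedge.flip x) : E →ₗ[ℝ] K) ∘ₗ (R.act.flip y : K →ₗ[ℝ] E) := by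
    ext ξ
    simp
  rw [h, LinearMap.trace_comp_comm', LinearMap.trace_eq_sum_inner _ (stdOrthonormalBasis ℝ E),
    wedgeSum, ← Finset.sum_neg_distrib]
  refine Finset.sum_congr rfl fun i _ => ?_
  simp only [LinearMap.comp_apply, ContinuousLinearMap.coe_coe, ContinuousLinearMap.comp_apply,
    ContinuousLinearMap.flip_apply]
  rw [← R.inner_wedge, R.wedge_antisymm, inner_neg_left, real_inner_comm]

/-- The other polarization has the same trace because `T` is symmetric. -/
theorem trace_T_prB' (x y : E) :
    LinearMap.trace ℝ K ((R.T x).comp (R.prB y x) : K →L[ℝ] K) = -R.wedgeSum x y := by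
  have h : (((R.T x).comp (R.prB y x) : K →L[ℝ] K) : K →ₗ[ℝ] K) =
      ((R.T x).comp (R.wedge.flip y) : E →ₗ[ℝ] K) ∘ₗ (R.act.flip x : K →ₗ[ℝ] E) := by
    ext ξ
    simp
  rw [h, LinearMap.trace_comp_comm', LinearMap.trace_eq_sum_inner _ (stdOrthonormalBasis ℝ E),
    wedgeSum, ← Finset.sum_neg_distrib]
  refine Finset.sum_congr rfl fun i _ => ?_
  simp only [LinearMap.comp_apply, ContinuousLinearMap.coe_coe, ContinuousLinearMap.comp_apply,
    ContinuousLinearMap.flip_apply]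
  rw [← R.inner_wedge, ← R.T_symm, R.wedge_antisymm y, inner_neg_right, neg_neg]

/-- The angular velocity `ω` as a function of `(k, x)`. -/
noncomputable def omega (p : K × E) : K := R.T p.2 p.1

/-- The `E`-component of the field is `-ε ω x`, orthogonal to `x`, so the derivative of `‖x‖⁻²`
drops out. The two polarizations contribute equally, whence the factor 2. -/
theorem trace_T_kapDeriv (p : K × E) :
    LinearMap.trace ℝ K ((R.T p.2).comp (R.kapDeriv p.2 (R.field p).2) : K →L[ℝ] K) =
      2 * (R.ε * (R.D * (‖p.2‖ ^ 2)⁻¹) * R.wedgeSum p.2 (R.act (R.omega p) p.2)) := by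
  have h0 : ⟪p.2, (R.field p).2⟫ = 0 := by
    simp only [field, inner_neg_right, inner_smul_right]
    rw [real_inner_comm, R.inner_act, mul_zero, neg_zero]
  have h1 : (R.field p).2 = (-R.ε) • R.act (R.omega p) p.2 := by
    rw [neg_smul]; rfl
  rw [kapDeriv, h0, h1]
  simp only [map_smul, smul_apply, mul_zero, zero_mul, zero_smul, sub_zero,
    ContinuousLinearMap.comp_smul, ContinuousLinearMap.comp_add, ← smul_add,
    ContinuousLinearMap.toLinearMap_smul, ContinuousLinearMap.toLinearMap_add, map_add]
  rw [R.trace_T_prB, R.trace_T_prB']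
  simp only [smul_eq_mul]
  ring

/-- The `k`-block is `η ↦ [η, ω] + [k, T η]`: a skew operator plus a skew operator composed with a
symmetric one, hence traceless. In the `x`-block the explicit factor `x` gives the skew term `-ε ω
δ`, and differentiating `T` gives three sums, of which `t2` and `t3` vanish. -/
theorem trace_fderiv_field {p : K × E} (hp : p.2 ≠ 0) :
    LinearMap.trace ℝ (K × E) (fderiv ℝ R.field p : K × E →ₗ[ℝ] K × E) =
      R.ε * (R.D * (‖p.2‖ ^ 2)⁻¹) * R.wedgeSum p.2 (R.act (R.omega p) p.2) := by
  obtain ⟨k, x⟩ := p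
  simp only at hp
  have hd : HasFDerivAt R.field (fderiv ℝ R.field (k, x)) (k, x) :=
    ((R.contDiffAt_field (p := (k, x)) hp).differentiableAt one_ne_zero).hasFDerivAt
  rw [trace_prod]
  have e1 : LinearMap.fst ℝ K E ∘ₗ (fderiv ℝ R.field (k, x) : K × E →ₗ[ℝ] K × E) ∘ₗ
      LinearMap.inl ℝ K E = (R.br.flip (R.T x k) : K →ₗ[ℝ] K) +
        (R.br k : K →ₗ[ℝ] K) ∘ₗ (R.T x : K →ₗ[ℝ] K) := by
    have h1 : HasFDerivAt (fun η => R.br η (R.T x η))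
        ((ContinuousLinearMap.fst ℝ K E).comp ((fderiv ℝ R.field (k, x)).comp
          (ContinuousLinearMap.inl ℝ K E))) k :=
      (ContinuousLinearMap.fst ℝ K E).hasFDerivAt.comp k
        (HasFDerivAt.comp (f := fun e => (e, x)) k hd (hasFDerivAt_prodMk_left k x))
    have h2 : HasFDerivAt (fun η => R.br η (R.T x η)) _ k :=
      (R.br.hasFDerivAt (x := k)).clm_apply ((R.T x).hasFDerivAt (x := k))
    have := h1.unique h2
    ext η
    have := congrArg (fun f : K →L[ℝ] K => f η) this
    simpa [add_comm] using this
  have e2 : ∀ δ, (LinearMap.snd ℝ K E ∘ₗ (fderiv ℝ R.field (k, x) : K × E →ₗ[ℝ] K × E) ∘ₗ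
      LinearMap.inr ℝ K E) δ = R.ε • R.act (R.T x (R.kapDeriv x δ (R.T x k))) x -
        R.ε • R.act (R.T x k) δ := by
    intro δ
    have h1 : HasFDerivAt (fun y => -(R.ε • R.act (R.T y k) y))
        ((ContinuousLinearMap.snd ℝ K E).comp ((fderiv ℝ R.field (k, x)).comp
          (ContinuousLinearMap.inr ℝ K E))) x :=
      (ContinuousLinearMap.snd ℝ K E).hasFDerivAt.comp x
        (HasFDerivAt.comp (f := fun e => (k, e)) x hd (hasFDerivAt_prodMk_right k x))
    have hT : HasFDerivAt R.T (fderiv ℝ R.T x) x :=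
      ((R.contDiffAt_T hp).differentiableAt one_ne_zero).hasFDerivAt
    have h2 : HasFDerivAt (fun y => R.T y k) _ x := hT.clm_apply (hasFDerivAt_const k x)
    have h3 : HasFDerivAt (fun y => R.act (R.T y k)) _ x := R.act.hasFDerivAt.comp x h2
    have h4 : HasFDerivAt (fun y => -(R.ε • R.act (R.T y k) y)) _ x :=
      ((h3.clm_apply (hasFDerivAt_id x)).const_smul R.ε).neg
    have := congrArg (fun f : E →L[ℝ] E => f δ) (h1.unique h4)
    simp [R.fderiv_T hp] at this
    simpa [sub_eq_add_neg, add_comm] using this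
  rw [e1, map_add, trace_eq_zero_of_skew (fun η => R.inner_br_left η _),
    trace_skew_comp_symm (fun η => R.inner_br_right k η) (R.T_symm x), zero_add, zero_add,
    LinearMap.trace_eq_sum_inner _ (stdOrthonormalBasis ℝ E)]
  simp only [e2]
  set ω := R.T x k with hω
  set b := stdOrthonormalBasis ℝ E
  set y := R.act ω x
  set c := R.D * (‖x‖ ^ 2)⁻¹
  have t1 : ∑ i, ⟪b i, R.act ω (b i)⟫ = 0 :=
    Finset.sum_eq_zero fun i _ => by rw [real_inner_comm, R.inner_act]
  -- The operator `v ↦ T (v ∧ x) x` on `E` is symmetric, so its product with the skew operator `ω`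
  -- is traceless.
  have t2 : ∑ i, ⟪R.T x (R.wedge (b i) x), R.wedge (R.act ω (b i)) x⟫ = 0 := by
    have := trace_skew_comp_symm (S := (R.act ω : E →ₗ[ℝ] E))
      (T := (R.act.flip x : K →ₗ[ℝ] E) ∘ₗ (R.T x : K →ₗ[ℝ] K) ∘ₗ (R.wedge.flip x : E →ₗ[ℝ] K))
      (R.inner_act ω) (fun u v => by
        simp only [LinearMap.comp_apply, ContinuousLinearMap.coe_coe,
          ContinuousLinearMap.flip_apply]
        rw [← R.inner_wedge, real_inner_comm, ← R.inner_wedge, ← R.T_symm, real_inner_comm])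
    rw [LinearMap.trace_eq_sum_inner _ b] at this
    rw [← neg_eq_zero, ← this, ← Finset.sum_neg_distrib]
    refine Finset.sum_congr rfl fun i _ => ?_
    simp only [LinearMap.comp_apply, ContinuousLinearMap.coe_coe, ContinuousLinearMap.flip_apply]
    rw [real_inner_comm, R.inner_wedge, R.inner_act_left, neg_neg]
  -- This sum comes from the derivative of `‖x‖⁻²`; summing the weights `⟪x, b i⟫` against `b i`
  -- yields `x`, and `x ∧ x = 0`.
  have t3 : ∑ i, ⟪x, b i⟫ * ⟪R.T x (R.wedge (b i) x), R.wedge y x⟫ = 0 := by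
    have h : ∑ i, ⟪x, b i⟫ • b i = x := by
      simpa only [real_inner_comm] using b.sum_repr' x
    have h2 : ∑ i, ⟪x, b i⟫ * ⟪R.T x (R.wedge (b i) x), R.wedge y x⟫ =
        ⟪R.T x (R.wedge (∑ i, ⟪x, b i⟫ • b i) x), R.wedge y x⟫ := by
      simp [map_sum, sum_inner, inner_smul_left]
    rw [h2, h, R.wedge_self, map_zero, inner_zero_left]
  have key : ∀ i, ⟪b i, R.ε • R.act (R.T x (R.kapDeriv x (b i) ω)) x - R.ε • R.act ω (b i)⟫ =
      R.ε * (c * ⟪R.T x (R.wedge (b i) x), R.wedge (R.act ω (b i)) x⟫ +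
        c * ⟪R.T x (R.wedge (b i) x), R.wedge y (b i)⟫
        - R.D * 2 * ((‖x‖ ^ 2)⁻¹) ^ 2 *
          (⟪x, b i⟫ * ⟪R.T x (R.wedge (b i) x), R.wedge y x⟫)) - R.ε * ⟪b i, R.act ω (b i)⟫ := by
    intro i
    rw [inner_sub_right, inner_smul_right, inner_smul_right, ← R.inner_wedge, ← R.T_symm]
    simp only [kapDeriv, sub_apply, add_apply, smul_apply, prB_apply, inner_sub_right,
      inner_add_right, inner_smul_right]
    ring
  simp_rw [key]
  rw [Finset.sum_sub_distrib, ← Finset.mul_sum, ← Finset.mul_sum, Finset.sum_sub_distrib,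
    Finset.sum_add_distrib, ← Finset.mul_sum, ← Finset.mul_sum, ← Finset.mul_sum, t1, t2, t3]
  simp only [wedgeSum]
  change R.ε * (c * 0 + c * ∑ i, ⟪R.T x (R.wedge (b i) x), R.wedge y (b i)⟫ - _ * 0) - R.ε * 0 =
    R.ε * c * ∑ i, ⟪R.T x (R.wedge (b i) x), R.wedge y (b i)⟫
  ring

end RollingData

end ChaplyginBall

/-! ### First integrals, invariant shells and the invariant density. -/

namespace ChaplyginBall

open Set Filter Topology
open scoped NNReal ENNReal RealInnerProductSpace

theorem norm_sq_const {F : Type*} [NormedAddCommGroup F] [InnerProductSpace ℝ F] {α α' : ℝ → F}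
    (h : ∀ t, HasDerivAt α (α' t) t) (h0 : ∀ t, ⟪α t, α' t⟫ = 0) (t s : ℝ) :
    ‖α t‖ ^ 2 = ‖α s‖ ^ 2 := by
  have hd : ∀ t, HasDerivAt (fun t => ‖α t‖ ^ 2) 0 t := fun t => by
    have := (h t).norm_sq
    rwa [h0, mul_zero] at this
  exact is_const_of_deriv_eq_zero (fun t => (hd t).differentiableAt) (fun t => (hd t).deriv) t s

section Shell

variable {K E : Type*} [NormedAddCommGroup K] [NormedAddCommGroup E]

/-- A compact set of phase points that contains the unit sphere in its interior. -/
def shell (K E : Type*) [NormedAddCommGroup K]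
    [NormedAddCommGroup E] (r : ℝ) : Set (K × E) :=
  {p | ‖p.1‖ ^ 2 ≤ r ∧ 1 / 2 ≤ ‖p.2‖ ^ 2 ∧ ‖p.2‖ ^ 2 ≤ 3 / 2}

theorem isCompact_shell [ProperSpace K] [ProperSpace E] (r : ℝ) : IsCompact (shell K E r) := by
  refine Metric.isCompact_of_isClosed_isBounded ?_ ?_
  · have h1 : Continuous fun p : K × E => ‖p.1‖ ^ 2 := by fun_prop
    have h2 : Continuous fun p : K × E => ‖p.2‖ ^ 2 := by fun_prop
    exact (isClosed_le h1 continuous_const).inter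
      ((isClosed_le continuous_const h2).inter (isClosed_le h2 continuous_const))
  · refine (Metric.isBounded_closedBall (x := (0 : K)) (r := |r| + 1)).prod
      (Metric.isBounded_closedBall (x := (0 : E)) (r := 2)) |>.subset fun p hp => ⟨?_, ?_⟩
    · rw [mem_closedBall_zero_iff]
      nlinarith [hp.1, le_abs_self r, abs_nonneg r, norm_nonneg p.1]
    · rw [mem_closedBall_zero_iff]
      nlinarith [hp.2.2, norm_nonneg p.2]

theorem ne_zero_of_mem_shell {r : ℝ} {p : K × E} (hp : p ∈ shell K E r) : p.2 ≠ 0 := by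
  intro h
  have := hp.2.1
  rw [h, norm_zero] at this
  norm_num at this

/-- The cutoff function of the second component. -/
noncomputable def radialBump : ContDiffBump (1 : ℝ) := ⟨1 / 4, 1 / 2, by norm_num, by norm_num⟩

/-- The cutoff function of the first component. -/
noncomputable def sizeBump (r : ℝ) (hr : 0 < r) : ContDiffBump (0 : ℝ) := ⟨r, r + 1, hr, by linarith⟩

/-- The cutoff function of the phase points. -/
noncomputable def shellCutoff (r : ℝ) (hr : 0 < r) (p : K × E) : ℝ :=
  sizeBump r hr (‖p.1‖ ^ 2) * radialBump (‖p.2‖ ^ 2)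

theorem shellCutoff_nonneg (r : ℝ) (hr : 0 < r) (p : K × E) : 0 ≤ shellCutoff r hr p :=
  mul_nonneg (sizeBump r hr).nonneg radialBump.nonneg

theorem support_shellCutoff_subset (r : ℝ) (hr : 0 < r) :
    Function.support (shellCutoff (K := K) (E := E) r hr) ⊆ shell K E (r + 1) := by
  intro p h
  have h1 : ‖p.1‖ ^ 2 ∈ Function.support (sizeBump r hr) := left_ne_zero_of_mul h
  have h2 : ‖p.2‖ ^ 2 ∈ Function.support radialBump := right_ne_zero_of_mul h
  rw [ContDiffBump.support_eq, Metric.mem_ball, Real.dist_eq] at h1 h2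
  rw [abs_lt] at h1 h2
  simp only [sizeBump, radialBump] at h1 h2
  exact ⟨by linarith, by linarith, by linarith⟩

end Shell

namespace RollingData

variable {K E : Type*} [NormedAddCommGroup K] [InnerProductSpace ℝ K]
    [NormedAddCommGroup E] [InnerProductSpace ℝ E] (R : RollingData K E)

theorem inner_field_fst (p : K × E) : ⟪p.1, (R.field p).1⟫ = 0 := by
  rw [field, real_inner_comm, R.inner_br_left]

theorem inner_field_snd (p : K × E) : ⟪p.2, (R.field p).2⟫ = 0 := by
  rw [field, inner_neg_right, inner_smul_right, real_inner_comm, R.inner_act, mul_zero, neg_zero]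

/-- The norms of both components are constant along the integral curves of every field
proportional to the rolling field. -/
theorem norm_sq_curve {α : ℝ → K × E} {c : ℝ → ℝ}
    (h : ∀ t, HasDerivAt α (c t • R.field (α t)) t) (t s : ℝ) :
    ‖(α t).1‖ ^ 2 = ‖(α s).1‖ ^ 2 ∧ ‖(α t).2‖ ^ 2 = ‖(α s).2‖ ^ 2 := by
  constructor
  · refine norm_sq_const (α := fun t => (α t).1) (fun t => (h t).fst) (fun t => ?_) t s
    rw [Prod.smul_fst, inner_smul_right, R.inner_field_fst, mul_zero]
  · refine norm_sq_const (α := fun t => (α t).2) (fun t => (h t).snd) (fun t => ?_) t s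
    rw [Prod.smul_snd, inner_smul_right, R.inner_field_snd, mul_zero]

/-- The density `1 / √(det (𝕀 + D pr))`. -/
noncomputable def dens (x : E) : ℝ := (Real.sqrt (LinearMap.det (R.kap x : K →ₗ[ℝ] K)))⁻¹

theorem dens_smul {r : ℝ} (hr : r ≠ 0) (x : E) : R.dens (r • x) = R.dens x := by
  rw [dens, R.kap_smul hr, dens]

theorem dens_nonneg (x : E) : 0 ≤ R.dens x := inv_nonneg.2 (Real.sqrt_nonneg _)

theorem contDiff_shellCutoff (r : ℝ) (hr : 0 < r) :
    ContDiff ℝ 1 (shellCutoff (K := K) (E := E) r hr) := by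
  refine ContDiff.mul ?_ ?_
  · exact (sizeBump r hr).contDiff.comp ((contDiff_norm_sq ℝ).comp contDiff_fst)
  · exact radialBump.contDiff.comp ((contDiff_norm_sq ℝ).comp contDiff_snd)

/-- The cutoff is a function of the two norms, which are first integrals, so multiplying the density
by it preserves invariance. -/
theorem fderiv_shellCutoff_field (r : ℝ) (hr : 0 < r) (p : K × E) :
    fderiv ℝ (shellCutoff r hr) p (R.field p) = 0 := by
  have hn1 : HasFDerivAt (fun p : K × E => ‖p.1‖ ^ 2) _ p :=
    (hasStrictFDerivAt_norm_sq p.1).hasFDerivAt.comp p hasFDerivAt_fst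
  have hn2 : HasFDerivAt (fun p : K × E => ‖p.2‖ ^ 2) _ p :=
    (hasStrictFDerivAt_norm_sq p.2).hasFDerivAt.comp p hasFDerivAt_snd
  have ha := ((sizeBump r hr).contDiff (n := 1)).differentiable one_ne_zero (‖p.1‖ ^ 2)
  have hb := (radialBump.contDiff (n := 1)).differentiable one_ne_zero (‖p.2‖ ^ 2)
  have h1 := ha.hasFDerivAt.comp p hn1
  have h2 := hb.hasFDerivAt.comp p hn2
  have h3 : HasFDerivAt (shellCutoff r hr) _ p := h1.mul h2
  rw [h3.fderiv]
  simp [R.inner_field_fst, R.inner_field_snd]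

variable [FiniteDimensional ℝ K]

theorem contDiffAt_dens {x : E} (hx : x ≠ 0) : ContDiffAt ℝ 1 R.dens x := by
  have h1 : ContDiffAt ℝ 1 (fun x => LinearMap.det (R.kap x : K →ₗ[ℝ] K)) x :=
    contDiff_det.contDiffAt.comp x (R.contDiffAt_kap hx)
  have h0 := R.det_kap_pos x
  exact (h1.sqrt h0.ne').inv (Real.sqrt_pos.2 h0).ne'

/-- Jacobi's formula gives the logarithmic derivative of the determinant; the exponent `-1/2` gives
the coefficient. -/
theorem fderiv_dens {x : E} (hx : x ≠ 0) (δ : E) : fderiv ℝ R.dens x δ =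
    -(1 / 2) * R.dens x *
      LinearMap.trace ℝ K ((R.T x).comp (R.kapDeriv x δ) : K →L[ℝ] K) := by
  have h0 := R.det_kap_pos x
  have hk : HasFDerivAt R.kap (fderiv ℝ R.kap x) x :=
    ((R.contDiffAt_kap hx).differentiableAt one_ne_zero).hasFDerivAt
  have hdet : HasFDerivAt (fun A : K →L[ℝ] K => LinearMap.det (A : K →ₗ[ℝ] K)) _ (R.kap x) :=
    (contDiff_det.differentiable one_ne_zero _).hasFDerivAt
  have h1 : HasFDerivAt (fun x => LinearMap.det (R.kap x : K →ₗ[ℝ] K)) _ x := hdet.comp x hk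
  have h2 := h1.sqrt h0.ne'
  have h3 : HasFDerivAt R.dens _ x :=
    (hasDerivAt_inv (Real.sqrt_pos.2 h0).ne').comp_hasFDerivAt x h2
  rw [h3.fderiv]
  simp only [smul_apply, ContinuousLinearMap.comp_apply, fderiv_det (R.kap_comp_T x),
    R.fderiv_kap hx, smul_eq_mul, dens]
  have h4 := Real.sq_sqrt h0.le
  have h5 := (Real.sqrt_pos.2 h0).ne'
  set d := LinearMap.det (R.kap x : K →ₗ[ℝ] K)
  rw [h4]
  field_simp

variable [FiniteDimensional ℝ E]

/-- The divergence of `θ dens X` vanishes if `θ` is constant along `X`. -/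
theorem trace_fderiv_dens_smul_field {θ : K × E → ℝ} {p : K × E} (hp : p.2 ≠ 0)
    (hθ : DifferentiableAt ℝ θ p) (h0 : fderiv ℝ θ p (R.field p) = 0) :
    LinearMap.trace ℝ (K × E)
      (fderiv ℝ (fun p => (θ p * R.dens p.2) • R.field p) p : K × E →ₗ[ℝ] K × E) = 0 := by
  have hd : HasFDerivAt R.field (fderiv ℝ R.field p) p :=
    ((R.contDiffAt_field hp).differentiableAt one_ne_zero).hasFDerivAt
  have hdens : HasFDerivAt R.dens (fderiv ℝ R.dens p.2) p.2 :=
    ((R.contDiffAt_dens hp).differentiableAt one_ne_zero).hasFDerivAt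
  have h1 : HasFDerivAt (fun p : K × E => R.dens p.2) _ p := hdens.comp p hasFDerivAt_snd
  have h2 := (hθ.hasFDerivAt.mul h1)
  have h3 : HasFDerivAt (fun p => (θ p * R.dens p.2) • R.field p) _ p := h2.smul hd
  rw [h3.fderiv, ContinuousLinearMap.toLinearMap_add, map_add, ContinuousLinearMap.toLinearMap_smul,
    map_smul, R.trace_fderiv_field hp]
  have h4 : ∀ (l : K × E →L[ℝ] ℝ) (v : K × E),
      LinearMap.trace ℝ (K × E) (l.smulRight v : K × E →L[ℝ] K × E) = l v := fun l v =>
    LinearMap.trace_smulRight (l : K × E →ₗ[ℝ] ℝ) v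
  rw [h4]
  -- The derivative of `θ` along the field vanishes, and the factor `-(1/2)` of `fderiv_dens` meets
  -- the factor 2 of `trace_T_kapDeriv`, cancelling the divergence of the field.
  simp only [add_apply, smul_apply, h0, ContinuousLinearMap.comp_apply, smul_eq_mul, Pi.mul_apply,
    ContinuousLinearMap.coe_snd', R.fderiv_dens hp, R.trace_T_kapDeriv]
  ring

theorem exists_shell_flow (r : ℝ) :
    ∃ (Y : K × E → K × E) (Φ : ℝ → K × E → K × E) (C M : ℝ≥0),
      (∀ p ∈ shell K E r, Y p = R.field p) ∧ LipschitzWith C Y ∧ (∀ p, ‖Y p‖ ≤ M) ∧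
      IsFlowOf Y Φ ∧ ∀ p ∈ shell K E r, ∀ t, Φ t p ∈ shell K E r := by
  refine exists_cutoff_flow (isCompact_shell r)
    (fun p hp => R.contDiffAt_field (ne_zero_of_mem_shell hp)) fun χ α h h0 t => ?_
  obtain ⟨h1, h2⟩ := R.norm_sq_curve (c := fun t => χ (α t)) h t 0
  exact ⟨h1.trans_le h0.1, h2.symm ▸ h0.2.1, h2.trans_le h0.2.2⟩

/-- The regularized density on the linear space. -/
noncomputable def shellDens (r : ℝ) (hr : 0 < r) (p : K × E) : ℝ :=
  shellCutoff r hr p * R.dens p.2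

theorem tsupport_shellCutoff_subset (r : ℝ) (hr : 0 < r) :
    tsupport (shellCutoff (K := K) (E := E) r hr) ⊆ shell K E (r + 1) :=
  closure_minimal (support_shellCutoff_subset r hr) (isCompact_shell _).isClosed

theorem hasCompactSupport_shellCutoff (r : ℝ) (hr : 0 < r) :
    HasCompactSupport (shellCutoff (K := K) (E := E) r hr) :=
  (isCompact_shell (r + 1)).of_isClosed_subset (isClosed_tsupport _)
    (tsupport_shellCutoff_subset r hr)

theorem contDiff_shellDens (r : ℝ) (hr : 0 < r) : ContDiff ℝ 1 (R.shellDens r hr) := by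
  have h := contDiff_smul_of_tsupport (n := 1) (χ := shellCutoff (K := K) (E := E) r hr)
    (X := fun p => R.dens p.2) (contDiff_shellCutoff r hr) fun p hp =>
      (R.contDiffAt_dens (ne_zero_of_mem_shell (tsupport_shellCutoff_subset r hr hp))).comp p
        contDiffAt_snd
  exact h

/-- The cutoff is supported in the shell of size `r + 1`, where `Y` is the rolling field, so the
density times `Y` is everywhere a `C¹` divergence-free field. -/
theorem measurePreserving_shell [MeasurableSpace K] [BorelSpace K] [MeasurableSpace E]
    [BorelSpace E] (volV : Measure (K × E)) [volV.IsAddHaarMeasure] (r : ℝ)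
    (hr : 0 < r) {Y : K × E → K × E} {Φ : ℝ → K × E → K × E} {C M : ℝ≥0}
    (hYeq : ∀ p ∈ shell K E (r + 1), Y p = R.field p) (hY : LipschitzWith C Y)
    (hM : ∀ p, ‖Y p‖ ≤ M) (hΦ : IsFlowOf Y Φ) (t : ℝ) :
    MeasurePreserving (Φ t) (volV.withDensity fun p => ENNReal.ofReal (R.shellDens r hr p))
      (volV.withDensity fun p => ENNReal.ofReal (R.shellDens r hr p)) := by
  set θ : K × E → ℝ := shellCutoff r hr with hθdef
  have hθ : ContDiff ℝ 1 θ := contDiff_shellCutoff r hr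
  have hθs : tsupport θ ⊆ shell K E (r + 1) := tsupport_shellCutoff_subset r hr
  have hfield : (fun p => R.shellDens r hr p • Y p) =
      fun p => (θ p * R.dens p.2) • R.field p := by
    funext p
    by_cases h : θ p = 0
    · have h' : R.shellDens r hr p = 0 := by
        change θ p * R.dens p.2 = 0
        rw [h, zero_mul]
      rw [h', h, zero_mul, zero_smul, zero_smul]
    · rw [hYeq p (support_shellCutoff_subset r hr h)]
      rfl
  have hfield' : (fun p => (θ p * R.dens p.2) • R.field p) =
      fun p => θ p • (R.dens p.2 • R.field p) := by
    funext p
    rw [mul_smul]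
  refine hΦ.measurePreserving volV hY hM (R.contDiff_shellDens r hr).continuous
    (HasCompactSupport.mul_right (f := θ) (hasCompactSupport_shellCutoff r hr)) (fun p => ?_) ?_ ?_ t
  · exact mul_nonneg (shellCutoff_nonneg r hr p) (R.dens_nonneg _)
  · rw [hfield, hfield']
    refine contDiff_smul_of_tsupport (n := 1) hθ fun p hp => ?_
    have hp' := ne_zero_of_mem_shell (hθs hp)
    exact ((R.contDiffAt_dens hp').comp p contDiffAt_snd).smul (R.contDiffAt_field hp')
  · intro p
    rw [hfield]
    by_cases hp : p ∈ tsupport θ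
    · exact R.trace_fderiv_dens_smul_field (ne_zero_of_mem_shell (hθs hp))
        (hθ.differentiable one_ne_zero p) (R.fderiv_shellCutoff_field r hr p)
    · have : (fun p => (θ p * R.dens p.2) • R.field p) =ᶠ[𝓝 p] fun _ => 0 := by
        filter_upwards [(notMem_tsupport_iff_eventuallyEq.1 hp)] with q hq
        simp [hq]
      rw [this.fderiv_eq]
      simp

end RollingData

end ChaplyginBall

/-! ### From the linear space to the sphere by polar coordinates. -/

namespace ChaplyginBall

open Set Filter Topology
open scoped NNReal ENNReal RealInnerProductSpace

theorem map_withDensity_comp {α β : Type*} [MeasurableSpace α] [MeasurableSpace β]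
    (μ : Measure α) {m : α → β} (hm : Measurable m) {f : β → ℝ≥0∞} (hf : Measurable f) :
    (μ.withDensity fun a => f (m a)).map m = (μ.map m).withDensity f := by
  ext s hs
  rw [Measure.map_apply hm hs, withDensity_apply _ (hm hs), withDensity_apply _ hs,
    setLIntegral_map hs hf hm]

section Polar

variable {K E : Type*} [NormedAddCommGroup E] [InnerProductSpace ℝ E]

/-- Polar coordinates in the second factor. -/
def polar (z : (K × Metric.sphere (0 : E) 1) × Ioi (0 : ℝ)) : K × E :=
  (z.1.1, (z.2 : ℝ) • (z.1.2 : E))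

variable [FiniteDimensional ℝ E] [MeasurableSpace K] [MeasurableSpace E] [BorelSpace E]

theorem measurableEmbedding_polar : MeasurableEmbedding (polar (K := K) (E := E)) := by
  have h1 : MeasurableEmbedding (Subtype.val ∘ (homeomorphUnitSphereProd E).symm) :=
    (MeasurableEmbedding.subtype_coe (measurableSet_singleton _).compl).comp
      (Homeomorph.measurableEmbedding _)
  exact (MeasurableEmbedding.id.prodMap h1).comp MeasurableEquiv.prodAssoc.measurableEmbedding

theorem measurePreserving_polar [Nontrivial E] (volK : Measure K) [SFinite volK] (volE : Measure E)
    [volE.IsAddHaarMeasure] :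
    MeasurePreserving (polar (K := K) (E := E))
      ((volK.prod volE.toSphere).prod (Measure.volumeIoiPow (Module.finrank ℝ E - 1)))
      (volK.prod volE) := by
  have h1 := (volE.measurePreserving_homeomorphUnitSphereProd).symm
    (homeomorphUnitSphereProd E).toMeasurableEquiv
  have h2 : MeasurePreserving (Subtype.val : ({0}ᶜ : Set E) → E)
      (volE.comap Subtype.val) volE := by
    have := measurePreserving_subtype_coe (μa := volE) (s := ({0}ᶜ : Set E))
      (measurableSet_singleton _).compl
    rwa [Measure.restrict_eq_self_of_ae_mem (by simp [ae_iff])] at this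
  exact ((MeasurePreserving.id volK).prod (h2.comp h1)).comp
    (measurePreserving_prodAssoc volK volE.toSphere _)

end Polar

/-- The weight is at most 1 and vanishes for radius at least 2. Finiteness and positivity of the
radial mass are what permit cancelling it. -/
theorem radialMeasure_ne_top (n : ℕ) : (Measure.volumeIoiPow n).withDensity
    (fun s => ENNReal.ofReal (radialBump ((s : ℝ) ^ 2))) univ ≠ ∞ := by
  rw [withDensity_apply _ .univ, Measure.restrict_univ]
  refine ne_of_lt (lt_of_le_of_lt (lintegral_mono (g := (Iio ⟨2, mem_Ioi.2 two_pos⟩).indicator 1)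
    fun s => ?_) ?_)
  · by_cases hs : s ∈ Iio (⟨2, mem_Ioi.2 two_pos⟩ : Ioi (0 : ℝ))
    · rw [indicator_of_mem hs]
      exact ENNReal.ofReal_le_one.2 radialBump.le_one
    · have h2 : (2 : ℝ) ≤ s := not_lt.1 hs
      rw [radialBump.zero_of_le_dist]
      · simp
      · rw [Real.dist_eq]
        refine le_trans ?_ (le_abs_self _)
        simp only [radialBump]
        nlinarith
  · rw [lintegral_indicator_one measurableSet_Iio, Measure.volumeIoiPow_apply_Iio]
    exact ENNReal.ofReal_lt_top

theorem radialMeasure_ne_zero (n : ℕ) : (Measure.volumeIoiPow n).withDensity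
    (fun s => ENNReal.ofReal (radialBump ((s : ℝ) ^ 2))) univ ≠ 0 := by
  rw [withDensity_apply _ .univ, Measure.restrict_univ]
  intro h
  have hrad : Measurable fun s : Ioi (0 : ℝ) => ENNReal.ofReal (radialBump ((s : ℝ) ^ 2)) :=
    (radialBump.continuous.measurable.comp (by fun_prop)).ennreal_ofReal
  rw [lintegral_eq_zero_iff hrad] at h
  -- For radii in `[9/10, 11/10)` the square lies within `1/4` of 1, where the bump equals 1, and
  -- this interval has positive measure.
  set a : Ioi (0 : ℝ) := ⟨9 / 10, mem_Ioi.2 (by norm_num)⟩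
  set b : Ioi (0 : ℝ) := ⟨11 / 10, mem_Ioi.2 (by norm_num)⟩
  have h1 : Measure.volumeIoiPow n (Ico a b) = 0 := by
    refine measure_mono_null (fun s hs => ?_) h
    have h2 : (9 / 10 : ℝ) ≤ s := hs.1
    have h3 : (s : ℝ) < 11 / 10 := hs.2
    have : radialBump ((s : ℝ) ^ 2) = 1 := by
      refine radialBump.one_of_mem_closedBall ?_
      rw [Metric.mem_closedBall, Real.dist_eq, abs_le]
      simp only [radialBump]
      constructor <;> nlinarith
    simp [this]
  have h4 : Measure.volumeIoiPow n (Iio b) ≤ Measure.volumeIoiPow n (Iio a) := by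
    calc Measure.volumeIoiPow n (Iio b) ≤ Measure.volumeIoiPow n (Iio a ∪ Ico a b) :=
          measure_mono fun s hs => (lt_or_ge s a).imp id fun h => ⟨h, hs⟩
      _ ≤ Measure.volumeIoiPow n (Iio a) + Measure.volumeIoiPow n (Ico a b) := measure_union_le _ _
      _ = Measure.volumeIoiPow n (Iio a) := by rw [h1, add_zero]
  rw [Measure.volumeIoiPow_apply_Iio, Measure.volumeIoiPow_apply_Iio,
    ENNReal.ofReal_le_ofReal_iff (by positivity)] at h4
  have h5 : (9 / 10 : ℝ) ^ (n + 1) < (11 / 10) ^ (n + 1) :=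
    pow_lt_pow_left₀ (by norm_num) (by norm_num) (by simp)
  have h6 := div_lt_div_of_pos_right h5 (show (0 : ℝ) < n + 1 by positivity)
  exact absurd h4 (not_le.2 h6)

namespace RollingData

variable {K E : Type*} [NormedAddCommGroup K] [InnerProductSpace ℝ K]
    [NormedAddCommGroup E] [InnerProductSpace ℝ E] (R : RollingData K E)

/-- The curve `x` on `K × S` solves the rolling equations. -/
def IsSphereCurve (x : ℝ → K × Metric.sphere (0 : E) 1) : Prop :=
  ∀ t, HasDerivAt (fun s => ((x s).1, ((x s).2 : E))) (R.field ((x t).1, ((x t).2 : E))) t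

/-- As `T` is homogeneous of degree zero, scaling the second component carries solutions to
solutions. -/
theorem field_smul {r : ℝ} (hr : r ≠ 0) (k : K) (x : E) :
    R.field (k, r • x) = ((R.field (k, x)).1, r • (R.field (k, x)).2) := by
  simp only [field, R.T_smul hr, map_smul, smul_neg, smul_comm r]

variable {R}

theorem IsSphereCurve.norm_fst {x : ℝ → K × Metric.sphere (0 : E) 1} (h : R.IsSphereCurve x)
    (t s : ℝ) : ‖(x t).1‖ ^ 2 = ‖(x s).1‖ ^ 2 :=
  (R.norm_sq_curve (c := fun _ => 1) (fun t => by simpa using h t) t s).1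

/-- The curves on `K × S` and their multiples are integral curves of a cutoff of the field. -/
theorem IsSphereCurve.polar_eq {x : ℝ → K × Metric.sphere (0 : E) 1} (h : R.IsSphereCurve x)
    {ρ : ℝ} {Y : K × E → K × E} {Φ : ℝ → K × E → K × E} {C : ℝ≥0}
    (hYeq : ∀ p ∈ shell K E ρ, Y p = R.field p) (hY : LipschitzWith C Y) (hΦ : IsFlowOf Y Φ)
    (hx : ‖(x 0).1‖ ^ 2 ≤ ρ) (r : Ioi (0 : ℝ)) (hr1 : 1 / 2 ≤ (r : ℝ) ^ 2)
    (hr2 : (r : ℝ) ^ 2 ≤ 3 / 2) (t : ℝ) : Φ t (polar (x 0, r)) = polar (x t, r) := by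
  refine hΦ.eq_curve hY (α := fun t => polar (x t, r)) (fun t => ?_) t
  have hmem : polar (x t, r) ∈ shell K E ρ := by
    have hn : ‖(r : ℝ) • ((x t).2 : E)‖ ^ 2 = (r : ℝ) ^ 2 := by
      rw [norm_smul, norm_eq_of_mem_sphere, mul_one, Real.norm_eq_abs, sq_abs]
    exact ⟨by simpa [polar] using (h.norm_fst t 0).trans_le hx, hn.symm ▸ hr1, hn.symm ▸ hr2⟩
  rw [hYeq _ hmem]
  have h1 : R.field (polar (x t, r)) = _ := R.field_smul r.2.ne' _ _
  rw [h1]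
  have h2 : HasDerivAt (fun s => (x s).1) _ t := (h t).fst
  have h3 : HasDerivAt (fun s => ((x s).2 : E)) _ t := (h t).snd
  exact HasDerivAt.prodMk h2 (h3.const_smul (r : ℝ))

theorem IsSphereCurve.coe_eq {x : ℝ → K × Metric.sphere (0 : E) 1} (h : R.IsSphereCurve x)
    {ρ : ℝ} {Y : K × E → K × E} {Φ : ℝ → K × E → K × E} {C : ℝ≥0}
    (hYeq : ∀ p ∈ shell K E ρ, Y p = R.field p) (hY : LipschitzWith C Y) (hΦ : IsFlowOf Y Φ)
    (hx : ‖(x 0).1‖ ^ 2 ≤ ρ) (t : ℝ) :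
    Φ t ((x 0).1, ((x 0).2 : E)) = ((x t).1, ((x t).2 : E)) := by
  have := h.polar_eq hYeq hY hΦ hx ⟨1, mem_Ioi.2 one_pos⟩ (by norm_num) (by norm_num) t
  simpa [polar] using this

section Measure

variable [MeasurableSpace K] [MeasurableSpace E]

variable (R) in
/-- The measure `dens dk dγ`. -/
noncomputable def sphereMeasure (volK : Measure K) (volE : Measure E) :
    Measure (K × Metric.sphere (0 : E) 1) :=
  (volK.prod volE.toSphere).withDensity fun q => ENNReal.ofReal (R.dens q.2)

variable (R) in
/-- The measure `dens dk dγ` with a cutoff in the variable `k`. -/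
noncomputable def cutoffMeasure (volK : Measure K) (volE : Measure E) (r : ℝ) (hr : 0 < r) :
    Measure (K × Metric.sphere (0 : E) 1) :=
  (volK.prod volE.toSphere).withDensity
    fun q => ENNReal.ofReal (sizeBump r hr (‖q.1‖ ^ 2) * R.dens q.2)

theorem sphereMeasure_eq_cutoffMeasure (volK : Measure K) (volE : Measure E) {r : ℝ} (hr : 0 < r)
    {A : Set (K × Metric.sphere (0 : E) 1)} (hA : MeasurableSet A) (h : ∀ q ∈ A, ‖q.1‖ ^ 2 ≤ r) :
    R.sphereMeasure volK volE A = R.cutoffMeasure volK volE r hr A := by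
  rw [sphereMeasure, cutoffMeasure, withDensity_apply _ hA, withDensity_apply _ hA]
  refine setLIntegral_congr_fun hA fun q hq => ?_
  have : sizeBump r hr (‖q.1‖ ^ 2) = 1 := by
    refine (sizeBump r hr).one_of_mem_closedBall ?_
    rw [mem_closedBall_zero_iff, Real.norm_of_nonneg (by positivity)]
    exact h q hq
  simp [this]

end Measure

variable [FiniteDimensional ℝ K]

theorem measurable_dens_sphere [MeasurableSpace E] [BorelSpace E] : Measurable fun q : Metric.sphere (0 : E) 1 => R.dens q := by
  refine Continuous.measurable (continuous_iff_continuousAt.2 fun q => ?_)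
  have hq : (q : E) ≠ 0 := ne_zero_of_mem_unit_sphere q
  exact ContinuousAt.comp (f := fun q : Metric.sphere (0 : E) 1 => (q : E))
    (R.contDiffAt_dens hq).continuousAt continuous_subtype_val.continuousAt

variable [FiniteDimensional ℝ E]

theorem IsSphereCurve.ext {x y : ℝ → K × Metric.sphere (0 : E) 1} (hx : R.IsSphereCurve x)
    (hy : R.IsSphereCurve y) (h : x 0 = y 0) : x = y := by
  obtain ⟨Y, Φ, C, M, hYeq, hY, hM, hΦ, -⟩ := R.exists_shell_flow (‖(x 0).1‖ ^ 2)
  funext t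
  have h1 := hx.coe_eq hYeq hY hΦ le_rfl t
  have h2 := hy.coe_eq hYeq hY hΦ (by rw [h]) t
  rw [h, h2] at h1
  obtain ⟨h3, h4⟩ := Prod.mk.inj h1
  exact (Prod.ext h3 (Subtype.ext h4)).symm

/-- A flow on `K × S` is continuous. -/
theorem continuous_sphereFlow {Ψ : ℝ → K × Metric.sphere (0 : E) 1 → K × Metric.sphere (0 : E) 1}
    (h0 : ∀ q, Ψ 0 q = q) (hΨ : ∀ q, R.IsSphereCurve fun t => Ψ t q) (t : ℝ) :
    Continuous (Ψ t) := by
  refine continuous_iff_continuousAt.2 fun q₀ => ?_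
  obtain ⟨Y, Φ, C, M, hYeq, hY, hM, hΦ, -⟩ := R.exists_shell_flow (K := K) (E := E)
    (‖q₀.1‖ ^ 2 + 1)
  -- All starting points near `q₀` lie in one shell, so near `q₀` the map `Ψ t` coincides with a
  -- single cutoff flow, which is continuous.
  have hev : ∀ᶠ q in 𝓝 q₀, ((Ψ t q).1, ((Ψ t q).2 : E)) = Φ t (q.1, (q.2 : E)) := by
    have hc : Continuous fun q : K × Metric.sphere (0 : E) 1 => ‖q.1‖ ^ 2 := by fun_prop
    filter_upwards [hc.continuousAt.eventually_lt (continuousAt_const (y := ‖q₀.1‖ ^ 2 + 1))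
      (by linarith)] with q hq
    have := (hΨ q).coe_eq hYeq hY hΦ (by simpa [h0] using hq.le) t
    simpa [h0] using this.symm
  have hcont : ContinuousAt (fun q : K × Metric.sphere (0 : E) 1 => Φ t (q.1, (q.2 : E))) q₀ :=
    ((hΦ.continuous hY t).comp (by fun_prop)).continuousAt
  have h1 := hcont.congr (hev.mono fun q hq => hq.symm)
  have hemb : IsEmbedding (fun q : K × Metric.sphere (0 : E) 1 => (q.1, (q.2 : E))) :=
    IsEmbedding.id.prodMap IsEmbedding.subtypeVal
  exact hemb.continuousAt_iff.2 h1

variable [MeasurableSpace K] [BorelSpace K] [MeasurableSpace E] [BorelSpace E]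

/-- Times the radial measure, the cutoff measure becomes in polar coordinates the regularized
density on `K × E`, which the cutoff flow preserves. That flow acts as `Ψ t` times the identity on
radii, so testing on sets `A ×ˢ univ` and cancelling the radial mass gives invariance under `Ψ t`.
-/
theorem measurePreserving_cutoff [Nontrivial E] (volK : Measure K) [volK.IsAddHaarMeasure]
    (volE : Measure E) [volE.IsAddHaarMeasure]
    {Ψ : ℝ → K × Metric.sphere (0 : E) 1 → K × Metric.sphere (0 : E) 1}
    (h0 : ∀ q, Ψ 0 q = q) (hΨ : ∀ q, R.IsSphereCurve fun t => Ψ t q) (r : ℝ) (hr : 0 < r) (t : ℝ) :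
    MeasurePreserving (Ψ t) (R.cutoffMeasure volK volE r hr) (R.cutoffMeasure volK volE r hr) := by
  obtain ⟨Y, Φ, C, M, hYeq, hY, hM, hΦ, -⟩ := R.exists_shell_flow (K := K) (E := E) (r + 1)
  have hpres := R.measurePreserving_shell (volK.prod volE) r hr hYeq hY hM hΦ t
  have hmeas : Measurable (Ψ t) := (continuous_sphereFlow h0 hΨ t).measurable
  set n := Module.finrank ℝ E - 1
  set β : Measure (Ioi (0 : ℝ)) := (Measure.volumeIoiPow n).withDensity
    fun s => ENNReal.ofReal (radialBump ((s : ℝ) ^ 2)) with hβ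
  set ν := R.cutoffMeasure volK volE r hr
  have hsize : Measurable fun q : K × Metric.sphere (0 : E) 1 => sizeBump r hr (‖q.1‖ ^ 2) :=
    (sizeBump r hr).continuous.measurable.comp (by fun_prop)
  have hrad : Measurable fun s : Ioi (0 : ℝ) => radialBump ((s : ℝ) ^ 2) :=
    radialBump.continuous.measurable.comp (by fun_prop)
  have hdens : Measurable fun q : K × Metric.sphere (0 : E) 1 => R.dens q.2 :=
    measurable_dens_sphere.comp measurable_snd
  have hνm : Measurable fun q : K × Metric.sphere (0 : E) 1 =>
      ENNReal.ofReal (sizeBump r hr (‖q.1‖ ^ 2) * R.dens q.2) := (hsize.mul hdens).ennreal_ofReal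
  have hsf : SFinite ν := by
    change SFinite (Measure.withDensity _ _)
    infer_instance
  have hsf' : SFinite β := by
    change SFinite (Measure.withDensity _ _)
    infer_instance
  have hprod : ν.prod β = ((volK.prod volE.toSphere).prod (Measure.volumeIoiPow n)).withDensity
      fun z => ENNReal.ofReal (R.shellDens r hr (polar z)) := by
    change (Measure.withDensity _ _).prod (Measure.withDensity _ _) = _
    rw [prod_withDensity hνm hrad.ennreal_ofReal]
    congr 1
    funext z
    have hz : ‖(z.2 : ℝ) • (z.1.2 : E)‖ ^ 2 = (z.2 : ℝ) ^ 2 := by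
      rw [norm_smul, norm_eq_of_mem_sphere, mul_one, Real.norm_eq_abs, sq_abs]
    rw [← ENNReal.ofReal_mul (mul_nonneg (sizeBump r hr).nonneg (R.dens_nonneg _)), shellDens]
    congr 1
    simp only [polar, shellCutoff]
    rw [hz, R.dens_smul z.2.2.ne']
    ring
  have hN : (ν.prod β).map polar =
      (volK.prod volE).withDensity fun p => ENNReal.ofReal (R.shellDens r hr p) := by
    rw [hprod, map_withDensity_comp (f := fun p => ENNReal.ofReal (R.shellDens r hr p)) _
      measurableEmbedding_polar.measurable
      (R.contDiff_shellDens r hr).continuous.measurable.ennreal_ofReal,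
      (measurePreserving_polar volK volE).map_eq]
  -- The identity is only almost everywhere: outside the shell the two flows may differ, but the
  -- density vanishes there.
  have hae : ∀ᵐ z ∂(ν.prod β), Φ t (polar z) = polar (Prod.map (Ψ t) id z) := by
    have hm : Measurable fun z : (K × Metric.sphere (0 : E) 1) × Ioi (0 : ℝ) =>
        ENNReal.ofReal (R.shellDens r hr (polar z)) :=
      (R.contDiff_shellDens r hr).continuous.measurable.ennreal_ofReal.comp
        measurableEmbedding_polar.measurable
    rw [hprod, ae_withDensity_iff hm]
    refine ae_of_all _ fun z hz => ?_
    have hz' : shellCutoff r hr (polar z) ≠ 0 := by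
      intro h
      apply hz
      rw [shellDens, h, zero_mul, ENNReal.ofReal_zero]
    have hs := support_shellCutoff_subset r hr hz'
    have hn : ‖(polar z).2‖ ^ 2 = (z.2 : ℝ) ^ 2 := by
      rw [polar, norm_smul, norm_eq_of_mem_sphere, mul_one, Real.norm_eq_abs, sq_abs]
    have := (hΨ z.1).polar_eq hYeq hY hΦ (by rw [h0]; exact hs.1) z.2 (hn ▸ hs.2.1)
      (hn ▸ hs.2.2) t
    rwa [h0] at this
  have hinv : (ν.prod β).map (Prod.map (Ψ t) id) = ν.prod β := by
    have h1 : ((ν.prod β).map (Prod.map (Ψ t) id)).map polar = (ν.prod β).map polar := by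
      rw [Measure.map_map measurableEmbedding_polar.measurable (hmeas.prodMap measurable_id)]
      refine (Measure.map_congr hae).symm.trans ?_
      change (ν.prod β).map (Φ t ∘ polar) = _
      rw [← Measure.map_map hpres.measurable measurableEmbedding_polar.measurable, hN, hpres.map_eq]
    -- Being an embedding, `polar` determines a measure from its image.
    rw [← measurableEmbedding_polar.comap_map ((ν.prod β).map (Prod.map (Ψ t) id)), h1,
      measurableEmbedding_polar.comap_map]
  refine ⟨hmeas, ?_⟩
  ext A hA
  have h1 : (ν.prod β).map (Prod.map (Ψ t) id) (A ×ˢ univ) = ν.prod β (A ×ˢ univ) := by rw [hinv]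
  rw [Measure.map_apply (hmeas.prodMap measurable_id) (hA.prod .univ),
    show Prod.map (Ψ t) id ⁻¹' A ×ˢ univ = (Ψ t ⁻¹' A) ×ˢ (univ : Set (Ioi (0 : ℝ))) by ext; simp,
    Measure.prod_prod, Measure.prod_prod] at h1
  rw [Measure.map_apply hmeas hA]
  have hβ0 := radialMeasure_ne_zero n
  have hβ1 := radialMeasure_ne_top n
  exact (ENNReal.mul_left_inj hβ0 hβ1).1 h1

/-- Every flow of the rolling equations on `K × S` preserves the measure `dens dk dγ`. -/
theorem measurePreserving_sphereFlow [Nontrivial E] (volK : Measure K) [volK.IsAddHaarMeasure]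
    (volE : Measure E) [volE.IsAddHaarMeasure]
    {Ψ : ℝ → K × Metric.sphere (0 : E) 1 → K × Metric.sphere (0 : E) 1}
    (h0 : ∀ q, Ψ 0 q = q) (hΨ : ∀ q, R.IsSphereCurve fun t => Ψ t q) (t : ℝ) :
    MeasurePreserving (Ψ t) (R.sphereMeasure volK volE) (R.sphereMeasure volK volE) := by
  have hmeas : Measurable (Ψ t) := (continuous_sphereFlow h0 hΨ t).measurable
  refine ⟨hmeas, ?_⟩
  ext A hA
  rw [Measure.map_apply hmeas hA]
  -- These sets are invariant because `‖k‖` is conserved, and they exhaust the space; on each of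
  -- them some cutoff equals 1. The `+ 1` keeps the radius positive for `j = 0`.
  let B : ℕ → Set (K × Metric.sphere (0 : E) 1) := fun j => {q | ‖q.1‖ ^ 2 ≤ j + 1}
  have hB : ∀ j, MeasurableSet (B j) := fun j => measurableSet_le (by fun_prop) measurable_const
  have hmono : ∀ S : Set (K × Metric.sphere (0 : E) 1), Monotone fun j => S ∩ B j := by
    intro S i j hij
    have : (i : ℝ) ≤ j := by exact_mod_cast hij
    have hle : (i : ℝ) + 1 ≤ j + 1 := by linarith
    exact inter_subset_inter_right _ fun q hq => le_trans hq hle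
  have hcover : ∀ S : Set (K × Metric.sphere (0 : E) 1), ⋃ j, S ∩ B j = S := by
    intro S
    rw [← inter_iUnion]
    refine inter_eq_left.2 fun q _ => mem_iUnion.2 ⟨⌈‖q.1‖ ^ 2⌉₊, ?_⟩
    exact (Nat.le_ceil (‖q.1‖ ^ 2)).trans (le_add_of_nonneg_right zero_le_one)
  have hpre : ∀ j, Ψ t ⁻¹' A ∩ B j = Ψ t ⁻¹' (A ∩ B j) := by
    intro j
    ext q
    have := (hΨ q).norm_fst t 0
    rw [h0] at this
    change (_ ∧ ‖q.1‖ ^ 2 ≤ _) ↔ (_ ∧ ‖(Ψ t q).1‖ ^ 2 ≤ _)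
    rw [this]
    rfl
  rw [← hcover (Ψ t ⁻¹' A), ← hcover A, (hmono _).measure_iUnion, (hmono _).measure_iUnion]
  refine iSup_congr fun j => ?_
  have hj : (0 : ℝ) < j + 1 := by positivity
  rw [hcover, sphereMeasure_eq_cutoffMeasure volK volE hj ((hmeas hA).inter (hB j)) fun q hq => hq.2,
    sphereMeasure_eq_cutoffMeasure volK volE hj (hA.inter (hB j)) fun q hq => hq.2, hpre,
    (measurePreserving_cutoff volK volE h0 hΨ _ hj t).measure_preimage
      (hA.inter (hB j)).nullMeasurableSet]

end RollingData

end ChaplyginBall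

/-! ### The flow on the sphere together with a linear equation along it. -/

namespace ChaplyginBall

open Set Filter Topology
open scoped NNReal ENNReal RealInnerProductSpace

/-- A compact invariant set of the full field. -/
def fullShell (K E ι : Type*) [NormedAddCommGroup K] [NormedAddCommGroup E] (r ρ : ℝ) :
    Set ((K × E) × (ι → E)) :=
  {p | p.1 ∈ shell K E r ∧ ∀ i, ‖p.2 i‖ ^ 2 ≤ ρ}

theorem isCompact_fullShell {K E ι : Type*} [NormedAddCommGroup K]
    [NormedAddCommGroup E] [ProperSpace K] [ProperSpace E] (r ρ : ℝ) :
    IsCompact (fullShell K E ι r ρ) := by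
  have h : IsCompact (shell K E r ×ˢ univ.pi fun _ : ι => {x : E | ‖x‖ ^ 2 ≤ ρ}) := by
    refine (isCompact_shell r).prod (isCompact_univ_pi fun _ => ?_)
    refine Metric.isCompact_of_isClosed_isBounded (isClosed_le (by fun_prop) continuous_const) ?_
    refine (Metric.isBounded_closedBall (x := (0 : E)) (r := |ρ| + 1)).subset fun x hx => ?_
    rw [mem_closedBall_zero_iff]
    have hx' : ‖x‖ ^ 2 ≤ ρ := hx
    nlinarith [le_abs_self ρ, abs_nonneg ρ, norm_nonneg x]
  refine h.of_isClosed_subset ?_ fun p hp => ⟨hp.1, fun i _ => hp.2 i⟩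
  convert h.isClosed using 1
  ext p
  exact ⟨fun hp => ⟨hp.1, fun i _ => hp.2 i⟩, fun hp => ⟨hp.1, fun i => hp.2 i trivial⟩⟩

namespace RollingData

variable {K E : Type*} [NormedAddCommGroup K] [InnerProductSpace ℝ K]
    [NormedAddCommGroup E] [InnerProductSpace ℝ E] (R : RollingData K E) {ι : Type*} [Fintype ι]

/-- The rolling field together with the linear equations `r' = -ω r` of a family of vectors. -/
noncomputable def fullField (p : (K × E) × (ι → E)) : (K × E) × (ι → E) :=
  (R.field p.1, fun i => -(R.act (R.omega p.1) (p.2 i)))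

variable [FiniteDimensional ℝ K]

theorem contDiffAt_fullField {p : (K × E) × (ι → E)} (hp : p.1.2 ≠ 0) :
    ContDiffAt ℝ 1 R.fullField p := by
  have hω : ContDiffAt ℝ 1 (fun p : (K × E) × (ι → E) => R.T p.1.2 p.1.1) p :=
    ((R.contDiffAt_T hp).comp p contDiffAt_fst.snd).clm_apply contDiffAt_fst.fst
  refine ((R.contDiffAt_field hp).comp p contDiffAt_fst).prodMk (contDiffAt_pi.2 fun i => ?_)
  exact ((R.act.contDiff.contDiffAt.comp p hω).clm_apply
    ((contDiff_apply ℝ E i).contDiffAt.comp p contDiffAt_snd)).neg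

variable [FiniteDimensional ℝ E]

/-- The additional vectors also keep their norms, since `ω` acts by a skew operator, so the enlarged
shell is again compact and invariant. -/
theorem exists_fullShell_flow (r ρ : ℝ) :
    ∃ (Y : (K × E) × (ι → E) → (K × E) × (ι → E)) (Φ : ℝ → (K × E) × (ι → E) → (K × E) × (ι → E))
      (C : ℝ≥0), (∀ p ∈ fullShell K E ι r ρ, Y p = R.fullField p) ∧ LipschitzWith C Y ∧
      IsFlowOf Y Φ ∧ ∀ p ∈ fullShell K E ι r ρ, ∀ t, Φ t p ∈ fullShell K E ι r ρ := by
  obtain ⟨Y, Φ, C, -, h1, h2, -, h3, h4⟩ := exists_cutoff_flow (X := R.fullField)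
    (isCompact_fullShell (K := K) (E := E) (ι := ι) r ρ)
    (fun p hp => R.contDiffAt_fullField (ne_zero_of_mem_shell hp.1)) fun χ α h h0 t => by
      have hα : ∀ t, HasDerivAt (fun t => (α t).1) (χ (α t) • R.field (α t).1) t :=
        fun t => (h t).fst
      obtain ⟨h1, h2⟩ := R.norm_sq_curve (c := fun t => χ (α t)) hα t 0
      refine ⟨⟨h1.trans_le h0.1.1, h2.symm ▸ h0.1.2.1, h2.trans_le h0.1.2.2⟩, fun i => ?_⟩
      have h3 : ∀ t, HasDerivAt (fun t => (α t).2 i)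
          (χ (α t) • -(R.act (R.omega (α t).1) ((α t).2 i))) t := fun t =>
        hasDerivAt_pi.1 (h t).snd i
      refine (norm_sq_const h3 (fun t => ?_) t 0).trans_le (h0.2 i)
      rw [inner_smul_right, inner_neg_right, real_inner_comm, R.inner_act, neg_zero, mul_zero]
  exact ⟨Y, Φ, C, h1, h2, h3, h4⟩

/-- Existence of a global flow on `K × S`, and of solutions of the equations `r' = -ω r` along it
which depend continuously on the initial point. -/
theorem exists_sphereFlow (r₀ : ι → E) :
    ∃ (Ψ : ℝ → K × Metric.sphere (0 : E) 1 → K × Metric.sphere (0 : E) 1)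
      (G : ℝ → K × Metric.sphere (0 : E) 1 → ι → E),
      (∀ q, Ψ 0 q = q) ∧ (∀ q, R.IsSphereCurve fun t => Ψ t q) ∧ (∀ q, G 0 q = r₀) ∧
      (∀ q i t, HasDerivAt (fun s => G s q i)
        (-(R.act (R.omega ((Ψ t q).1, ((Ψ t q).2 : E))) (G t q i))) t) ∧
      ∀ t, Continuous (G t) := by
  set ρ := ∑ i, ‖r₀ i‖ ^ 2 with hρ
  have hr₀ : ∀ i, ‖r₀ i‖ ^ 2 ≤ ρ := fun i =>
    Finset.single_le_sum (f := fun i => ‖r₀ i‖ ^ 2) (fun i _ => by positivity) (Finset.mem_univ i)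
  choose Y Φ C hYeq hY hΦ hinv using fun r => R.exists_fullShell_flow (ι := ι) r ρ
  let p₀ : K × Metric.sphere (0 : E) 1 → (K × E) × (ι → E) := fun q => ((q.1, (q.2 : E)), r₀)
  -- The cutoff is adapted to the size of the initial `k`, so `α` is pieced together from different
  -- flows.
  let α : K × Metric.sphere (0 : E) 1 → ℝ → (K × E) × (ι → E) := fun q t =>
    Φ (‖q.1‖ ^ 2) t (p₀ q)
  have hp₀ : ∀ q (r : ℝ), ‖q.1‖ ^ 2 ≤ r → p₀ q ∈ fullShell K E ι r ρ := by
    intro q r hq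
    have hn : ‖(q.2 : E)‖ ^ 2 = 1 := by rw [norm_eq_of_mem_sphere, one_pow]
    exact ⟨⟨hq, by simp only [p₀]; linarith, by simp only [p₀]; linarith⟩, hr₀⟩
  have hα0 : ∀ q, α q 0 = p₀ q := fun q => (hΦ _).1 _
  have hα : ∀ q t, HasDerivAt (α q) (R.fullField (α q t)) t := by
    intro q t
    have h := (hΦ (‖q.1‖ ^ 2)).2 (p₀ q) t
    rwa [hYeq _ _ (hinv _ _ (hp₀ q _ le_rfl) t)] at h
  have hα1 : ∀ q t, HasDerivAt (fun t => (α q t).1) (R.field (α q t).1) t := fun q t =>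
    (hα q t).fst
  have hn := fun q t => R.norm_sq_curve (c := fun _ => 1) (α := fun t => (α q t).1)
    (fun t => by simpa using hα1 q t) t 0
  have hS : ∀ q t, (α q t).1.2 ∈ Metric.sphere (0 : E) 1 := by
    intro q t
    have h := (hn q t).2
    rw [hα0] at h
    simp only [p₀, norm_eq_of_mem_sphere, one_pow] at h
    rw [mem_sphere_zero_iff_norm]
    exact (pow_eq_one_iff_of_nonneg (norm_nonneg _) two_ne_zero).1 h
  have hα2 : ∀ q i t, HasDerivAt (fun t => (α q t).2 i)
      (-(R.act (R.omega (α q t).1) ((α q t).2 i))) t := fun q i t => hasDerivAt_pi.1 (hα q t).snd i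
  refine ⟨fun t q => ((α q t).1.1, ⟨(α q t).1.2, hS q t⟩), fun t q => (α q t).2, fun q => ?_,
    fun q => hα1 q, fun q => ?_, fun q i t => hα2 q i t, fun t => ?_⟩
  · exact Prod.ext (by simp [hα0, p₀]) (Subtype.ext (by simp [hα0, p₀]))
  · exact congrArg Prod.snd (hα0 q)
  · refine continuous_iff_continuousAt.2 fun q₀ => ?_
    set r := ‖q₀.1‖ ^ 2 + 1
    have hc : Continuous fun q : K × Metric.sphere (0 : E) 1 => ‖q.1‖ ^ 2 := by fun_prop
    -- By uniqueness one slightly larger shell serves all nearby starting points, and continuity is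
    -- inherited from its flow.
    have hev : ∀ᶠ q in 𝓝 q₀, (Φ r t (p₀ q)).2 = (α q t).2 := by
      filter_upwards [hc.continuousAt.eventually_lt (continuousAt_const (y := r))
        (by simp only [r]; linarith)] with q hq
      rw [← hα0 q, (hΦ r).eq_curve (hY r) (fun s => ?_) t]
      have hmem : α q s ∈ fullShell K E ι r ρ := by
        have := hinv _ _ (hp₀ q _ le_rfl) s
        exact ⟨⟨this.1.1.trans hq.le, this.1.2⟩, this.2⟩
      rw [hYeq r _ hmem]
      exact hα q s
    have hcont : Continuous fun q => (Φ r t (p₀ q)).2 :=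
      continuous_snd.comp (((hΦ r).continuous (hY r) t).comp (by fun_prop))
    exact hcont.continuousAt.congr hev

end RollingData

end ChaplyginBall

/-! ### The Lie algebra `so(n)` in Euclidean coordinates. -/

namespace ChaplyginBall

open Set Filter Topology
open scoped NNReal ENNReal RealInnerProductSpace

/-- Derivatives of curves of matrices are taken in topological vector spaces with no norm; this
carries them to Euclidean coordinates and back. -/
theorem hasDerivAt_continuousLinearMap_comp {F G : Type*} [AddCommGroup F] [Module ℝ F] [TopologicalSpace F]
    [ContinuousSMul ℝ F] [AddCommGroup G] [Module ℝ G] [TopologicalSpace G] [ContinuousSMul ℝ G]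
    (L : F →L[ℝ] G) {f : ℝ → F} {f' : F} {t : ℝ} (h : HasDerivAt f f' t) :
    HasDerivAt (fun s => L (f s)) (L f') t := by
  refine HasFDerivAtFilter.of_isLittleOTVS ?_
  have h1 := (L.isBigOTVS_fun_comp (f := _) (l := _)).trans_isLittleOTVS h.isLittleOTVS
  refine h1.congr_left fun p => ?_
  simp

/-- The coordinates of an element of `so(n)` in the basis `E_i ∧ E_j`. -/
noncomputable def soCoord (n : ℕ) : LieSO n →ₗ[ℝ] EuclideanSpace ℝ (Pairs n) where
  toFun X := WithLp.toLp 2 fun p => X.1 p.1.1 p.1.2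
  map_add' _ _ := rfl
  map_smul' _ _ := rfl

variable {n : ℕ}

theorem soCoord_apply (X : LieSO n) (p : Pairs n) : soCoord n X p = X.1 p.1.1 p.1.2 := rfl

theorem so_apply (X : LieSO n) (i j : Fin n) : X.1 i j = -X.1 j i := by
  have h := (LieAlgebra.Orthogonal.mem_so (Fin n) ℝ X.1).1 X.2
  exact congrFun (congrFun h j) i

theorem soCoord_basisSO (p : Pairs n) : soCoord n (basisSO p) = EuclideanSpace.single p 1 := by
  ext q
  obtain ⟨⟨i, j⟩, hij⟩ := p
  obtain ⟨⟨k, l⟩, hkl⟩ := q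
  rw [soCoord_apply]
  simp only [basisSO, wedge, stdVec, Matrix.sub_apply, Matrix.vecMulVec_apply, Pi.single_apply,
    PiLp.single_apply, Subtype.mk.injEq, Prod.mk.injEq]
  simp only at hij hkl
  by_cases h1 : k = i <;> by_cases h2 : l = j <;> by_cases h3 : k = j <;> by_cases h4 : l = i <;>
    simp_all; omega

theorem soCoord_injective : Function.Injective (soCoord n) := by
  refine (injective_iff_map_eq_zero _).2 fun X hX => ?_
  have h : ∀ i j, i < j → X.1 i j = 0 := fun i j hij =>
    congrArg (fun c : EuclideanSpace ℝ (Pairs n) => c ⟨(i, j), hij⟩) hX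
  refine Subtype.ext (Matrix.ext fun i j => ?_)
  rcases lt_trichotomy i j with hij | rfl | hij
  · exact h i j hij
  · have := so_apply X i i
    change X.1 i i = 0
    linarith
  · rw [so_apply, h j i hij]
    exact neg_zero

instance isTopologicalAddGroup_lieSO : IsTopologicalAddGroup (LieSO n) :=
  Topology.IsInducing.topologicalAddGroup
    (AddMonoidHom.mk' (Subtype.val : LieSO n → Matrix (Fin n) (Fin n) ℝ) fun _ _ => rfl)
    IsInducing.subtypeVal

/-- The coordinates as an equivalence. -/
noncomputable def soEquiv (n : ℕ) : LieSO n ≃L[ℝ] EuclideanSpace ℝ (Pairs n) :=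
  LinearEquiv.toContinuousLinearEquiv <| LinearEquiv.ofBijective (soCoord n)
    ⟨soCoord_injective, fun c => ⟨∑ p, c p • basisSO p, by
      simp only [map_sum, map_smul, soCoord_basisSO]
      ext q
      simp [Pi.single_apply]⟩⟩

theorem soEquiv_apply (X : LieSO n) : soEquiv n X = soCoord n X := rfl

theorem sum_pairs {f : Fin n → Fin n → ℝ} (h : ∀ i j, f i j = f j i) (h0 : ∀ i, f i i = 0) :
    ∑ i, ∑ j, f i j = 2 * ∑ p : Pairs n, f p.1.1 p.1.2 := by
  rw [← Fintype.sum_prod_type', ← Fintype.sum_subtype_add_sum_subtype (fun p : Fin n × Fin n => p.1 < p.2)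
    (fun p => f p.1 p.2), two_mul]
  congr 1
  rw [← Finset.sum_subtype (Finset.univ.filter fun p : Fin n × Fin n => ¬p.1 < p.2) (by simp) (fun p => f p.1 p.2),
    ← Finset.sum_subtype (Finset.univ.filter fun p : Fin n × Fin n => p.1 < p.2) (by simp) (fun p => f p.1 p.2)]
  symm
  refine Finset.sum_of_injOn Prod.swap Prod.swap_injective.injOn (fun p hp => ?_) (fun p hp hp' => ?_)
    (fun p _ => h _ _)
  · simp at hp ⊢
    exact hp.le
  · have : p.1 = p.2 := by
      simp at hp hp'
      by_contra hne
      exact hp' _ _ (lt_of_le_of_ne hp (Ne.symm hne)) rfl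
    rw [this, h0]

/-- The factor `1/2` compensates for counting each pair twice, the sign for `Y j i = -Y i j`. Thus
the `E_i ∧ E_j` are orthonormal. -/
theorem killing_eq_inner (X Y : LieSO n) : killing X Y = ⟪soEquiv n X, soEquiv n Y⟫ := by
  have h1 : (X.1 * Y.1).trace = -∑ i, ∑ j, X.1 i j * Y.1 i j := by
    simp only [Matrix.trace, Matrix.diag, Matrix.mul_apply, ← Finset.sum_neg_distrib]
    refine Finset.sum_congr rfl fun i _ => Finset.sum_congr rfl fun j _ => ?_
    rw [so_apply Y j i, mul_neg]
  have h2 := sum_pairs (f := fun i j => X.1 i j * Y.1 i j)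
    (fun i j => by rw [so_apply X i j, so_apply Y i j, neg_mul_neg])
    (fun i => by have := so_apply X i i; rw [show X.1 i i = 0 by linarith, zero_mul])
  rw [killing, h1, h2, PiLp.inner_apply]
  simp only [soEquiv_apply, soCoord_apply, RCLike.inner_apply, conj_trivial, mul_comm (Y.1 _ _)]
  ring

theorem killing_lie_self (X Y : LieSO n) : killing ⁅X, Y⁆ X = 0 := by
  change -(1 / 2 : ℝ) * ((X.1 * Y.1 - Y.1 * X.1) * X.1).trace = 0
  rw [Matrix.sub_mul, Matrix.trace_sub, Matrix.trace_mul_comm, ← Matrix.mul_assoc,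
    Matrix.mul_assoc Y.1, Matrix.trace_mul_comm Y.1]
  simp

theorem killing_lie_right (X Y : LieSO n) : killing ⁅X, Y⁆ Y = 0 := by
  change -(1 / 2 : ℝ) * ((X.1 * Y.1 - Y.1 * X.1) * Y.1).trace = 0
  rw [Matrix.sub_mul, Matrix.trace_sub, Matrix.mul_assoc Y.1, Matrix.trace_mul_comm Y.1]
  simp

theorem killing_wedge (x y : Fin n → ℝ) (W : LieSO n) :
    killing (wedge x y) W = x ⬝ᵥ W.1.mulVec y := by
  have hW : W.1.transpose = -W.1 := (LieAlgebra.Orthogonal.mem_so (Fin n) ℝ W.1).1 W.2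
  change -(1 / 2 : ℝ) * ((Matrix.vecMulVec x y - Matrix.vecMulVec y x) * W.1).trace = _
  rw [Matrix.sub_mul, Matrix.trace_sub, Matrix.vecMulVec_mul, Matrix.vecMulVec_mul,
    Matrix.trace_vecMulVec, Matrix.trace_vecMulVec, ← Matrix.mulVec_transpose, ← Matrix.mulVec_transpose,
    hW, Matrix.neg_mulVec, Matrix.neg_mulVec, dotProduct_neg, dotProduct_neg]
  have : y ⬝ᵥ W.1.mulVec x = -(x ⬝ᵥ W.1.mulVec y) := by
    rw [Matrix.dotProduct_mulVec, ← Matrix.mulVec_transpose, hW, Matrix.neg_mulVec, neg_dotProduct,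
      dotProduct_comm]
  rw [this]
  ring

/-- The action of `so(n)` on Euclidean space. -/
noncomputable def soAct (n : ℕ) :
    EuclideanSpace ℝ (Pairs n) →L[ℝ] EuclideanSpace ℝ (Fin n) →L[ℝ] EuclideanSpace ℝ (Fin n) :=
  (LinearMap.mk₂ ℝ (fun w x => WithLp.toLp 2 (((soEquiv n).symm w).1.mulVec (WithLp.ofLp x)))
    (fun w w' x => by
      rw [map_add, ← WithLp.toLp_add, ← Matrix.add_mulVec]; rfl)
    (fun c w x => by
      rw [map_smul, ← WithLp.toLp_smul, ← Matrix.smul_mulVec]; rfl)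
    (fun w x y => by rw [WithLp.ofLp_add, Matrix.mulVec_add, WithLp.toLp_add])
    (fun c w x => by rw [WithLp.ofLp_smul, Matrix.mulVec_smul, WithLp.toLp_smul])).toContinuousBilinearMap

/-- The bracket in coordinates. -/
noncomputable def soBracket (n : ℕ) :
    EuclideanSpace ℝ (Pairs n) →L[ℝ] EuclideanSpace ℝ (Pairs n) →L[ℝ] EuclideanSpace ℝ (Pairs n) :=
  (LinearMap.mk₂ ℝ (fun k w => soEquiv n ⁅(soEquiv n).symm k, (soEquiv n).symm w⁆)
    (fun k k' w => by rw [map_add, add_lie, map_add])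
    (fun c k w => by rw [map_smul, smul_lie, map_smul])
    (fun k w w' => by rw [map_add, lie_add, map_add])
    (fun c k w => by rw [map_smul, lie_smul, map_smul])).toContinuousBilinearMap

theorem wedge_coe (x y : Fin n → ℝ) :
    (wedge x y).1 = Matrix.vecMulVec x y - Matrix.vecMulVec y x := rfl

/-- The wedge product in coordinates. -/
noncomputable def soWedge (n : ℕ) :
    EuclideanSpace ℝ (Fin n) →L[ℝ] EuclideanSpace ℝ (Fin n) →L[ℝ] EuclideanSpace ℝ (Pairs n) :=
  (LinearMap.mk₂ ℝ (fun x y => soEquiv n (wedge (WithLp.ofLp x) (WithLp.ofLp y)))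
    (fun x x' y => by
      rw [← map_add]
      refine congrArg _ (Subtype.ext ?_)
      change Matrix.vecMulVec _ _ - Matrix.vecMulVec _ _ = (_ - _) + (_ - _)
      rw [WithLp.ofLp_add, Matrix.add_vecMulVec, Matrix.vecMulVec_add]
      abel)
    (fun c x y => by
      rw [← map_smul]
      refine congrArg _ (Subtype.ext ?_)
      change Matrix.vecMulVec _ _ - Matrix.vecMulVec _ _ = c • (_ - _)
      rw [WithLp.ofLp_smul, Matrix.smul_vecMulVec, Matrix.vecMulVec_smul, smul_sub])
    (fun x y y' => by
      rw [← map_add]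
      refine congrArg _ (Subtype.ext ?_)
      change Matrix.vecMulVec _ _ - Matrix.vecMulVec _ _ = (_ - _) + (_ - _)
      rw [WithLp.ofLp_add, Matrix.add_vecMulVec, Matrix.vecMulVec_add]
      abel)
    (fun c x y => by
      rw [← map_smul]
      refine congrArg _ (Subtype.ext ?_)
      change Matrix.vecMulVec _ _ - Matrix.vecMulVec _ _ = c • (_ - _)
      rw [WithLp.ofLp_smul, Matrix.smul_vecMulVec, Matrix.vecMulVec_smul, smul_sub])).toContinuousBilinearMap

theorem soAct_soEquiv (X : LieSO n) (x : EuclideanSpace ℝ (Fin n)) :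
    soAct n (soEquiv n X) x = WithLp.toLp 2 (X.1.mulVec (WithLp.ofLp x)) := by
  change WithLp.toLp 2 (((soEquiv n).symm (soEquiv n X)).1.mulVec _) = _
  rw [ContinuousLinearEquiv.symm_apply_apply]

theorem soBracket_soEquiv (X Y : LieSO n) :
    soBracket n (soEquiv n X) (soEquiv n Y) = soEquiv n ⁅X, Y⁆ := by
  change soEquiv n ⁅(soEquiv n).symm (soEquiv n X), (soEquiv n).symm (soEquiv n Y)⁆ = _
  rw [ContinuousLinearEquiv.symm_apply_apply, ContinuousLinearEquiv.symm_apply_apply]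

theorem soWedge_apply (x y : EuclideanSpace ℝ (Fin n)) :
    soWedge n x y = soEquiv n (wedge (WithLp.ofLp x) (WithLp.ofLp y)) := rfl

theorem euclidean_inner (x y : EuclideanSpace ℝ (Fin n)) :
    ⟪x, y⟫ = WithLp.ofLp x ⬝ᵥ WithLp.ofLp y := by
  rw [EuclideanSpace.inner_eq_star_dotProduct, dotProduct_comm]
  simp

/-- The rolling data of the Chaplygin ball. -/
noncomputable def ballData {I : LieSO n →ₗ[ℝ] LieSO n} (hI : IsInertia I) {D : ℝ} (hD : 0 ≤ D)
    (ε : ℝ) : RollingData (EuclideanSpace ℝ (Pairs n)) (EuclideanSpace ℝ (Fin n)) where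
  br := soBracket n
  act := soAct n
  wedge := soWedge n
  inertia := LinearMap.toContinuousLinearMap
    ((soEquiv n).toLinearEquiv.toLinearMap ∘ₗ I ∘ₗ (soEquiv n).symm.toLinearEquiv.toLinearMap)
  D := D
  ε := ε
  inner_br_left k w := by
    obtain ⟨k, rfl⟩ := (soEquiv n).surjective k
    obtain ⟨w, rfl⟩ := (soEquiv n).surjective w
    rw [soBracket_soEquiv, ← killing_eq_inner, killing_lie_self]
  inner_br_right k w := by
    obtain ⟨k, rfl⟩ := (soEquiv n).surjective k
    obtain ⟨w, rfl⟩ := (soEquiv n).surjective w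
    rw [soBracket_soEquiv, ← killing_eq_inner, killing_lie_right]
  inner_act w x := by
    obtain ⟨w, rfl⟩ := (soEquiv n).surjective w
    have h1 : killing (wedge (WithLp.ofLp x) (WithLp.ofLp x)) w = 0 := by
      rw [killing, wedge_coe, sub_self, Matrix.zero_mul, Matrix.trace_zero, mul_zero]
    rw [soAct_soEquiv, real_inner_comm, euclidean_inner, ← h1, killing_wedge]
  inner_wedge x y w := by
    obtain ⟨w, rfl⟩ := (soEquiv n).surjective w
    rw [soAct_soEquiv, soWedge_apply, ← killing_eq_inner, killing_wedge, euclidean_inner]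
  inertia_symm x y := by
    obtain ⟨x, rfl⟩ := (soEquiv n).surjective x
    obtain ⟨y, rfl⟩ := (soEquiv n).surjective y
    simpa [killing_eq_inner] using hI.symm x y
  inertia_pos x hx := by
    obtain ⟨x, rfl⟩ := (soEquiv n).surjective x
    have := hI.pos x fun h => hx (by rw [h, map_zero])
    simpa [killing_eq_inner] using this
  D_nonneg := hD

variable {I : LieSO n →ₗ[ℝ] LieSO n} (hI : IsInertia I) {D : ℝ} (hD : 0 ≤ D) (ε : ℝ)

theorem prV_eq_wedge (γ : UnitSphere n) (X : LieSO n) :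
    prV γ X = wedge (X.1.mulVec (coords γ)) (coords γ) := by
  have hX : X.1.transpose = -X.1 := (LieAlgebra.Orthogonal.mem_so (Fin n) ℝ X.1).1 X.2
  refine Subtype.ext ?_
  change X.1 * Matrix.vecMulVec _ _ + Matrix.vecMulVec _ _ * X.1 = Matrix.vecMulVec _ _ - Matrix.vecMulVec _ _
  rw [Matrix.mul_vecMulVec, Matrix.vecMulVec_mul, ← Matrix.mulVec_transpose, hX, Matrix.neg_mulVec,
    Matrix.vecMulVec_neg, sub_eq_add_neg]

theorem ballData_kap (γ : UnitSphere n) (X : LieSO n) :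
    (ballData hI hD ε).kap γ (soEquiv n X) = soEquiv n (kappa I D γ X) := by
  have h1 : ‖(γ : EuclideanSpace ℝ (Fin n))‖ = 1 := norm_eq_of_mem_sphere γ
  rw [RollingData.kap, h1, add_apply, smul_apply, RollingData.prB_apply]
  simp only [ballData, kappa, LinearMap.add_apply, LinearMap.smul_apply, prV_eq_wedge, map_add,
    map_smul, soAct_soEquiv, soWedge_apply]
  simp [coords]

theorem det_ballData_kap (γ : UnitSphere n) :
    LinearMap.det ((ballData hI hD ε).kap γ).toLinearMap = LinearMap.det (kappa I D γ) := by
  rw [← LinearMap.det_conj (kappa I D γ) (soEquiv n).toLinearEquiv]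
  congr 1
  refine LinearMap.ext fun k => ?_
  obtain ⟨k, rfl⟩ := (soEquiv n).surjective k
  simpa using ballData_kap hI hD ε γ k

theorem ballData_dens (γ : UnitSphere n) : (ballData hI hD ε).dens γ = 1 / mu I D γ := by
  rw [RollingData.dens, det_ballData_kap, mu, one_div]

/-- The coordinates on the reduced phase space. -/
noncomputable def reducedEquiv (n : ℕ) :
    ReducedSpace n ≃ₜ EuclideanSpace ℝ (Pairs n) × UnitSphere n :=
  (soEquiv n).toHomeomorph.prodCongr (Homeomorph.refl _)

theorem omega_eq_iff (k X : LieSO n) (γ : UnitSphere n) :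
    (ballData hI hD ε).omega (soEquiv n k, (γ : EuclideanSpace ℝ (Fin n))) = soEquiv n X ↔
      kappa I D γ X = k := by
  rw [← ((ballData hI hD ε).kap_injective γ).eq_iff, RollingData.omega, RollingData.kap_T,
    ballData_kap, (soEquiv n).injective.eq_iff, eq_comm]

/-- The angular velocity as a function on the reduced phase space. -/
noncomputable def angularVelocity (q : ReducedSpace n) : LieSO n :=
  (soEquiv n).symm ((ballData hI hD ε).omega (soEquiv n q.1, (q.2 : EuclideanSpace ℝ (Fin n))))

theorem kappa_eq_iff (X : LieSO n) (q : ReducedSpace n) :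
    kappa I D q.2 X = q.1 ↔ X = angularVelocity hI hD ε q := by
  rw [← omega_eq_iff hI hD ε, angularVelocity, ContinuousLinearEquiv.eq_symm_apply, eq_comm]

theorem soEquiv_angularVelocity (q : ReducedSpace n) : soEquiv n (angularVelocity hI hD ε q) =
    (ballData hI hD ε).omega (soEquiv n q.1, (q.2 : EuclideanSpace ℝ (Fin n))) := by
  rw [angularVelocity, ContinuousLinearEquiv.apply_symm_apply]

theorem hasDerivAt_soEquiv_iff {f : ℝ → LieSO n} {f' : LieSO n} {t : ℝ} :
    HasDerivAt (fun s => soEquiv n (f s)) (soEquiv n f') t ↔ HasDerivAt f f' t := by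
  refine ⟨fun h => ?_,
    hasDerivAt_continuousLinearMap_comp (soEquiv n).toContinuousLinearMap⟩
  simpa using hasDerivAt_continuousLinearMap_comp (soEquiv n).symm.toContinuousLinearMap h

/-- Since `κ` is invertible, the angular velocity in the definition of a rolling curve is forced,
and the equations become those of an explicit vector field. -/
theorem isSphereCurve_iff (x : ℝ → ReducedSpace n) :
    (ballData hI hD ε).IsSphereCurve (fun t => reducedEquiv n (x t)) ↔ IsReducedRolling I D ε x := by
  have key : ∀ t, (ballData hI hD ε).field (soEquiv n (x t).1, ((x t).2 : EuclideanSpace ℝ (Fin n))) =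
      (soEquiv n ⁅(x t).1, angularVelocity hI hD ε (x t)⁆, WithLp.toLp 2
        (-(ε • (angularVelocity hI hD ε (x t)).1.mulVec (coords (x t).2)))) := by
    intro t
    refine Prod.ext ?_ ?_
    · rw [← soBracket_soEquiv, soEquiv_angularVelocity]
      rfl
    · rw [WithLp.toLp_neg, WithLp.toLp_smul]
      have := soAct_soEquiv (angularVelocity hI hD ε (x t)) ((x t).2 : EuclideanSpace ℝ (Fin n))
      rw [coords, ← this, soEquiv_angularVelocity]
      rfl
  constructor
  · intro h
    refine ⟨fun t => angularVelocity hI hD ε (x t), fun t => ?_⟩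
    have ht := h t
    change HasDerivAt _ ((ballData hI hD ε).field (soEquiv n (x t).1, ((x t).2 : EuclideanSpace ℝ (Fin n)))) t at ht
    rw [key] at ht
    exact ⟨(kappa_eq_iff hI hD ε _ _).2 rfl, hasDerivAt_soEquiv_iff.1 ht.fst, ht.snd⟩
  · rintro ⟨ω, h⟩ t
    obtain ⟨h1, h2, h3⟩ := h t
    rw [kappa_eq_iff hI hD ε] at h1
    rw [h1] at h2 h3
    change HasDerivAt _ ((ballData hI hD ε).field (soEquiv n (x t).1, ((x t).2 : EuclideanSpace ℝ (Fin n)))) t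
    rw [key]
    exact (hasDerivAt_soEquiv_iff.2 h2).prodMk h3

theorem measurePreserving_soEquiv : MeasurePreserving (soEquiv n) (volSO n) volume := by
  refine ⟨(soEquiv n).continuous.measurable, ?_⟩
  have hm : Measurable fun c : Pairs n → ℝ => ∑ p, c p • basisSO p :=
    Continuous.measurable (by fun_prop)
  rw [volSO, Measure.map_map (soEquiv n).continuous.measurable hm]
  rw [← (EuclideanSpace.volume_preserving_symm_measurableEquiv_toLp (Pairs n)).symm.map_eq]
  congr 1
  funext c
  change soCoord n _ = _
  simp only [map_sum, map_smul, soCoord_basisSO]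
  ext q
  simp [Pi.single_apply]

end ChaplyginBall

/-! ### The group `SO(n)` and the reduced system. -/

namespace ChaplyginBall

open Set Filter Topology
open scoped NNReal ENNReal RealInnerProductSpace

variable {n : ℕ}

instance secondCountableTopology_SO : SecondCountableTopology (SO n) :=
  have : SecondCountableTopology (Matrix (Fin n) (Fin n) ℝ) :=
    inferInstanceAs (SecondCountableTopology (Fin n → Fin n → ℝ))
  TopologicalSpace.Subtype.secondCountableTopology _

theorem SO_mul_transpose (g : SO n) : g.1 * g.1.transpose = 1 := by
  have := (Matrix.mem_orthogonalGroup_iff (Fin n) ℝ).1 (Matrix.mem_specialOrthogonalGroup_iff.1 g.2).1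
  exact this

theorem SO_transpose_mul (g : SO n) : g.1.transpose * g.1 = 1 :=
  mul_eq_one_comm.1 (SO_mul_transpose g)

theorem mem_SO_iff (A : Matrix (Fin n) (Fin n) ℝ) :
    A ∈ Matrix.specialOrthogonalGroup (Fin n) ℝ ↔ A * A.transpose = 1 ∧ A.det = 1 := by
  rw [Matrix.mem_specialOrthogonalGroup_iff, Matrix.mem_orthogonalGroup_iff]

instance isTopologicalGroup_SO : IsTopologicalGroup (SO n) where
  continuous_inv := by
    refine continuous_induced_rng.2 ?_
    change Continuous fun g : SO n => star g.1
    exact continuous_subtype_val.star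

instance compactSpace_SO : CompactSpace (SO n) := by
  refine isCompact_iff_compactSpace.1 ?_
  have h : IsCompact (univ.pi fun _ : Fin n => univ.pi fun _ : Fin n => Icc (-1 : ℝ) 1) :=
    isCompact_univ_pi fun _ => isCompact_univ_pi fun _ => isCompact_Icc
  refine IsCompact.of_isClosed_subset (X := Matrix (Fin n) (Fin n) ℝ) h ?_ fun A hA i _ j _ => ?_
  · have : (Matrix.specialOrthogonalGroup (Fin n) ℝ : Set (Matrix (Fin n) (Fin n) ℝ)) =
        {A | A * A.transpose = 1} ∩ {A | A.det = 1} := by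
      ext A
      exact mem_SO_iff A
    rw [this]
    exact (isClosed_eq (by fun_prop) continuous_const).inter
      (isClosed_eq (continuous_id.matrix_det) continuous_const)
  · have := entry_norm_bound_of_unitary (Matrix.mem_specialOrthogonalGroup_iff.1 hA).1 i j
    rw [Real.norm_eq_abs] at this
    exact abs_le.1 this

/-- A Haar measure on a compact group is right invariant. -/
theorem map_mul_right_haar {G : Type*} [Group G] [TopologicalSpace G] [IsTopologicalGroup G]
    [CompactSpace G] [SecondCountableTopology G] [MeasurableSpace G] [BorelSpace G]
    (μ : Measure G) [μ.IsHaarMeasure] (g : G) : μ.map (· * g) = μ := by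
  -- A right translate is again left invariant, hence a multiple of `μ`; comparing the finite
  -- nonzero total masses gives the factor 1.
  have h := Measure.isMulLeftInvariant_eq_smul (μ.map (· * g)) μ
  have h1 : (μ.map (· * g)) univ = μ univ := by
    rw [Measure.map_apply (measurable_mul_const g) .univ, preimage_univ]
  have h2 := congrArg (fun ν : Measure G => ν univ) h
  simp only [h1, Measure.smul_apply] at h2
  have h3 : (Measure.haarScalarFactor (μ.map (· * g)) μ : ℝ≥0∞) * μ univ = 1 * μ univ := by
    rw [one_mul]
    exact h2.symm
  rw [ENNReal.mul_left_inj (NeZero.ne _) (measure_ne_top μ univ)] at h3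
  rw [h, ENNReal.coe_eq_one.1 h3, one_smul]

theorem hasDerivAt_matrix_iff {g : ℝ → Matrix (Fin n) (Fin n) ℝ} {g' : Matrix (Fin n) (Fin n) ℝ}
    {t : ℝ} : HasDerivAt g g' t ↔ ∀ i j, HasDerivAt (fun s => g s i j) (g' i j) t := by
  constructor
  · intro h i j
    exact hasDerivAt_continuousLinearMap_comp
      (⟨Matrix.entryLinearMap ℝ ℝ i j, continuous_id.matrix_elem i j⟩ : Matrix (Fin n) (Fin n) ℝ →L[ℝ] ℝ) h
  · intro h
    have h1 : HasDerivAt (F := Fin n → Fin n → ℝ) (fun s i j => g s i j) (fun i j => g' i j) t :=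
      hasDerivAt_pi.2 fun i => hasDerivAt_pi.2 fun j => h i j
    exact hasDerivAt_continuousLinearMap_comp
      (⟨(Matrix.ofLinearEquiv ℝ).toLinearMap, continuous_id⟩ :
        (Fin n → Fin n → ℝ) →L[ℝ] Matrix (Fin n) (Fin n) ℝ) h1

theorem so_transpose (X : LieSO n) : X.1.transpose = -X.1 :=
  (LieAlgebra.Orthogonal.mem_so (Fin n) ℝ X.1).1 X.2

/-- Two solutions of the linear equation `g' = g ω` differ by a constant factor. -/
theorem mul_transpose_const {g h : ℝ → Matrix (Fin n) (Fin n) ℝ} {ω : ℝ → LieSO n}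
    (hg : ∀ t, HasDerivAt g (g t * (ω t).1) t) (hh : ∀ t, HasDerivAt h (h t * (ω t).1) t) (t : ℝ) :
    g t * (h t).transpose = g 0 * (h 0).transpose := by
  refine Matrix.ext fun i j => ?_
  have key : ∀ s, HasDerivAt (fun s => (g s * (h s).transpose) i j) 0 s := by
    intro s
    have h1 : ∀ k, HasDerivAt (fun s => g s i k * h s j k)
        ((g s * (ω s).1) i k * h s j k + g s i k * (h s * (ω s).1) j k) s := fun k =>
      (hasDerivAt_matrix_iff.1 (hg s) i k).mul (hasDerivAt_matrix_iff.1 (hh s) j k)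
    have h2 := HasDerivAt.fun_sum (u := Finset.univ) fun k _ => h1 k
    -- The two terms of the product rule cancel because `ω` is skew.
    have h3 : (g s * (ω s).1) * (h s).transpose + g s * (h s * (ω s).1).transpose = 0 := by
      rw [Matrix.transpose_mul, so_transpose, Matrix.neg_mul, Matrix.mul_neg, Matrix.mul_assoc,
        add_neg_cancel]
    rw [Finset.sum_add_distrib] at h2
    exact h2.congr_deriv (congrFun (congrFun h3 i) j)
  exact is_const_of_deriv_eq_zero (fun s => (key s).differentiableAt) (fun s => (key s).deriv) t 0

/-- The product `h hᵀ` stays equal to 1, so the determinant squares to 1; being continuous and 1 at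
time zero, it stays 1. -/
theorem mem_SO_of_hasDerivAt {h : ℝ → Matrix (Fin n) (Fin n) ℝ} {ω : ℝ → LieSO n}
    (hh : ∀ t, HasDerivAt h (h t * (ω t).1) t) (h0 : h 0 = 1) (t : ℝ) :
    h t ∈ Matrix.specialOrthogonalGroup (Fin n) ℝ := by
  have h1 : ∀ t, h t * (h t).transpose = 1 := fun t => by
    rw [mul_transpose_const hh hh t, h0, Matrix.transpose_one, Matrix.mul_one]
  refine (mem_SO_iff _).2 ⟨h1 t, ?_⟩
  have hc : Continuous fun t => (h t).det := by
    refine Continuous.matrix_det (continuous_matrix fun i j => ?_)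
    exact continuous_iff_continuousAt.2 fun s => (hasDerivAt_matrix_iff.1 (hh s) i j).continuousAt
  have h2 : ∀ t, (h t).det ^ 2 = 1 := fun t => by
    have := congrArg Matrix.det (h1 t)
    rwa [Matrix.det_mul, Matrix.det_transpose, Matrix.det_one, ← sq] at this
  exact isPreconnected_univ.eq_of_sq_eq (f := fun t => (h t).det) (g := fun _ => 1) hc.continuousOn
    continuousOn_const (fun t _ => by simpa using h2 t) (fun _ => one_ne_zero) (mem_univ 0)
    (by simp [h0]) (mem_univ t)

/-- The volume on `so(n)` is σ-finite. -/
instance sigmaFinite_volSO : SigmaFinite (volSO n) := by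
  have h := (measurePreserving_soEquiv (n := n)).symm (soEquiv n).toHomeomorph.toMeasurableEquiv
  rw [← h.map_eq]
  exact MeasurableEquiv.sigmaFinite_map _

instance isFiniteMeasure_volSphere : IsFiniteMeasure (volSphere n) :=
  inferInstanceAs (IsFiniteMeasure (volume : Measure (EuclideanSpace ℝ (Fin n))).toSphere)

variable {I : LieSO n →ₗ[ℝ] LieSO n} (hI : IsInertia I) {D : ℝ} (hD : 0 ≤ D) (ε : ℝ)

include hI hD in
theorem measurable_mu : Measurable fun γ : UnitSphere n => 1 / mu I D γ := by
  have := (ballData hI hD 0).measurable_dens_sphere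
  simpa only [ballData_dens] using this

include hI hD in
theorem measurable_density : Measurable fun γ : UnitSphere n => ENNReal.ofReal (1 / mu I D γ) :=
  (measurable_mu hI hD).ennreal_ofReal

theorem measurePreserving_reducedEquiv : MeasurePreserving (reducedEquiv n) (reducedMeasure I D)
    ((ballData hI hD ε).sphereMeasure volume volume) := by
  have h1 : MeasurePreserving (reducedEquiv n) ((volSO n).prod (volSphere n))
      ((volume : Measure (EuclideanSpace ℝ (Pairs n))).prod
        (volume : Measure (EuclideanSpace ℝ (Fin n))).toSphere) :=
    measurePreserving_soEquiv.prod (MeasurePreserving.id _)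
  refine ⟨h1.measurable, ?_⟩
  rw [RollingData.sphereMeasure, ← h1.map_eq, ← map_withDensity_comp _ h1.measurable]
  · simp only [ballData_dens]
    rfl
  · simp only [ballData_dens]
    exact (measurable_density hI hD).comp measurable_snd

include hI hD in
theorem reduced_flow_conj {Φ : ℝ → ReducedSpace n → ReducedSpace n}
    (hΦ : IsFlow (IsReducedRolling I D ε) Φ) :
    (∀ q, reducedEquiv n (Φ 0 ((reducedEquiv n).symm q)) = q) ∧
      ∀ q, (ballData hI hD ε).IsSphereCurve fun t => reducedEquiv n (Φ t ((reducedEquiv n).symm q)) :=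
  ⟨fun q => by rw [(hΦ _).1, Homeomorph.apply_symm_apply],
    fun q => (isSphereCurve_iff hI hD ε _).2 (hΦ _).2⟩

include hI hD in
theorem reduced_measurePreserving (hn : 2 ≤ n) {Φ : ℝ → ReducedSpace n → ReducedSpace n}
    (hΦ : IsFlow (IsReducedRolling I D ε) Φ) (t : ℝ) :
    MeasurePreserving (Φ t) (reducedMeasure I D) (reducedMeasure I D) := by
  have : Nontrivial (Fin n) := Fin.nontrivial_iff_two_le.2 hn
  have : Nontrivial (EuclideanSpace ℝ (Fin n)) := inferInstance
  obtain ⟨h0, h1⟩ := reduced_flow_conj hI hD ε hΦ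
  have h2 := RollingData.measurePreserving_sphereFlow volume volume h0 h1 t
  have h3 := measurePreserving_reducedEquiv hI hD ε
  have h4 := h3.symm (reducedEquiv n).toMeasurableEquiv
  have h5 := h4.comp (h2.comp h3)
  convert h5 using 1
  funext q
  simp

include hI hD in
theorem reduced_unique {x y : ℝ → ReducedSpace n} (hx : IsReducedRolling I D ε x)
    (hy : IsReducedRolling I D ε y) (h : x 0 = y 0) : x = y := by
  have := RollingData.IsSphereCurve.ext ((isSphereCurve_iff hI hD ε x).2 hx)
    ((isSphereCurve_iff hI hD ε y).2 hy) (by simp only [h])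
  funext t
  exact (reducedEquiv n).injective (congrFun this t)

/-- The flow of the reduced system together with the solution of `h' = h ω`, `h 0 = 1`. -/
theorem exists_reduced_flow : ∃ (Φ : ℝ → ReducedSpace n → ReducedSpace n)
    (h : ℝ → ReducedSpace n → SO n), IsFlow (IsReducedRolling I D ε) Φ ∧ (∀ q, h 0 q = 1) ∧
    (∀ q t, HasDerivAt (fun s => (h s q).1) ((h t q).1 * (angularVelocity hI hD ε (Φ t q)).1) t) ∧
    ∀ t, Continuous (h t) := by
  obtain ⟨Ψ, G, h1, h2, h3, h4, h5⟩ := (ballData hI hD ε).exists_sphereFlow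
    (fun i : Fin n => EuclideanSpace.single i (1 : ℝ))
  set Φ : ℝ → ReducedSpace n → ReducedSpace n :=
    fun t q => (reducedEquiv n).symm (Ψ t (reducedEquiv n q)) with hΦ
  -- The vectors `r' = -ω r` starting at the standard basis are the rows of `h`: since `ω` is skew,
  -- this is `h' = h ω` read row by row.
  let M : ℝ → ReducedSpace n → Matrix (Fin n) (Fin n) ℝ :=
    fun t q => Matrix.of fun i j => G t (reducedEquiv n q) i j
  have hM0 : ∀ q, M 0 q = 1 := by
    intro q
    refine Matrix.ext fun i j => ?_
    simp only [M, h3, Matrix.of_apply, PiLp.single_apply, Matrix.one_apply, eq_comm]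
  have hM : ∀ q t, HasDerivAt (fun s => M s q) (M t q * (angularVelocity hI hD ε (Φ t q)).1) t := by
    intro q t
    refine hasDerivAt_matrix_iff.2 fun i j => ?_
    have h6 := h4 (reducedEquiv n q) i t
    have h7 : (ballData hI hD ε).omega ((Ψ t (reducedEquiv n q)).1,
        ((Ψ t (reducedEquiv n q)).2 : EuclideanSpace ℝ (Fin n))) =
        soEquiv n (angularVelocity hI hD ε (Φ t q)) := by
      rw [soEquiv_angularVelocity]
      simp [hΦ, reducedEquiv]
    rw [h7] at h6
    have h8 := hasDerivAt_continuousLinearMap_comp (EuclideanSpace.proj j : EuclideanSpace ℝ (Fin n) →L[ℝ] ℝ) h6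
    have h9 : (ballData hI hD ε).act = soAct n := rfl
    rw [h9, soAct_soEquiv] at h8
    refine h8.congr_deriv ?_
    have h10 : (M t q * (angularVelocity hI hD ε (Φ t q)).1) i j =
        ∑ k, M t q i k * (angularVelocity hI hD ε (Φ t q)).1 k j := Matrix.mul_apply
    rw [h10]
    change -(∑ k, (angularVelocity hI hD ε (Φ t q)).1 j k * M t q i k) = _
    rw [← Finset.sum_neg_distrib]
    refine Finset.sum_congr rfl fun k _ => ?_
    rw [so_apply _ k j, mul_neg, mul_comm]
  refine ⟨Φ, fun t q => ⟨M t q, mem_SO_of_hasDerivAt (hM q) (hM0 q) t⟩, fun q => ⟨?_, ?_⟩,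
    fun q => Subtype.ext (hM0 q), hM, fun t => ?_⟩
  · simp [hΦ, h1]
  · rw [← isSphereCurve_iff hI hD ε]
    simpa [hΦ] using h2 (reducedEquiv n q)
  · refine continuous_induced_rng.2 (continuous_matrix fun i j => ?_)
    have h6 : Continuous fun q => G t (reducedEquiv n q) := (h5 t).comp (reducedEquiv n).continuous
    change Continuous fun q => G t (reducedEquiv n q) i j
    fun_prop

include hI hD in
theorem reduced_hasInvariantMeasure (hn : 2 ≤ n) :
    HasInvariantMeasure (IsReducedRolling I D ε) (reducedMeasure I D) := by
  obtain ⟨Φ, h, hΦ, -⟩ := exists_reduced_flow hI hD ε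
  exact ⟨⟨Φ, hΦ⟩, fun Φ hΦ t => reduced_measurePreserving hI hD ε hn hΦ t⟩

end ChaplyginBall

/-! ### The canonical volume and the full system. -/

namespace ChaplyginBall

open Set Filter Topology
open scoped NNReal ENNReal RealInnerProductSpace

variable {n : ℕ}

theorem killing_zero_right (X : LieSO n) : killing X 0 = 0 := by
  rw [killing_eq_inner, map_zero, inner_zero_right]

/-- The top power of the canonical form on the frame does not depend on the point. -/
theorem wedgePower_canonicalForm (k : LieSO n) :
    wedgePower (canonicalForm k) (frame (n := n)) =
      wedgePower (canonicalForm 0) (frame (n := n)) := by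
  have h1 : ∀ q q' : Pairs n × Fin 2, ¬(q.2 = 0 ∧ q'.2 = 0) →
      canonicalForm k (frame q) (frame q') = canonicalForm 0 (frame q) (frame q') := by
    intro q q' h
    have h2 : ⁅(frame q).1, (frame q').1⁆ = 0 := by
      rcases not_and_or.1 h with h | h
      · simp only [frame, if_neg h, zero_lie]
      · rw [show (frame q').1 = 0 by simp only [frame, if_neg h], lie_zero]
    rw [canonicalForm, canonicalForm, h2, killing_zero_right, killing_zero_right]
  have h0 : ∀ (k : LieSO n) (q q' : Pairs n × Fin 2), q.2 ≠ 0 → q'.2 ≠ 0 →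
      canonicalForm k (frame q) (frame q') = 0 := by
    intro k q q' h h'
    have h2 : (frame q).1 = 0 := by simp only [frame, if_neg h]
    have h3 : (frame q').1 = 0 := by simp only [frame, if_neg h']
    rw [canonicalForm, h2, h3, lie_zero, killing_zero_right, killing_zero_right, killing_zero_right,
      sub_zero, sub_zero]
  unfold wedgePower
  congr 1
  refine Finset.sum_congr rfl fun σ _ => ?_
  congr 1
  -- Only a factor on two vectors `(E_p, 0)` involves `k`. If one occurs, another factor has two
  -- vectors `(0, E_p)`, as both kinds are equally numerous, and the form vanishes on these.
  by_cases h : ∀ i, ¬((σ (i, 0)).2 = 0 ∧ (σ (i, 1)).2 = 0)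
  · exact Finset.prod_congr rfl fun i _ => h1 _ _ (h i)
  · obtain ⟨i, hi⟩ := not_forall.1 h
    rw [not_not] at hi
    obtain ⟨j, hj0, hj1⟩ : ∃ j, (σ (j, 0)).2 ≠ 0 ∧ (σ (j, 1)).2 ≠ 0 := by
      by_contra hcon
      let f : Pairs n × Fin 2 → ℕ := fun q => if q.2 = 0 then 1 else 0
      have hsum : ∑ q, f (σ q) = ∑ q, f q := Equiv.sum_comp σ f
      rw [Fintype.sum_prod_type, Fintype.sum_prod_type] at hsum
      have hlt : ∑ j : Pairs n, ∑ b, f (j, b) < ∑ j : Pairs n, ∑ b, f (σ (j, b)) := by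
        refine Finset.sum_lt_sum (fun j _ => ?_) ⟨i, Finset.mem_univ i, ?_⟩
        · rw [Fin.sum_univ_two, Fin.sum_univ_two]
          have hj : (σ (j, 0)).2 = 0 ∨ (σ (j, 1)).2 = 0 := by
            by_contra hne
            rw [not_or] at hne
            exact hcon ⟨j, hne⟩
          rcases hj with hj | hj <;> simp [f, hj]
        · rw [Fin.sum_univ_two, Fin.sum_univ_two]
          simp [f, hi.1, hi.2]
      exact hlt.ne' hsum
    rw [Finset.prod_eq_zero (Finset.mem_univ j) (h0 _ _ _ hj0 hj1),
      Finset.prod_eq_zero (Finset.mem_univ j) (h0 _ _ _ hj0 hj1)]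

/-- The exchange of the last two factors of the phase space. -/
def phaseEquiv (n : ℕ) : PhaseSpace n ≃ᵐ ReducedSpace n × SO n :=
  MeasurableEquiv.prodAssoc.trans
    (((MeasurableEquiv.refl (LieSO n)).prodCongr MeasurableEquiv.prodComm).trans
      MeasurableEquiv.prodAssoc.symm)

variable {I : LieSO n →ₗ[ℝ] LieSO n} (hI : IsInertia I) {D : ℝ} (hD : 0 ≤ D) (ε : ℝ)

include hI hD in
-- The density of `Ω^d` is a constant, which can be pulled out, and `μ` depends on `γ` alone; what
-- remains is a reordering of factors. Invariance later does not depend on the value of the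
-- constant.
theorem measurePreserving_phaseEquiv (haar : Measure (SO n)) [haar.IsHaarMeasure] :
    MeasurePreserving (phaseEquiv n) (phaseMeasure haar I D)
      (ENNReal.ofReal |wedgePower (canonicalForm 0) (frame (n := n))| •
        (reducedMeasure I D).prod haar) := by
  refine ⟨(phaseEquiv n).measurable, ?_⟩
  have h1 : MeasurePreserving (phaseEquiv n) (((volSO n).prod haar).prod (volSphere n))
      (((volSO n).prod (volSphere n)).prod haar) :=
    (MeasurePreserving.symm _ (measurePreserving_prodAssoc (volSO n) (volSphere n) haar)).comp
      (((MeasurePreserving.id (volSO n)).prod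
        (Measure.measurePreserving_swap (μ := haar) (ν := volSphere n))).comp
      (measurePreserving_prodAssoc (volSO n) haar (volSphere n)))
  have hm := measurable_density hI hD
  have hm1 : Measurable fun q : ReducedSpace n => ENNReal.ofReal (1 / mu I D q.2) :=
    hm.comp measurable_snd
  rw [phaseMeasure, liouville, reducedMeasure]
  simp only [wedgePower_canonicalForm]
  rw [withDensity_const, Measure.prod_smul_left, withDensity_smul_measure, Measure.map_smul,
    prod_withDensity_left hm1, ← h1.map_eq, ← map_withDensity_comp _ h1.measurable]
  · rfl
  · exact hm1.comp measurable_fst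

/-- The reduction of a solution of the full system. -/
def reduction (p : PhaseSpace n) : ReducedSpace n := (p.1.1, p.2)

theorem IsRolling.reduced {x : ℝ → PhaseSpace n} (h : IsRolling I D ε x) :
    IsReducedRolling I D ε fun t => reduction (x t) := by
  obtain ⟨ω, hω⟩ := h
  exact ⟨ω, fun t => ⟨(hω t).1, (hω t).2.1, (hω t).2.2.2⟩⟩

include hI hD in
-- Every flow is `(q, g) ↦ (Ψ t q, g * h t q)`: the base part by uniqueness for the reduced system,
-- the fibre part because `g hᵀ` is constant. Such a skew product with right translations preserves
-- the reduced measure times Haar.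
theorem full_hasInvariantMeasure (hn : 2 ≤ n) (haar : Measure (SO n)) [haar.IsHaarMeasure] :
    HasInvariantMeasure (IsRolling I D ε) (phaseMeasure haar I D) := by
  obtain ⟨Ψ, h, hΨ, h0, h1, h2⟩ := exists_reduced_flow hI hD ε
  constructor
  · refine ⟨fun t p => (((Ψ t (reduction p)).1, p.1.2 * h t (reduction p)), (Ψ t (reduction p)).2),
      fun p => ⟨?_, fun t => angularVelocity hI hD ε (Ψ t (reduction p)), fun t => ?_⟩⟩
    · dsimp only
      rw [(hΨ _).1, h0, mul_one]
      rfl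
    · obtain ⟨ω, hω⟩ := (hΨ (reduction p)).2
      obtain ⟨h3, h4, h5⟩ := hω t
      rw [kappa_eq_iff hI hD ε] at h3
      rw [h3] at h4 h5
      refine ⟨(kappa_eq_iff hI hD ε _ (Ψ t (reduction p))).2 rfl, h4, ?_, h5⟩
      have := hasDerivAt_continuousLinearMap_comp
        (⟨LinearMap.mulLeft ℝ p.1.2.1, continuous_const.mul continuous_id⟩ :
          Matrix (Fin n) (Fin n) ℝ →L[ℝ] Matrix (Fin n) (Fin n) ℝ) (h1 (reduction p) t)
      convert! this using 1
      exact Matrix.mul_assoc _ _ _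
  · intro Φ hΦ t
    have hred : ∀ p t, reduction (Φ t p) = Ψ t (reduction p) := by
      intro p t
      refine congrFun (reduced_unique hI hD ε (hΦ p).2.reduced (hΨ (reduction p)).2 ?_) t
      rw [(hΦ p).1, (hΨ _).1]
    have hg : ∀ p t, (Φ t p).1.2 = p.1.2 * h t (reduction p) := by
      intro p t
      obtain ⟨ω, hω⟩ := (hΦ p).2
      have h3 : ∀ t, ω t = angularVelocity hI hD ε (Ψ t (reduction p)) := fun t => by
        rw [← hred]
        exact (kappa_eq_iff hI hD ε _ (reduction (Φ t p))).1 (hω t).1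
      have h4 := mul_transpose_const (fun t => (hω t).2.2.1) (fun t => by
        rw [h3]
        exact h1 (reduction p) t) t
      beta_reduce at h4
      rw [h0, (hΦ p).1] at h4
      refine Subtype.ext ?_
      calc (Φ t p).1.2.1 = (Φ t p).1.2.1 * (h t (reduction p)).1.transpose * (h t (reduction p)).1 := by
            rw [Matrix.mul_assoc, SO_transpose_mul, Matrix.mul_one]
        _ = p.1.2.1 * (h t (reduction p)).1 := by
            rw [h4]
            simp
    have hskew : MeasurePreserving
        (fun z : ReducedSpace n × SO n => (Ψ t z.1, z.2 * h t z.1))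
        ((reducedMeasure I D).prod haar) ((reducedMeasure I D).prod haar) := by
      have : SFinite (reducedMeasure I D) := by
        unfold reducedMeasure
        infer_instance
      refine (reduced_measurePreserving hI hD ε hn hΨ t).skew_product
        (g := fun q g => g * h t q) ?_ (ae_of_all _ fun q => map_mul_right_haar haar _)
      exact (continuous_snd.mul ((h2 t).comp continuous_fst)).measurable
    have h5 := measurePreserving_phaseEquiv hI hD haar
    have h6 := (h5.symm (phaseEquiv n)).comp ((hskew.smul_measure
      (ENNReal.ofReal |wedgePower (canonicalForm 0) (frame (n := n))|)).comp h5)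
    convert h6 using 1
    funext p
    refine ((phaseEquiv n).symm_apply_eq.2 ?_).symm
    exact Prod.ext (hred p t).symm (hg p t).symm

end ChaplyginBall

/-! ### The determinant for the special inertia operators. -/

namespace ChaplyginBall

open Set Filter Topology
open scoped NNReal ENNReal RealInnerProductSpace

variable {n : ℕ}

theorem linearMap_det_one_add_comp_comm {M N : Type*} [AddCommGroup M] [Module ℝ M]
    [FiniteDimensional ℝ M] [AddCommGroup N] [Module ℝ N] [FiniteDimensional ℝ N]
    (F : N →ₗ[ℝ] M) (V : M →ₗ[ℝ] N) :
    LinearMap.det (1 + F ∘ₗ V) = LinearMap.det (1 + V ∘ₗ F) := by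
  let b := Module.finBasis ℝ M
  let c := Module.finBasis ℝ N
  rw [← LinearMap.det_toMatrix b, ← LinearMap.det_toMatrix c, map_add, map_add,
    LinearMap.toMatrix_comp b c b, LinearMap.toMatrix_comp c b c, LinearMap.toMatrix_one,
    LinearMap.toMatrix_one, Matrix.det_one_add_mul_comm]

theorem det_smul_one_add_mul {c : ℝ} (hc : c ≠ 0) (P : Matrix (Fin n) (Fin 2) ℝ)
    (Q : Matrix (Fin 2) (Fin n) ℝ) :
    (c • (1 : Matrix (Fin n) (Fin n) ℝ) + P * Q).det = c ^ n * (1 + c⁻¹ • (Q * P)).det := by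
  have h : c • (1 : Matrix (Fin n) (Fin n) ℝ) + P * Q = c • (1 + (c⁻¹ • P) * Q) := by
    rw [smul_add, Matrix.smul_mul, smul_smul, mul_inv_cancel₀ hc, one_smul]
  rw [h, Matrix.det_smul, Matrix.det_one_add_mul_comm, Matrix.mul_smul, Fintype.card_fin]

theorem sum_soCoord (X : LieSO n) : ∑ p, soCoord n X p • basisSO p = X := by
  refine soCoord_injective ?_
  simp only [map_sum, map_smul, soCoord_basisSO]
  ext q
  simp [Pi.single_apply]

/-- The operator `X ↦ B X B - X / D` for a diagonal matrix `B`. -/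
noncomputable def inverseInertia (b : Fin n → ℝ) (D : ℝ) : LieSO n →ₗ[ℝ] LieSO n where
  toFun X := ⟨Matrix.diagonal b * X.1 * Matrix.diagonal b - D⁻¹ • X.1, by
    rw [LieAlgebra.Orthogonal.mem_so, Matrix.transpose_sub, Matrix.transpose_mul,
      Matrix.transpose_mul, Matrix.transpose_smul, so_transpose, Matrix.diagonal_transpose,
      Matrix.neg_mul, Matrix.mul_neg, Matrix.mul_assoc, smul_neg, neg_sub_neg, neg_sub]⟩
  map_add' X Y := by
    refine Subtype.ext ?_
    change _ * (X.1 + Y.1) * _ - D⁻¹ • (X.1 + Y.1) = (_ - D⁻¹ • X.1) + (_ - D⁻¹ • Y.1)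
    rw [Matrix.mul_add, Matrix.add_mul, smul_add]
    abel
  map_smul' c X := by
    refine Subtype.ext ?_
    change _ * (c • X.1) * _ - D⁻¹ • (c • X.1) = c • (_ - D⁻¹ • X.1)
    rw [Matrix.mul_smul, Matrix.smul_mul, smul_sub, smul_comm c]

theorem inverseInertia_coe (b : Fin n → ℝ) (D : ℝ) (X : LieSO n) :
    (inverseInertia b D X).1 = Matrix.diagonal b * X.1 * Matrix.diagonal b - D⁻¹ • X.1 := rfl

theorem inverseInertia_wedge_stdVec (b : Fin n → ℝ) (D : ℝ) (i j : Fin n) :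
    inverseInertia b D (wedge (stdVec i) (stdVec j)) =
      (b i * b j - D⁻¹) • wedge (stdVec i) (stdVec j) := by
  refine Subtype.ext ?_
  change _ = _ • (wedge (stdVec i) (stdVec j)).1
  rw [inverseInertia_coe, sub_smul]
  congr 1
  ext k l
  rw [Matrix.mul_diagonal, Matrix.diagonal_mul, wedge_coe]
  simp only [Matrix.sub_apply, Matrix.smul_apply, Matrix.vecMulVec_apply, stdVec, Pi.single_apply,
    smul_eq_mul]
  by_cases h1 : k = i <;> by_cases h2 : l = j <;> by_cases h3 : k = j <;> by_cases h4 : l = i <;>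
    simp_all
  all_goals ring

/-- The vector `ξ γ`. -/
def evalVec (γ : UnitSphere n) : LieSO n →ₗ[ℝ] (Fin n → ℝ) where
  toFun X := X.1.mulVec (coords γ)
  map_add' X Y := Matrix.add_mulVec X.1 Y.1 _
  map_smul' c X := Matrix.smul_mulVec c X.1 _

/-- The map `x ↦ x ∧ γ`. -/
def wedgeVec (γ : UnitSphere n) : (Fin n → ℝ) →ₗ[ℝ] LieSO n where
  toFun x := wedge x (coords γ)
  map_add' x y := Subtype.ext <| by
    change Matrix.vecMulVec _ _ - Matrix.vecMulVec _ _ = (_ - _) + (_ - _)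
    rw [Matrix.add_vecMulVec, Matrix.vecMulVec_add]
    abel
  map_smul' c x := Subtype.ext <| by
    change Matrix.vecMulVec _ _ - Matrix.vecMulVec _ _ = c • (_ - _)
    rw [Matrix.smul_vecMulVec, Matrix.vecMulVec_smul, smul_sub]

theorem prV_eq_comp (γ : UnitSphere n) : prV γ = wedgeVec γ ∘ₗ evalVec γ :=
  LinearMap.ext (prV_eq_wedge γ)

theorem coords_dotProduct_self (γ : UnitSphere n) : coords γ ⬝ᵥ coords γ = 1 := by
  have h : ‖(γ : EuclideanSpace ℝ (Fin n))‖ = 1 := norm_eq_of_mem_sphere γ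
  have h2 := euclidean_inner (γ : EuclideanSpace ℝ (Fin n)) γ
  rw [real_inner_self_eq_norm_sq, h, one_pow] at h2
  exact h2.symm

/-- Using `γᵀγ = 1`, the part `-X / D` contributes `-x + (γ, x) γ`, which cancels the leading `x`
and leaves `γ γᵀ`. -/
theorem evalVec_inverseInertia_wedgeVec (b : Fin n → ℝ) {D : ℝ} (hD : D ≠ 0) (γ : UnitSphere n)
    (x : Fin n → ℝ) :
    x + evalVec γ (D • inverseInertia b D (wedgeVec γ x)) =
      ((D * ((b * coords γ) ⬝ᵥ coords γ)) • Matrix.diagonal b -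
        D • Matrix.vecMulVec (b * coords γ) (b * coords γ) +
        Matrix.vecMulVec (coords γ) (coords γ)).mulVec x := by
  set g := coords γ with hg
  have hgg : g ⬝ᵥ g = 1 := coords_dotProduct_self γ
  have hdiag : ∀ v, (Matrix.diagonal b).mulVec v = b * v := fun v => by
    funext i
    rw [Matrix.mulVec_diagonal]
    rfl
  have h1 : evalVec γ (D • inverseInertia b D (wedgeVec γ x)) =
      D • ((Matrix.diagonal b * (Matrix.vecMulVec x g - Matrix.vecMulVec g x) * Matrix.diagonal b -
        D⁻¹ • (Matrix.vecMulVec x g - Matrix.vecMulVec g x)).mulVec g) := by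
    rw [map_smul]
    rfl
  rw [h1, Matrix.sub_mulVec, ← Matrix.mulVec_mulVec, ← Matrix.mulVec_mulVec, Matrix.smul_mulVec,
    Matrix.sub_mulVec, Matrix.sub_mulVec, Matrix.add_mulVec, Matrix.sub_mulVec, Matrix.smul_mulVec,
    Matrix.smul_mulVec]
  simp only [Matrix.vecMulVec_mulVec, hdiag, hgg, dotProduct_comm x]
  funext i
  simp only [Pi.add_apply, Pi.sub_apply, Pi.smul_apply, Pi.mul_apply, smul_eq_mul,
    MulOpposite.smul_eq_mul_unop, MulOpposite.unop_op, dotProduct_comm g (b * g),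
    dotProduct_comm g x]
  field_simp
  ring

/-- Multiplying by `diag a` turns the matrix into a scalar matrix plus one of rank two, so the
determinant reduces to size two. -/
theorem det_diagonal_mul_rank_two {a : Fin n → ℝ} (ha : ∀ i, a i ≠ 0) (hn : 2 ≤ n) {D : ℝ}
    (hD : D ≠ 0) {g : Fin n → ℝ} (hg : g ⬝ᵥ g = 1) (hq : (a⁻¹ * g) ⬝ᵥ g ≠ 0) :
    (∏ i, a i) * ((D * ((a⁻¹ * g) ⬝ᵥ g)) • Matrix.diagonal a⁻¹ -
        D • Matrix.vecMulVec (a⁻¹ * g) (a⁻¹ * g) + Matrix.vecMulVec g g).det =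
      D ^ (n - 1) * ((a⁻¹ * g) ⬝ᵥ g) ^ (n - 2) := by
  set q := (a⁻¹ * g) ⬝ᵥ g with hqdef
  have h1 : Matrix.diagonal a * ((D * q) • Matrix.diagonal a⁻¹ -
        D • Matrix.vecMulVec (a⁻¹ * g) (a⁻¹ * g) + Matrix.vecMulVec g g) =
      (D * q) • (1 : Matrix (Fin n) (Fin n) ℝ) +
        (Matrix.of fun i => ![-D * g i, a i * g i]) * Matrix.of ![a⁻¹ * g, g] := by
    ext i j
    rw [Matrix.diagonal_mul]
    simp only [Matrix.add_apply, Matrix.sub_apply, Matrix.smul_apply, Matrix.vecMulVec_apply,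
      Matrix.mul_apply, Fin.sum_univ_two, Matrix.of_apply, Matrix.cons_val_zero, Matrix.cons_val_one,
      Pi.mul_apply, Pi.inv_apply, smul_eq_mul, Matrix.diagonal_apply, Matrix.one_apply]
    have := ha i
    have := ha j
    split_ifs <;> field_simp <;> ring
  have h2 : (Matrix.of ![a⁻¹ * g, g] : Matrix (Fin 2) (Fin n) ℝ) *
      (Matrix.of fun i => ![-D * g i, a i * g i]) = !![-D * q, 1; -D, (a * g) ⬝ᵥ g] := by
    ext i j
    have e1 : ∑ k, (a k)⁻¹ * g k * (a k * g k) = 1 := by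
      rw [← hg]
      refine Finset.sum_congr rfl fun k _ => ?_
      have := ha k
      field_simp
    have e2 : ∑ k, (a k)⁻¹ * g k * (D * g k) = D * q := by
      rw [hqdef, dotProduct, Finset.mul_sum]
      exact Finset.sum_congr rfl fun k _ => by simp only [Pi.mul_apply, Pi.inv_apply]; ring
    have e3 : ∑ k, g k * (D * g k) = D := by
      conv_rhs => rw [← mul_one D, ← hg, dotProduct, Finset.mul_sum]
      exact Finset.sum_congr rfl fun k _ => by ring
    have e4 : ∑ k, g k * (a k * g k) = (a * g) ⬝ᵥ g :=
      Finset.sum_congr rfl fun k _ => mul_comm _ _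
    fin_cases i <;> fin_cases j <;> simp [Matrix.mul_apply, e1, e2, e3, e4]
  have hc : D * q ≠ 0 := mul_ne_zero hD hq
  -- In `1 + (D q)⁻¹ Q P` the upper left entry is zero, so `(A γ, γ)` drops out; the determinant is
  -- `1 / (D q²)`, against the prefactor `(D q)^n`.
  rw [← Matrix.det_diagonal, ← Matrix.det_mul, h1, det_smul_one_add_mul hc, h2, Matrix.det_fin_two]
  obtain ⟨m, rfl⟩ := Nat.exists_eq_add_of_le' hn
  simp only [Matrix.add_apply, Matrix.smul_apply, Matrix.one_apply, Matrix.of_apply,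
    Matrix.cons_val', Matrix.cons_val_zero, Matrix.cons_val_one, Matrix.cons_val_fin_one,
    smul_eq_mul]
  rw [show m + 2 - 1 = m + 1 by omega, show m + 2 - 2 = m by omega]
  simp only [Fin.isValue, if_true, zero_ne_one, one_ne_zero, if_false]
  field_simp
  ring

variable {I : LieSO n →ₗ[ℝ] LieSO n}

/-- On `E_i ∧ E_j` the eigenvalues `1 / (a_i a_j) - 1 / D` and `D a_i a_j / (D - a_i a_j)` are
reciprocal. -/
theorem inertia_comp_inverseInertia {D : ℝ} {a : Fin n → ℝ}
    (ha : ∀ i j, i ≠ j → 0 < a i * a j ∧ a i * a j < D)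
    (hIa : ∀ i j, I (wedge (stdVec i) (stdVec j)) =
      (D * a i * a j / (D - a i * a j)) • wedge (stdVec i) (stdVec j)) :
    I ∘ₗ inverseInertia a⁻¹ D = LinearMap.id := by
  refine LinearMap.ext fun X => ?_
  rw [← sum_soCoord X, map_sum, map_sum]
  refine Finset.sum_congr rfl fun p _ => ?_
  rw [map_smul, map_smul]
  congr 1
  obtain ⟨h1, h2⟩ := ha p.1.1 p.1.2 p.2.ne
  have h3 : a p.1.1 ≠ 0 := left_ne_zero_of_mul h1.ne'
  have h4 : a p.1.2 ≠ 0 := right_ne_zero_of_mul h1.ne'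
  have h5 : D - a p.1.1 * a p.1.2 ≠ 0 := by linarith
  have h6 : D ≠ 0 := by linarith
  rw [LinearMap.comp_apply, basisSO, inverseInertia_wedge_stdVec, map_smul, hIa, smul_smul,
    LinearMap.id_apply]
  convert one_smul ℝ _ using 2
  simp only [Pi.inv_apply]
  field_simp

/-- Factor `κ = 𝕀 (1 + D 𝕀⁻¹ pr)` and move the determinant of the second factor from `so(n)` to
`ℝⁿ`. -/
theorem det_kappa_of_special (hn : 2 ≤ n) {D : ℝ} {a : Fin n → ℝ}
    (ha : ∀ i j, i ≠ j → 0 < a i * a j ∧ a i * a j < D)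
    (hIa : ∀ i j, I (wedge (stdVec i) (stdVec j)) =
      (D * a i * a j / (D - a i * a j)) • wedge (stdVec i) (stdVec j)) (hD : D ≠ 0)
    (ha0 : ∀ i, a i ≠ 0) (γ : UnitSphere n) (hq : (a⁻¹ * coords γ) ⬝ᵥ coords γ ≠ 0) :
    LinearMap.det (kappa I D γ) = LinearMap.det I * (∏ i, a i)⁻¹ * D ^ (n - 1) *
      ((a⁻¹ * coords γ) ⬝ᵥ coords γ) ^ (n - 2) := by
  have : FiniteDimensional ℝ (LieSO n) := (soEquiv n).symm.toLinearEquiv.finiteDimensional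
  have h1 : kappa I D γ =
      I ∘ₗ (1 + (D • inverseInertia a⁻¹ D ∘ₗ wedgeVec γ) ∘ₗ evalVec γ) := by
    refine LinearMap.ext fun X => ?_
    have h2 : ∀ Y, I (inverseInertia a⁻¹ D Y) = Y := fun Y =>
      congrArg (fun f : LieSO n →ₗ[ℝ] LieSO n => f Y) (inertia_comp_inverseInertia ha hIa)
    simp [kappa, prV_eq_comp, h2]
  have h3 : 1 + evalVec γ ∘ₗ (D • inverseInertia a⁻¹ D ∘ₗ wedgeVec γ) =
      Matrix.toLin' ((D * ((a⁻¹ * coords γ) ⬝ᵥ coords γ)) • Matrix.diagonal a⁻¹ -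
        D • Matrix.vecMulVec (a⁻¹ * coords γ) (a⁻¹ * coords γ) +
        Matrix.vecMulVec (coords γ) (coords γ)) :=
    LinearMap.ext (evalVec_inverseInertia_wedgeVec a⁻¹ hD γ)
  have h4 := det_diagonal_mul_rank_two ha0 hn hD (coords_dotProduct_self γ) hq
  have h5 : ∏ i, a i ≠ 0 := Finset.prod_ne_zero_iff.2 fun i _ => ha0 i
  rw [h1, LinearMap.det_comp, linearMap_det_one_add_comp_comm, h3, LinearMap.det_toLin',
    mul_assoc, mul_assoc, ← h4, inv_mul_cancel_left₀ h5]

theorem mu_of_special (hI : IsInertia I) (hn : 2 ≤ n) {D : ℝ} {a : Fin n → ℝ}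
    (ha : ∀ i j, i ≠ j → 0 < a i * a j ∧ a i * a j < D)
    (hIa : ∀ i j, I (wedge (stdVec i) (stdVec j)) =
      (D * a i * a j / (D - a i * a j)) • wedge (stdVec i) (stdVec j)) (hD : 0 < D) :
    ∃ c : ℝ, 0 < c ∧ ∀ γ : UnitSphere n, mu I D γ =
      c * |dotProduct (coords γ) ((Matrix.diagonal a)⁻¹.mulVec (coords γ))| ^
        (((n : ℝ) - 2) / 2) := by
  have : Nontrivial (Fin n) := Fin.nontrivial_iff_two_le.2 hn
  have ha0 : ∀ i, a i ≠ 0 := fun i => by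
    obtain ⟨j, hj⟩ := exists_ne i
    exact left_ne_zero_of_mul (ha i j hj.symm).1.ne'
  have hinv : (Matrix.diagonal a)⁻¹ = Matrix.diagonal a⁻¹ := by
    refine Matrix.inv_eq_right_inv ?_
    rw [Matrix.diagonal_mul_diagonal, ← Matrix.diagonal_one]
    congr 1
    funext i
    exact mul_inv_cancel₀ (ha0 i)
  have hquad : ∀ γ : UnitSphere n, coords γ ⬝ᵥ ((Matrix.diagonal a)⁻¹.mulVec (coords γ)) =
      (a⁻¹ * coords γ) ⬝ᵥ coords γ := by
    intro γ
    rw [hinv, dotProduct_comm]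
    congr 1
    funext i
    rw [Matrix.mulVec_diagonal]
    rfl
  have hq : ∀ γ : UnitSphere n, (a⁻¹ * coords γ) ⬝ᵥ coords γ ≠ 0 := by
    intro γ h
    obtain ⟨i₀⟩ : Nonempty (Fin n) := inferInstance
    -- All `a i` have the same sign, so multiplication by one of them makes the quadratic form
    -- positive definite.
    have hpos : ∀ i, 0 < a i₀ * (a i)⁻¹ := by
      intro i
      have h1 : 0 < a i₀ * a i := by
        by_cases hi : i₀ = i
        · rw [hi]
          exact mul_self_pos.2 (ha0 i)
        · exact (ha i₀ i hi).1
      have h2 : a i₀ * (a i)⁻¹ = a i₀ * a i * ((a i)⁻¹) ^ 2 := by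
        have := ha0 i
        field_simp
      rw [h2]
      have := ha0 i
      positivity
    have h1 : ∑ i, a i₀ * (a i)⁻¹ * (coords γ i) ^ 2 = 0 := by
      have h2 := congrArg (a i₀ * ·) h
      simp only [dotProduct, Finset.mul_sum, mul_zero] at h2
      rw [← h2]
      exact Finset.sum_congr rfl fun i _ => by simp only [Pi.mul_apply, Pi.inv_apply]; ring
    have h3 := (Finset.sum_eq_zero_iff_of_nonneg fun i _ =>
      mul_nonneg (hpos i).le (sq_nonneg (coords γ i))).1 h1
    have h4 : coords γ = 0 := by
      funext i
      have := (mul_eq_zero.1 (h3 i (Finset.mem_univ i))).resolve_left (hpos i).ne'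
      exact pow_eq_zero_iff two_ne_zero |>.1 this
    have h5 := coords_dotProduct_self γ
    rw [h4, dotProduct_zero] at h5
    exact zero_ne_one h5
  set C := LinearMap.det I * (∏ i, a i)⁻¹ * D ^ (n - 1) with hC
  -- The signs of `C` and of the quadratic form need not be tracked: the determinant is positive,
  -- hence equal to its absolute value.
  have hdet : ∀ γ : UnitSphere n, LinearMap.det (kappa I D γ) =
      |C| * |(a⁻¹ * coords γ) ⬝ᵥ coords γ| ^ (n - 2) := by
    intro γ
    have h1 : 0 < LinearMap.det (kappa I D γ) := by
      rw [← det_ballData_kap hI hD.le 0]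
      exact RollingData.det_kap_pos _ _
    rw [← abs_of_pos h1, det_kappa_of_special hn ha hIa hD.ne' ha0 γ (hq γ), abs_mul, abs_pow]
  have hC0 : C ≠ 0 := by
    intro h
    have : Nontrivial (EuclideanSpace ℝ (Fin n)) := inferInstance
    obtain ⟨γ⟩ : Nonempty (UnitSphere n) := (NormedSpace.sphere_nonempty.2 zero_le_one).to_subtype
    have h1 : 0 < LinearMap.det (kappa I D γ) := by
      rw [← det_ballData_kap hI hD.le 0]
      exact RollingData.det_kap_pos _ _
    rw [hdet, h, abs_zero, zero_mul] at h1
    exact lt_irrefl _ h1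
  refine ⟨Real.sqrt |C|, Real.sqrt_pos.2 (abs_pos.2 hC0), fun γ => ?_⟩
  rw [mu, hdet, Real.sqrt_mul (abs_nonneg C), hquad, Real.sqrt_eq_rpow (_ ^ (n - 2)),
    ← Real.rpow_natCast, ← Real.rpow_mul (abs_nonneg _), Nat.cast_sub hn]
  congr 2
  push_cast
  ring

end ChaplyginBall

open ChaplyginBall in
/-- The ball has mass `m`, radius `ρ` and inertia operator `I`; the fixed sphere has radius `σ`.
The sign is `s = 1` for rolling over the outer surface, and `s = -1` for rolling inside the fixed
sphere (`ρ < σ`) or around it as a spherical shell (`σ < ρ`). -/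
theorem theorem2p1 (n : ℕ) (hn : 2 ≤ n) (m ρ σ s : ℝ) (hm : 0 < m) (hρ : 0 < ρ) (hσ : 0 < σ)
    (hs : s = 1 ∨ (s = -1 ∧ σ ≠ ρ))
    (D ε : ℝ) (hD : D = m * ρ ^ 2) (hε : ε = σ / (σ + s * ρ))
    (I : LieSO n →ₗ[ℝ] LieSO n) (hI : IsInertia I) :
    ((∀ haar : MeasureTheory.Measure (SO n), haar.IsHaarMeasure →
        HasInvariantMeasure (IsRolling I D ε) (phaseMeasure haar I D)) ∧
      HasInvariantMeasure (IsReducedRolling I D ε) (reducedMeasure I D)) ∧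
    (∀ a : Fin n → ℝ, (∀ i j, i ≠ j → 0 < a i * a j ∧ a i * a j < D) →
      (∀ i j, I (wedge (stdVec i) (stdVec j)) =
        (D * a i * a j / (D - a i * a j)) • wedge (stdVec i) (stdVec j)) →
      ∃ c : ℝ, 0 < c ∧ ∀ γ : UnitSphere n,
        mu I D γ =
          c * |dotProduct (coords γ) ((Matrix.diagonal a)⁻¹.mulVec (coords γ))| ^
            (((n : ℝ) - 2) / 2)) := by
  have hD0 : 0 < D := hD ▸ by positivity
  exact ⟨⟨fun haar _ => full_hasInvariantMeasure hI hD0.le ε hn haar,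
    reduced_hasInvariantMeasure hI hD0.le ε hn⟩, fun a ha hIa => mu_of_special hI hn ha hIa hD0⟩
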